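/- Let $A\in\mathbb{R}^{m\times n}$, $b\in\mathbb{R}^m$ and $c\in\mathbb{R}^n\setminus\{0\}$ be such that the polyhedron $\{x\in\mathbb{R}^n : Ax\le b\}$ is full-dimensional, the linear program $\max\{c^tx : Ax\le b\}$ has an optimal solution, $A$ has no zero rows, distinct inequalities define distinct affine hyperplanes, and the rows of $(A|b)$ are normalized (either the leftmost non-zero coefficient of every row is $\pm1$, or every row consists of coprime integers). The *reduced ILP graph* of $\mathrm{ILP}(A,b,c)$ is the labeled simple graph with a node $\alpha_{ij}$ for each position of $A$, a node $\rho_i$ for each row, a node $\zeta_j$ for each column, and nodes $\kappa_u,\lambda_v,\mu_w$ for the distinct coefficients $u$ of $A$, $v$ of $b$, $w$ of $c$. Its edges are $\alpha_{ij}\rho_i$, $\alpha_{ij}\zeta_j$, $\alpha_{ij}\kappa_{a_{ij}}$, $\rho_i\lambda_{b_i}$ and $\zeta_j\mu_{c_j}$. All $\alpha_{ij}$ share one label, all $\rho_i$ a second one, all $\zeta_j$ a third one, and each coefficient node has its own label, given by its kind ($\kappa$, $\lambda$ or $\mu$) and its coefficient. The *ILP graph* is obtained from it as follows. Add a twin $\hat\zeta_j$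 of each $\zeta_j$, a twin $\hat\alpha_{ij}$ of each $\alpha_{ij}$ with $a_{ij}\neq0$ (put $\hat\alpha_{ij}=\alpha_{ij}$ if $a_{ij}=0$), and nodes for the negatives of the coefficients of $A$ and of $c$ where these are missing. Add the edges $\hat\alpha_{ij}\rho_i$, $\hat\alpha_{ij}\hat\zeta_j$, $\hat\alpha_{ij}\kappa_{-a_{ij}}$, $\hat\zeta_j\mu_{-c_j}$ and $\zeta_j\hat\zeta_j$ for all $i,j$, and $\alpha_{ij}\hat\alpha_{ij}$ if $a_{ij}\ne0$. Twins have the same label, and the new coefficient nodes get their own labels. **Theorem.** The class of ILP graphs and the class of reduced ILP graphs are both graph isomorphism complete. That is, for each of the two classes $\mathcal{C}$, the problem of deciding whether two given graphs in $\mathcal{C}$ are isomorphic and the problem of deciding whether two arbitrary finite simple graphs are isomorphic are polynomial-time many-one reducible to each other. This holds both for isomorphisms of the underlying simple graphs and for isomorphisms that respect the node labels (where in an instance the labels of the two graphs are replaced by natural numbers, written in unary, different labels by different numbers). -/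

import Mathlib

namespace ILPGraphs

/-! ### Linear programs `max cᵗx, A x ≤ b` -/

section LinearPrograms

variable {m n : ℕ} (A : Matrix (Fin m) (Fin n) ℝ) (b : Fin m → ℝ) (c : Fin n → ℝ)

/-- The feasible region `P(A, b) = {x ∈ ℝⁿ | A x ≤ b}`. -/
def feasible : Set (Fin n → ℝ) := {x | A.mulVec x ≤ b}

/-- The affine hyperplane of the `i`-th inequality. -/
def hyperplane (i : Fin m) : Set (Fin n → ℝ) := {x | A.mulVec x i = b i}

/-- In every row of `A` the leftmost non-zero coefficient is `1` or `-1`. -/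
def LeadingUnit : Prop :=
  ∀ i j, A i j ≠ 0 → (∀ k, k < j → A i k = 0) → A i j = 1 ∨ A i j = -1

/-- Every row of the extended matrix `(A|b)` consists of coprime integers. -/
def CoprimeIntegral : Prop :=
  ∃ (Z : Matrix (Fin m) (Fin n) ℤ) (z : Fin m → ℤ),
    (∀ i j, A i j = (Z i j : ℝ)) ∧ (∀ i, b i = (z i : ℝ)) ∧
    ∀ i, ∀ d : ℤ, (∀ j, d ∣ Z i j) → d ∣ z i → IsUnit d

/-- The standing assumptions on `(A, b, c)`: the objective function is not zero, the feasible
region is full-dimensional (in particular not empty), the linear program has an optimal solution,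
there are no zero rows, distinct inequalities define distinct hyperplanes, and the rows of the
extended matrix are normalized (leftmost non-zero coefficient `±1`, or coprime integers). -/
structure Admissible : Prop where
  objective_ne_zero : c ≠ 0
  fullDimensional : (interior (feasible A b)).Nonempty
  exists_optimal : ∃ x ∈ feasible A b, ∀ y ∈ feasible A b, c ⬝ᵥ y ≤ c ⬝ᵥ x
  row_ne_zero : ∀ i, A i ≠ 0
  hyperplane_injective : Function.Injective (hyperplane A b)
  normalized : LeadingUnit A ∨ CoprimeIntegral A b

end LinearPrograms

/-! ### ILP graphs -/

/-- A simple graph with node labels in `L`. -/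
structure LabeledGraph (L : Type) where
  V : Type
  graph : SimpleGraph V
  label : V → L

/-- The labels: one for all positions, one for all rows, one for all columns, and an individual
one for each coefficient of the matrix, of the right hand side and of the objective function. -/
inductive Label : Type
  | pos
  | row
  | col
  | kappa (u : ℝ)
  | lam (v : ℝ)
  | mu (w : ℝ)

section Graphs

variable {m n : ℕ} (A : Matrix (Fin m) (Fin n) ℝ) (b : Fin m → ℝ) (c : Fin n → ℝ)

/-- The coefficients that occur in `A`. -/
def entries : Set ℝ := Set.range fun p : Fin m × Fin n => A p.1 p.2

/-- The nodes of the reduced ILP graph: positions `α_{ij}`, rows `ρ_i`, columns `ζ_j`, and one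
node for each distinct coefficient of `A`, `b` and `c`. -/
inductive ReducedNode : Type
  | pos (i : Fin m) (j : Fin n)
  | row (i : Fin m)
  | col (j : Fin n)
  | kappa (u : entries A)
  | lam (v : Set.range b)
  | mu (w : Set.range c)

/-- The edges of the reduced ILP graph, each listed in one direction. -/
inductive ReducedEdge : ReducedNode A b c → ReducedNode A b c → Prop
  | pos_row (i : Fin m) (j : Fin n) : ReducedEdge (.pos i j) (.row i)
  | pos_col (i : Fin m) (j : Fin n) : ReducedEdge (.pos i j) (.col j)
  | pos_kappa (i : Fin m) (j : Fin n) (u : entries A) (h : (u : ℝ) = A i j) :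
      ReducedEdge (.pos i j) (.kappa u)
  | row_lam (i : Fin m) (v : Set.range b) (h : (v : ℝ) = b i) : ReducedEdge (.row i) (.lam v)
  | col_mu (j : Fin n) (w : Set.range c) (h : (w : ℝ) = c j) : ReducedEdge (.col j) (.mu w)

/-- The label of a node of the reduced ILP graph. -/
def ReducedNode.label : ReducedNode A b c → Label
  | .pos _ _ => .pos
  | .row _ => .row
  | .col _ => .col
  | .kappa u => .kappa u
  | .lam v => .lam v
  | .mu w => .mu w

/-- The reduced ILP graph of `ILP(A, b, c)`. -/
def reducedILPGraph : LabeledGraph Label where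
  V := ReducedNode A b c
  graph := SimpleGraph.fromRel (ReducedEdge A b c)
  label := ReducedNode.label A b c

/-- The elements of a set of reals together with their negatives. -/
def signed (S : Set ℝ) : Set ℝ := {u | u ∈ S ∨ -u ∈ S}

/-- The nodes of the ILP graph.  Every column has a twin, every position of a non-zero coefficient
has a twin, and there are nodes for the coefficients of `A` and `c` and for their negatives. -/
inductive Node : Type
  | pos (i : Fin m) (j : Fin n)
  | posTwin (i : Fin m) (j : Fin n) (h : A i j ≠ 0)
  | row (i : Fin m)
  | col (j : Fin n)
  | colTwin (j : Fin n)
  | kappa (u : signed (entries A))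
  | lam (v : Set.range b)
  | mu (w : signed (Set.range c))

/-- The edges of the ILP graph, each listed in one direction.  A position with coefficient zero
is its own twin: it is adjacent to the column node and to its twin (`zero_colTwin`). -/
inductive Edge : Node A b c → Node A b c → Prop
  | pos_row (i : Fin m) (j : Fin n) : Edge (.pos i j) (.row i)
  | pos_col (i : Fin m) (j : Fin n) : Edge (.pos i j) (.col j)
  | pos_kappa (i : Fin m) (j : Fin n) (u : signed (entries A)) (h : (u : ℝ) = A i j) :
      Edge (.pos i j) (.kappa u)
  | row_lam (i : Fin m) (v : Set.range b) (h : (v : ℝ) = b i) : Edge (.row i) (.lam v)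
  | col_mu (j : Fin n) (w : signed (Set.range c)) (h : (w : ℝ) = c j) : Edge (.col j) (.mu w)
  | posTwin_row (i : Fin m) (j : Fin n) (h : A i j ≠ 0) : Edge (.posTwin i j h) (.row i)
  | posTwin_colTwin (i : Fin m) (j : Fin n) (h : A i j ≠ 0) :
      Edge (.posTwin i j h) (.colTwin j)
  | zero_colTwin (i : Fin m) (j : Fin n) (h : A i j = 0) : Edge (.pos i j) (.colTwin j)
  | posTwin_kappa (i : Fin m) (j : Fin n) (h : A i j ≠ 0) (u : signed (entries A))
      (hu : (u : ℝ) = -A i j) : Edge (.posTwin i j h) (.kappa u)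
  | colTwin_mu (j : Fin n) (w : signed (Set.range c)) (h : (w : ℝ) = -c j) :
      Edge (.colTwin j) (.mu w)
  | pos_posTwin (i : Fin m) (j : Fin n) (h : A i j ≠ 0) : Edge (.pos i j) (.posTwin i j h)
  | col_colTwin (j : Fin n) : Edge (.col j) (.colTwin j)

/-- The label of a node of the ILP graph; twins share their label. -/
def Node.label : Node A b c → Label
  | .pos _ _ => .pos
  | .posTwin _ _ _ => .pos
  | .row _ => .row
  | .col _ => .col
  | .colTwin _ => .col
  | .kappa u => .kappa u
  | .lam v => .lam v
  | .mu w => .mu w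

/-- The ILP graph of `ILP(A, b, c)`. -/
def ilpGraph : LabeledGraph Label where
  V := Node A b c
  graph := SimpleGraph.fromRel (Edge A b c)
  label := Node.label A b c

end Graphs

/-- The class of reduced ILP graphs. -/
def reducedILPGraphs : Set (LabeledGraph Label) :=
  {Γ | ∃ (m n : ℕ) (A : Matrix (Fin m) (Fin n) ℝ) (b : Fin m → ℝ) (c : Fin n → ℝ),
    Admissible A b c ∧ Γ = reducedILPGraph A b c}

/-- The class of ILP graphs. -/
def ilpGraphs : Set (LabeledGraph Label) :=
  {Γ | ∃ (m n : ℕ) (A : Matrix (Fin m) (Fin n) ℝ) (b : Fin m → ℝ) (c : Fin n → ℝ),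
    Admissible A b c ∧ Γ = ilpGraph A b c}

/-! ### Finite graphs as inputs of Turing machines -/

/-- A finite graph, presented by its number of nodes and a list of edges. -/
structure GraphCode where
  n : ℕ
  edges : List (Fin n × Fin n)

/-- The simple graph that is presented: orientation and repetition of the listed pairs are
irrelevant, and loops are ignored. -/
def GraphCode.graph (x : GraphCode) : SimpleGraph (Fin x.n) :=
  SimpleGraph.fromRel fun i j => (i, j) ∈ x.edges

/-- A finite graph with natural numbers as node labels. -/
structure LabeledGraphCode extends GraphCode where
  label : Fin n → ℕ

/-- Self-delimiting unary notation. -/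
def unary (k : ℕ) : List Bool := List.replicate k true ++ [false]

/-- The number of nodes, then each edge preceded by the bit `true`, then the bit `false`. -/
def GraphCode.encode (x : GraphCode) : List Bool :=
  unary x.n ++ x.edges.flatMap (fun e => true :: (unary e.1 ++ unary e.2)) ++ [false]

/-- The underlying graph, followed by the labels of its nodes. -/
def LabeledGraphCode.encode (x : LabeledGraphCode) : List Bool :=
  x.toGraphCode.encode ++ (List.ofFn x.label).flatMap unary

def encodePair (p : GraphCode × GraphCode) : List Bool := p.1.encode ++ p.2.encode

def encodeLabeledPair (p : LabeledGraphCode × LabeledGraphCode) : List Bool :=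
  p.1.encode ++ p.2.encode

/-! ### Isomorphism problems and polynomial-time reductions -/

/-- A decision problem whose inputs are known to satisfy a promise. -/
structure PromiseProblem (α : Type) where
  promise : α → Prop
  yes : α → Prop

/-- Polynomial-time many-one reducibility, with respect to encodings of the instances by bit
strings: a function that is computable in polynomial time on a Turing machine maps the
instances of `P` to instances of `Q` with the same answer. -/
def PolyReduces {α β : Type} (ea : α → List Bool) (eb : β → List Bool)
    (P : PromiseProblem α) (Q : PromiseProblem β) : Prop :=
  ∃ f : α → β, Nonempty (Turing.TM2ComputableInPolyTime ea eb f) ∧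
    ∀ x, P.promise x → Q.promise (f x) ∧ (P.yes x ↔ Q.yes (f x))

/-- The graph isomorphism problem for arbitrary finite simple graphs. -/
def graphIsomorphism : PromiseProblem (GraphCode × GraphCode) where
  promise _ := True
  yes p := Nonempty (p.1.graph ≃g p.2.graph)

/-- Deciding whether two graphs of a class are isomorphic as simple graphs. -/
def isomorphismProblem {L : Type} (C : Set (LabeledGraph L)) :
    PromiseProblem (GraphCode × GraphCode) where
  promise p :=
    (∃ Γ ∈ C, Nonempty (p.1.graph ≃g Γ.graph)) ∧ (∃ Γ ∈ C, Nonempty (p.2.graph ≃g Γ.graph))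
  yes p := Nonempty (p.1.graph ≃g p.2.graph)

/-- `x` presents the labeled graph `Γ`, where the number `ν l` stands for the label `l`. -/
def LabeledGraphCode.Presents {L : Type} (x : LabeledGraphCode) (ν : L → ℕ)
    (Γ : LabeledGraph L) : Prop :=
  ∃ e : x.graph ≃g Γ.graph, ∀ v, x.label v = ν (Γ.label (e v))

/-- Deciding whether two labeled graphs of a class are isomorphic by an isomorphism that respects
the labels.  In an instance, the labels of both graphs are named by natural numbers, in such a way
that different labels have different names. -/
def labeledIsomorphismProblem {L : Type} (C : Set (LabeledGraph L)) :
    PromiseProblem (LabeledGraphCode × LabeledGraphCode) where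
  promise p := ∃ Γ₁ ∈ C, ∃ Γ₂ ∈ C, ∃ ν : L → ℕ,
    Set.InjOn ν (Set.range Γ₁.label ∪ Set.range Γ₂.label) ∧
    p.1.Presents ν Γ₁ ∧ p.2.Presents ν Γ₂
  yes p := ∃ e : p.1.graph ≃g p.2.graph, ∀ v, p.2.label (e v) = p.1.label v

/-- A class of graphs is graph isomorphism complete if its isomorphism problem and the general
graph isomorphism problem are reducible to each other in polynomial time. -/
def GraphIsomorphismComplete {L : Type} (C : Set (LabeledGraph L)) : Prop :=
  PolyReduces encodePair encodePair graphIsomorphism (isomorphismProblem C) ∧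
  PolyReduces encodePair encodePair (isomorphismProblem C) graphIsomorphism

/-- The same with label-respecting isomorphisms of the graphs of the class. -/
def LabeledGraphIsomorphismComplete {L : Type} (C : Set (LabeledGraph L)) : Prop :=
  PolyReduces encodePair encodeLabeledPair graphIsomorphism (labeledIsomorphismProblem C) ∧
  PolyReduces encodeLabeledPair encodePair (labeledIsomorphismProblem C) graphIsomorphism

end ILPGraphs

/-! Membership. An unlabeled instance is already an instance of graph isomorphism, so the identity
is a reduction. Labels are eliminated by hanging `label + 2` leaves on every node: a leaf has one
neighbor, an old node at least two, so an isomorphism of the extended graphs maps old nodes to old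
nodes, and the number of leaves gives back the label (`exists_iso_of_leafGraph`).

Hardness. A graph `G` on `n` vertices is turned into a linear program. The rows are the vertices,
six padding vertices and one additional row; the columns are the ordered pairs of vertices or
padding vertices. Row `i` has the entry 2 in column `(u, v)` if `i` is `u` or `v` and moreover `u =
v` or `uv` is an edge of `G`. The additional row has the entry 2 exactly in the diagonal columns of
the padding vertices (the marked columns). All other entries are 1. The right hand side is 0, and
the objective equals the additional row. Positive entries make the negative orthant feasible, the
additional constraint says that the objective is at most 0, so that 0 is optimal, and the rows are
pairwise not proportional and each contain a 1 (`admissible`). Since no entry vanishes, passing to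
the ILP graph just doubles positions, columns and the coefficient nodes of matrix and objective.
Hence one family `gadget σ` covers both classes: `σ = 1` for reduced ILP graphs and `σ = 2` for ILP
graphs.

An isomorphism of graphs induces a label preserving isomorphism of gadgets (`gadgetIso`).
Conversely, `G` can be recovered from its gadget even without labels, by looking at degrees and
neighborhoods. Positions have degree at most 4, all other nodes at least 6, thanks to the padding.
Among the large nodes, the coefficients of the matrix are those with only small neighbors, and the
entry 2 is the rarer one. Rows have larger degree than columns. Unmarked columns are those whose
objective coefficient has more than six neighbors. Two rows that have an entry 2 in a common
unmarked column are exactly the rows of two equal or adjacent vertices of `G` (`linked_gadget_iff`),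
and every isomorphism respects this relation (`nonempty_iso_of_gadget`).

Polynomial time. Reductions are written in a small language of stack programs, which is compiled
step by step into multi-stack machines (`polyTime_of_run`). On top of it lies a calculus of bit
strings that can be output in polynomial time (`Emittable`), closed under concatenation, case
distinction and loops over ranges and tables. The level `ℓ` in it keeps the scratch stacks of nested
constructions apart. Output bits carry marks because a program cannot tell the bit `false` from the
bottom of a stack. -/

namespace ILPGraphs

open Function

/-! ### A small language of stack programs -/

/-- Programs that act on stacks of bits, indexed by `K`.  Both `loop` and `ite` pop the stack `k`
and test whether the popped symbol is `true`; an empty stack counts as `false`. -/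
inductive Prog (K : Type) : Type
  | skip
  | push (k : K) (b : Bool)
  | seq (p q : Prog K)
  | loop (k : K) (p : Prog K)
  | ite (k : K) (p q : Prog K)

/-- `Run p s t s'`: started on the stacks `s`, the program `p` ends after `t` steps
with the stacks `s'`. -/
inductive Run {K : Type} [DecidableEq K] :
    Prog K → (K → List Bool) → ℕ → (K → List Bool) → Prop
  | skip (s) : Run .skip s 1 s
  | push (k b s) : Run (.push k b) s 1 (update s k (b :: s k))
  | seq {p q s s' s'' t t'} : Run p s t s' → Run q s' t' s'' → Run (.seq p q) s (t + t') s''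
  | loop_done {k p s} : (s k).head? ≠ some true →
      Run (.loop k p) s 1 (update s k (s k).tail)
  | loop_step {k p s s' s'' t t'} : (s k).head? = some true →
      Run p (update s k (s k).tail) t s' → Run (.loop k p) s' t' s'' →
      Run (.loop k p) s (1 + t + t') s''
  | ite_true {k p q s s' t} : (s k).head? = some true →
      Run p (update s k (s k).tail) t s' → Run (.ite k p q) s (1 + t) s'
  | ite_false {k p q s s' t} : (s k).head? ≠ some true →
      Run q (update s k (s k).tail) t s' → Run (.ite k p q) s (1 + t) s'

namespace Prog

variable {K : Type}

/-- The control states of a program. -/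
def Lab : Prog K → Type
  | skip => Unit
  | push _ _ => Unit
  | seq p q => p.Lab ⊕ q.Lab
  | loop _ p => Option p.Lab
  | ite _ p q => Option (p.Lab ⊕ q.Lab)

/-- The initial control state. -/
def start : (p : Prog K) → p.Lab
  | skip => ()
  | push _ _ => ()
  | seq p _ => Sum.inl p.start
  | loop _ _ => none
  | ite _ _ _ => none

theorem finite_lab : (p : Prog K) → Finite p.Lab
  | skip => inferInstanceAs (Finite Unit)
  | push _ _ => inferInstanceAs (Finite Unit)
  | seq p q => by
      have := p.finite_lab; have := q.finite_lab
      exact inferInstanceAs (Finite (p.Lab ⊕ q.Lab))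
  | loop _ p => by
      have := p.finite_lab
      exact inferInstanceAs (Finite (Option p.Lab))
  | ite _ p q => by
      have := p.finite_lab; have := q.finite_lab
      exact inferInstanceAs (Finite (Option (p.Lab ⊕ q.Lab)))

/-- The stacks a program uses. -/
def regs [DecidableEq K] : Prog K → Finset K
  | skip => ∅
  | push k _ => {k}
  | seq p q => p.regs ∪ q.regs
  | loop k p => insert k p.regs
  | ite k p q => insert k (p.regs ∪ q.regs)

/-- Pop the stack `k` and jump to `l₁` or `l₂`. -/
def popGoto {K Λ : Type} (k : K) (l₁ l₂ : Λ) :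
    Turing.TM2.Stmt (fun _ : K => Bool) Λ (Option Bool) :=
  .pop k (fun _ x => x) <| .branch (fun v => v == some true)
    -- Resetting the internal state to `none` makes every jump arrive in a configuration of the form
    -- that `Run.steps` speaks about.
    (.load (fun _ => none) (.goto fun _ => l₁)) (.load (fun _ => none) (.goto fun _ => l₂))

/-- The translation of a program into statements of a multi-stack Turing machine: `emb` names the
control states, `exit` is the state to go to in the end. -/
def code {K' Λ : Type} (ρ : K → K') : (p : Prog K) → (p.Lab → Λ) → Λ → p.Lab →
    Turing.TM2.Stmt (fun _ : K' => Bool) Λ (Option Bool)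
  | skip, _, exit => fun _ => .goto fun _ => exit
  | push k b, _, exit => fun _ => .push (ρ k) (fun _ => b) (.goto fun _ => exit)
  | seq p q, emb, exit => fun l => match l with
      | .inl l => p.code ρ (fun l => emb (.inl l)) (emb (.inr q.start)) l
      | .inr l => q.code ρ (fun l => emb (.inr l)) exit l
  | loop k p, emb, exit => fun l => match l with
      | none => popGoto (ρ k) (emb (some p.start)) exit
      -- The exit of the body is the head of the loop, where the test is repeated.
      | some l => p.code ρ (fun l => emb (some l)) (emb none) l
  | ite k p q, emb, exit => fun l => match l with
      | none => popGoto (ρ k) (emb (some (.inl p.start))) (emb (some (.inr q.start)))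
      | some (.inl l) => p.code ρ (fun l => emb (some (.inl l))) exit l
      | some (.inr l) => q.code ρ (fun l => emb (some (.inr l))) exit l

end Prog

/-! ### Compilation of stack programs to Turing machines -/

section Simulation

open Turing

variable {K : Type} [DecidableEq K]

/-- `Steps M t c c'`: the machine `M` goes from `c` to `c'` in `t` steps. -/
def Steps {K' Λ σ : Type} [DecidableEq K'] (M : Λ → TM2.Stmt (fun _ : K' => Bool) Λ σ) (t : ℕ)
    (c c' : TM2.Cfg (fun _ : K' => Bool) Λ σ) : Prop :=
  (flip bind (TM2.step M))^[t] (some c) = some c'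

theorem Steps.trans {K' Λ σ : Type} [DecidableEq K'] {M : Λ → TM2.Stmt (fun _ : K' => Bool) Λ σ}
    {t t' : ℕ} {c c' c'' : TM2.Cfg (fun _ : K' => Bool) Λ σ}
    (h : Steps M t c c') (h' : Steps M t' c' c'') : Steps M (t + t') c c'' := by
  unfold Steps at *
  rw [Nat.add_comm, Function.iterate_add_apply, h, h']

variable {S : Finset K} {ρ : K → S}

/-- The index type `K` may be infinite while a machine has finitely many stacks. The machine
therefore works on the restriction of `s` to a finite set `S`, and `ρ` is a retraction onto `S`. -/
theorem restrict_update (hρ : ∀ k (h : k ∈ S), ρ k = ⟨k, h⟩) {k : K} (hk : k ∈ S) (s : K → List Bool) (l : List Bool) :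
    (fun i : S => update s k l i) = update (fun i : S => s i) (ρ k) l := by
  rw [hρ k hk]
  funext i
  by_cases h : i = ⟨k, hk⟩
  · subst h; simp
  · have : (i : K) ≠ k := fun h' => h (Subtype.ext h')
    simp [h, this]

theorem steps_popGoto (hρ : ∀ k (h : k ∈ S), ρ k = ⟨k, h⟩) {Λ : Type}
    {M : Λ → TM2.Stmt (fun _ : S => Bool) Λ (Option Bool)}
    {l l₁ l₂ : Λ} {k : K} (hk : k ∈ S) (hM : M l = Prog.popGoto (ρ k) l₁ l₂) (s : K → List Bool) :
    Steps M 1 ⟨some l, none, fun i => s i⟩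
      ⟨some (if (s k).head? = some true then l₁ else l₂), none,
        fun i => update s k (s k).tail i⟩ := by
  have hs : s (ρ k : K) = s k := by rw [hρ k hk]
  rw [restrict_update hρ hk]
  simp only [Steps, Function.iterate_one, flip, Option.bind_eq_bind, Option.bind_some, TM2.step,
    hM, Prog.popGoto, TM2.stepAux, hs]
  by_cases h : (s k).head? = some true
  · simp [h]
  · rw [beq_eq_false_iff_ne.2 h, if_neg h]; rfl

/-- Correctness of the compilation, by induction on the run; the step counts agree exactly. The
machine, the embedding of the control states and the exit are arbitrary, because the induction
hypotheses are applied to subprograms that sit inside the same large machine. -/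
theorem Run.steps (hρ : ∀ k (h : k ∈ S), ρ k = ⟨k, h⟩) {p : Prog K} {s s' : K → List Bool} {t : ℕ} (h : Run p s t s') :
    ∀ {Λ : Type} {M : Λ → TM2.Stmt (fun _ : S => Bool) Λ (Option Bool)} {emb : p.Lab → Λ}
      {exit : Λ}, p.regs ⊆ S → (∀ l, M (emb l) = p.code ρ emb exit l) →
      Steps M t ⟨some (emb p.start), none, fun i => s i⟩ ⟨some exit, none, fun i => s' i⟩ := by
  induction h with
  | skip s =>
    intro Λ M emb exit _ hM
    simp [Steps, flip, TM2.step, hM, Prog.code]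
  | push k b s =>
    intro Λ M emb exit hS hM
    have hk : k ∈ S := hS (by simp [Prog.regs])
    rw [restrict_update hρ hk]
    simp [Steps, flip, TM2.step, hM, Prog.code, hρ k hk]
  | seq _ _ ih₁ ih₂ =>
    intro Λ M emb exit hS hM
    refine (ih₁ (emb := fun l => emb (.inl l)) (fun x hx => hS ?_) fun l => hM (.inl l)).trans
      (ih₂ (emb := fun l => emb (.inr l)) (fun x hx => hS ?_) fun l => hM (.inr l)) <;>
    simp [Prog.regs, hx]
  | @loop_done k p s hd =>
    intro Λ M emb exit hS hM
    have := steps_popGoto hρ (hS (by simp [Prog.regs])) (hM none) s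
    rw [if_neg hd] at this
    exact this
  | @loop_step k p s s' s'' t t' hd _ _ ih₁ ih₂ =>
    intro Λ M emb exit hS hM
    have := steps_popGoto hρ (hS (by simp [Prog.regs])) (hM none) s
    rw [if_pos hd] at this
    refine Steps.trans (Steps.trans ?_
      (ih₁ (emb := fun l => emb (some l)) (fun x hx => hS ?_) fun l => hM (some l))) (ih₂ hS hM)
    · exact this
    · simp [Prog.regs, hx]
  | @ite_true k p q s s' t hd _ ih =>
    intro Λ M emb exit hS hM
    have := steps_popGoto hρ (hS (by simp [Prog.regs])) (hM none) s
    rw [if_pos hd] at this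
    refine Steps.trans ?_
      (ih (emb := fun l => emb (some (.inl l))) (fun x hx => hS ?_) fun l => hM (some (.inl l)))
    · exact this
    · simp [Prog.regs, hx]
  | @ite_false k p q s s' t hd _ ih =>
    intro Λ M emb exit hS hM
    have := steps_popGoto hρ (hS (by simp [Prog.regs])) (hM none) s
    rw [if_neg hd] at this
    refine Steps.trans ?_
      (ih (emb := fun l => emb (some (.inr l))) (fun x hx => hS ?_) fun l => hM (some (.inr l)))
    · exact this
    · simp [Prog.regs, hx]

/-- The machine that runs a program and halts. -/
noncomputable def Prog.machine (p : Prog K) (inp fin : K) : FinTM2 :=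
  haveI : Fintype (Option p.Lab) :=
    haveI := p.finite_lab
    Fintype.ofFinite _
  { K := (insert inp (insert fin p.regs) : Finset K)
    k₀ := ⟨inp, by simp⟩
    k₁ := ⟨fin, by simp⟩
    Γ := fun _ => Bool
    Λ := Option p.Lab
    main := some p.start
    σ := Option Bool
    initialState := none
    Γk₀Fin := inferInstanceAs (Fintype Bool)
    m := fun l => match l with
      | none => .halt
      | some l => p.code
          -- Outside the finite set of stacks the value is junk, which is harmless since the program
          -- only touches `p.regs`.
          (fun k => if h : k ∈ insert inp (insert fin p.regs) then ⟨k, h⟩ else ⟨inp, by simp⟩)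
          some none l }

/-- The separate list `l'` is there because the input of the machine appears as `List.map id l`. -/
theorem Prog.initList_machine (p : Prog K) (inp fin : K) {l l' : List Bool} (h : l' = l) :
    initList (p.machine inp fin) l' =
      (⟨some (some p.start), none, fun i => update (fun _ => []) inp l i.1⟩ :
        TM2.Cfg (fun _ => Bool) _ _) := by
  subst h
  unfold initList
  congr 1
  funext k
  obtain ⟨k, hk⟩ := k
  by_cases hki : k = inp
  · subst hki; simp only [update_self]; exact dif_pos rfl
  · simp only [update_of_ne hki]; exact dif_neg fun h => hki (congrArg Subtype.val h)

theorem Prog.haltList_machine (p : Prog K) (inp fin : K) {l l' : List Bool} (h : l' = l) :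
    haltList (p.machine inp fin) l' =
      (⟨none, none, fun i => update (fun _ => []) fin l i.1⟩ :
        TM2.Cfg (fun _ => Bool) _ _) := by
  subst h
  unfold haltList
  congr 1
  funext k
  obtain ⟨k, hk⟩ := k
  by_cases hki : k = fin
  · subst hki; simp only [update_self]; exact dif_pos rfl
  · simp only [update_of_ne hki]; exact dif_neg fun h => hki (congrArg Subtype.val h)

/-- A function is computable in polynomial time if some program computes it in polynomial time. -/
theorem polyTime_of_run {α β : Type} {ea : α → List Bool} {eb : β → List Bool} {f : α → β}
    (p : Prog K) (inp fin : K) (P : Polynomial ℕ)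
    (h : ∀ a, ∃ t ≤ P.eval (ea a).length,
      Run p (update (fun _ => []) inp (ea a)) t (update (fun _ => []) fin (eb (f a)))) :
    Nonempty (TM2ComputableInPolyTime ea eb f) := by
  have hM : ∀ a, ∃ t ≤ (P + 1).eval (ea a).length, Steps (p.machine inp fin).m t
      (initList (p.machine inp fin) ((ea a).map id))
      (haltList (p.machine inp fin) ((eb (f a)).map id)) := by
    intro a
    obtain ⟨t, ht, hr⟩ := h a
    have h1 := hr.steps (S := insert inp (insert fin p.regs))
      (ρ := fun k => if h : k ∈ insert inp (insert fin p.regs) then ⟨k, h⟩ else ⟨inp, by simp⟩)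
      (fun k hk => by simp [hk]) (M := (p.machine inp fin).m) (emb := some) (exit := none)
      (fun x hx => by simp [hx]) (fun l => rfl)
    -- The extra step executes `halt` in the exit state `none`.
    refine ⟨t + 1, by simpa using ht, ?_⟩
    have e₁ := p.initList_machine inp fin (List.map_id (ea a))
    have e₂ := p.haltList_machine inp fin (List.map_id (eb (f a)))
    exact (congrArg₂ (Steps (p.machine inp fin).m (t + 1)) e₁ e₂).mpr (h1.trans rfl)
  refine ⟨⟨⟨p.machine inp fin, Equiv.refl Bool, Equiv.refl Bool⟩, P + 1, fun a =>
    ⟨⟨(hM a).choose, ?_⟩, (hM a).choose_spec.1⟩⟩⟩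
  exact (hM a).choose_spec.2

end Simulation

end ILPGraphs

namespace ILPGraphs

open Function

/-! ### Time bounds -/

section RunsIn

variable {K : Type} [DecidableEq K]

/-- The program `p` leads from `s` to `s'` in at most `T` steps. -/
def RunsIn (p : Prog K) (s s' : K → List Bool) (T : ℕ) : Prop := ∃ t ≤ T, Run p s t s'

theorem RunsIn.mono {p : Prog K} {s s' : K → List Bool} {T T' : ℕ} (h : RunsIn p s s' T)
    (hT : T ≤ T') : RunsIn p s s' T' :=
  let ⟨t, ht, hr⟩ := h
  ⟨t, ht.trans hT, hr⟩

theorem RunsIn.skip (s : K → List Bool) : RunsIn .skip s s 1 := ⟨1, le_rfl, .skip s⟩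

theorem RunsIn.push (k : K) (b : Bool) (s : K → List Bool) :
    RunsIn (.push k b) s (update s k (b :: s k)) 1 := ⟨1, le_rfl, .push k b s⟩

theorem RunsIn.seq {p q : Prog K} {s s' s'' : K → List Bool} {T T' : ℕ}
    (h : RunsIn p s s' T) (h' : RunsIn q s' s'' T') : RunsIn (.seq p q) s s'' (T + T') :=
  let ⟨t, ht, hr⟩ := h
  let ⟨t', ht', hr'⟩ := h'
  ⟨t + t', Nat.add_le_add ht ht', .seq hr hr'⟩

theorem RunsIn.ite_true {p q : Prog K} {k : K} {s s' : K → List Bool} {T : ℕ} {l : List Bool}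
    (hs : s k = true :: l) (h : RunsIn p (update s k l) s' T) :
    RunsIn (.ite k p q) s s' (1 + T) :=
  let ⟨t, ht, hr⟩ := h
  ⟨1 + t, Nat.add_le_add_left ht 1, .ite_true (by simp [hs]) (by simpa [hs] using hr)⟩

theorem RunsIn.ite_false {p q : Prog K} {k : K} {s s' : K → List Bool} {T : ℕ}
    (hs : (s k).head? ≠ some true) (h : RunsIn q (update s k (s k).tail) s' T) :
    RunsIn (.ite k p q) s s' (1 + T) :=
  let ⟨t, ht, hr⟩ := h
  ⟨1 + t, Nat.add_le_add_left ht 1, .ite_false hs hr⟩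

/-- A loop whose successive states are `σ 0, …, σ n`. -/
theorem RunsIn.loop {p : Prog K} {k : K} {B : ℕ} {n : ℕ} (σ : ℕ → K → List Bool)
    (h : ∀ j < n, ∃ l, σ j k = true :: l ∧ RunsIn p (update (σ j) k l) (σ (j + 1)) B)
    (hn : (σ n k).head? ≠ some true) :
    RunsIn (.loop k p) (σ 0) (update (σ n) k (σ n k).tail) (n * (B + 1) + 1) := by
  induction n generalizing σ with
  | zero => exact ⟨1, by simp, .loop_done hn⟩
  | succ n ih =>
    obtain ⟨l, hl, t, ht, hr⟩ := h 0 (by simp)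
    obtain ⟨t', ht', hr'⟩ := ih (fun j => σ (j + 1)) (fun j hj => h (j + 1) (by omega)) hn
    exact ⟨1 + t + t', by rw [Nat.succ_mul]; omega,
      .loop_step (by simp [hl]) (by simpa [hl] using hr) hr'⟩

/-- A step pushes at most one symbol. Thus a time bound is also a bound for the length of the
output, and no separate estimate of the computed numbers is needed. -/
theorem Run.length_le {p : Prog K} {s s' : K → List Bool} {t : ℕ} (h : Run p s t s') (k : K) :
    (s' k).length ≤ (s k).length + t := by
  have pop : ∀ (s : K → List Bool) (k' : K),
      (update s k' (s k').tail k).length ≤ (s k).length := by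
    intro s k'
    by_cases h : k = k'
    · subst h; simp
    · simp [h]
  induction h with
  | skip s => simp
  | push k' b s =>
    by_cases h : k = k'
    · subst h; simp
    · simp [h]
  | seq _ _ ih₁ ih₂ => omega
  | loop_done => exact (pop _ _).trans (by simp)
  | @loop_step k' _ s _ _ _ _ _ _ _ ih₁ ih₂ => have := pop s k'; omega
  | @ite_true k' _ _ s _ _ _ _ ih => have := pop s k'; omega
  | @ite_false k' _ _ s _ _ _ _ ih => have := pop s k'; omega

/-- Move a unary number from one stack to another. -/
theorem RunsIn.move {k k' : K} (hk : k ≠ k') (n : ℕ) (l : List Bool) (hl : l.head? ≠ some true)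
    (s : K → List Bool) (hs : s k = List.replicate n true ++ l) :
    RunsIn (.loop k (.push k' true)) s
      (update (update s k l.tail) k' (List.replicate n true ++ s k')) (n * 2 + 1) := by
  convert RunsIn.loop (k := k) (p := .push k' true) (B := 1) (n := n)
    (fun j => update (update s k (List.replicate (n - j) true ++ l)) k'
      (List.replicate j true ++ s k')) ?_ ?_ using 1
  · funext r
    simp only [update_apply]
    split_ifs <;> simp_all
  · funext r
    simp only [update_apply]
    split_ifs <;> simp_all
  · intro j hj
    refine ⟨List.replicate (n - (j + 1)) true ++ l, ?_, ?_⟩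
    · have : n - j = (n - (j + 1)) + 1 := by omega
      simp [hk, this, List.replicate_succ]
    · convert RunsIn.push k' true _ using 1
      funext r
      simp only [update_apply]
      split_ifs <;> simp_all [List.replicate_succ]
  · simp [hk, hl]

/-- Clear a stack that holds a unary number. -/
theorem RunsIn.clear {k : K} (n : ℕ) (l : List Bool) (hl : l.head? ≠ some true)
    (s : K → List Bool) (hs : s k = List.replicate n true ++ l) :
    RunsIn (.loop k .skip) s (update s k l.tail) (n * 2 + 1) := by
  convert RunsIn.loop (k := k) (p := .skip) (B := 1) (n := n)
    (fun j => update s k (List.replicate (n - j) true ++ l)) ?_ ?_ using 1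
  · funext r
    simp only [update_apply]
    split_ifs <;> simp_all
  · simp
  · intro j hj
    refine ⟨List.replicate (n - (j + 1)) true ++ l, ?_, ?_⟩
    · have : n - j = (n - (j + 1)) + 1 := by omega
      simp [this, List.replicate_succ]
    · simp only [update_idem]
      exact RunsIn.skip _
  · simp [hl]

theorem RunsIn.congr {p : Prog K} {s s' s'' : K → List Bool} {T : ℕ} (h : RunsIn p s s' T)
    (hs : s' = s'') : RunsIn p s s'' T := hs ▸ h

end RunsIn

/-! ### Registers and environments -/

/-- The stacks of our machines: input, output (reversed and final), an auxiliary stack, tables of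
pairs of numbers, variables, and three kinds of stacks for intermediate results. -/
inductive Reg : Type
  | inp
  | out
  | fin
  | aux
  | tab (t : ℕ)
  | var (i : ℕ)
  | tmp (l : ℕ)
  | acc (l : ℕ)
  | sav (l : ℕ)
  deriving DecidableEq

/-- The values of the variables and of the tables. -/
structure Env where
  var : ℕ → ℕ
  tab : ℕ → List (ℕ × ℕ)

/-- Assign the value `k` to the variable `x`. -/
def Env.set (e : Env) (x k : ℕ) : Env := ⟨fun i => if i = x then k else e.var i, e.tab⟩

/-- All numbers in the environment and the lengths of the tables are at most `M`. -/
def Env.Bdd (e : Env) (M : ℕ) : Prop :=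
  (∀ i, e.var i ≤ M) ∧ ∀ t, (e.tab t).length ≤ M ∧ ∀ a ∈ e.tab t, a.1 ≤ M ∧ a.2 ≤ M

/-- A table as a bit string. -/
def tableCode (L : List (ℕ × ℕ)) : List Bool :=
  L.flatMap fun e => true :: (unary e.1 ++ unary e.2)

/-- The stacks `s` hold the environment `e`, and the stacks for intermediate results of level at
least `ℓ` are empty. -/
structure Rep (e : Env) (ℓ : ℕ) (s : Reg → List Bool) : Prop where
  var : ∀ i, s (.var i) = List.replicate (e.var i) true
  tab : ∀ t, s (.tab t) = tableCode (e.tab t)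
  aux : s .aux = []
  tmp : ∀ i, ℓ ≤ i → s (.tmp i) = []
  acc : ∀ i, ℓ ≤ i → s (.acc i) = []
  sav : ∀ i, ℓ ≤ i → s (.sav i) = []

/-- The stacks that may serve for the output of a program of level `ℓ`. -/
inductive IsOut (ℓ : ℕ) : Reg → Prop
  | out : IsOut ℓ .out
  | acc (i : ℕ) (h : i < ℓ) : IsOut ℓ (.acc i)

theorem IsOut.mono {ℓ ℓ' : ℕ} {o : Reg} (h : IsOut ℓ o) (hl : ℓ ≤ ℓ') : IsOut ℓ' o := by
  cases h with
  | out => exact .out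
  | acc i h => exact .acc i (by omega)

/-- Output is stored in reverse order, with a mark on each bit. -/
def marked (L : List Bool) : List Bool := L.reverse.flatMap fun b => [true, b]

theorem marked_append (L L' : List Bool) : marked (L ++ L') = marked L' ++ marked L := by
  simp [marked]

/-- A number that has been output in unary occupies twice as many symbols, all of them `true`. This
is the source of the factors 2 in the loops that consume such a number. -/
theorem marked_replicate (n : ℕ) : marked (List.replicate n true) = List.replicate (2 * n) true := by
  induction n with
  | zero => rfl
  | succ n ih =>
    rw [List.replicate_succ', marked_append, ih, Nat.mul_succ]
    simp [marked, List.replicate_succ]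

/-- Append `L` to the output on the stack `o`. -/
def output (o : Reg) (L : List Bool) (s : Reg → List Bool) : Reg → List Bool :=
  update s o (marked L ++ s o)

theorem output_append (o : Reg) (L L' : List Bool) (s : Reg → List Bool) :
    output o (L ++ L') s = output o L' (output o L s) := by
  simp [output, marked_append]

theorem output_nil (o : Reg) (s : Reg → List Bool) : output o [] s = s := by
  simp [output, marked]

/-- The stacks that are irrelevant for the representation of an environment at level `ℓ`. -/
def IsScratch (ℓ : ℕ) : Reg → Prop
  | .inp | .out | .fin => True
  | .tmp i | .acc i | .sav i => i < ℓ
  | _ => False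

theorem IsOut.isScratch {ℓ : ℕ} {o : Reg} (h : IsOut ℓ o) : IsScratch ℓ o := by
  cases h with
  | out => trivial
  | acc i h => exact h

theorem Rep.update {e : Env} {ℓ : ℕ} {s : Reg → List Bool} (h : Rep e ℓ s) {r : Reg}
    (hr : IsScratch ℓ r) (L : List Bool) : Rep e ℓ (update s r L) := by
  have key : ∀ r', ¬ IsScratch ℓ r' → Function.update s r L r' = s r' := by
    intro r' hr'
    refine update_of_ne ?_ _ _
    rintro rfl
    exact hr' hr
  constructor
  · intro i; rw [key (.var i) id, h.var]
  · intro i; rw [key (.tab i) id, h.tab]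
  · rw [key .aux id, h.aux]
  · intro i hi; rw [key (.tmp i) hi.not_gt, h.tmp i hi]
  · intro i hi; rw [key (.acc i) hi.not_gt, h.acc i hi]
  · intro i hi; rw [key (.sav i) hi.not_gt, h.sav i hi]

theorem Rep.output {e : Env} {ℓ : ℕ} {s : Reg → List Bool} (h : Rep e ℓ s) {o : Reg}
    (ho : IsOut ℓ o) (L : List Bool) : Rep e ℓ (output o L s) := h.update ho.isScratch _

theorem Rep.set {e : Env} {ℓ : ℕ} {s : Reg → List Bool} (h : Rep e ℓ s) (x k : ℕ) :
    Rep (e.set x k) ℓ (Function.update s (.var x) (List.replicate k true)) := by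
  constructor
  case var =>
    intro i
    by_cases hi : i = x
    · subst hi; simp [Env.set]
    · simp [Env.set, hi, h.var]
  all_goals intros; simp [Env.set, h.tab, h.aux, h.tmp, h.acc, h.sav, *]

theorem Rep.mono {e : Env} {ℓ ℓ' : ℕ} {s : Reg → List Bool} (h : Rep e ℓ s) (hl : ℓ ≤ ℓ') :
    Rep e ℓ' s :=
  ⟨h.var, h.tab, h.aux, fun i hi => h.tmp i (hl.trans hi), fun i hi => h.acc i (hl.trans hi),
    fun i hi => h.sav i (hl.trans hi)⟩

/-- For environments in `D`, the bit string `f e` can be output in polynomial time. -/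
def EmittableOn (D : Env → Prop) (f : Env → List Bool) : Prop :=
  ∀ ℓ, ∃ (p : Reg → Prog Reg) (P : Polynomial ℕ), ∀ e M s o, D e → e.Bdd M → Rep e ℓ s →
    IsOut ℓ o → RunsIn (p o) s (output o (f e) s) (P.eval M)

/-- The bit string `f e` can be output in polynomial time. -/
def Emittable (f : Env → List Bool) : Prop := EmittableOn (fun _ => True) f

/-- The number `h e` can be output in unary in polynomial time. -/
def Num (h : Env → ℕ) : Prop := Emittable fun e => List.replicate (h e) true

/-- The condition `b` can be tested in polynomial time. -/
def Testable (b : Env → Prop) : Prop := ∃ f, Emittable f ∧ ∀ e, b e ↔ f e ≠ []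

end ILPGraphs

namespace ILPGraphs

open Function

/-! ### Building blocks of output programs -/

theorem Emittable.congr {f g : Env → List Bool} (hf : Emittable f) (h : ∀ e, f e = g e) :
    Emittable g := (funext h : f = g) ▸ hf

theorem EmittableOn.mono {D D' : Env → Prop} {f : Env → List Bool} (hf : EmittableOn D f)
    (h : ∀ e, D' e → D e) : EmittableOn D' f := fun ℓ =>
  let ⟨p, P, hp⟩ := hf ℓ
  ⟨p, P, fun e M s o hD => hp e M s o (h e hD)⟩

theorem Emittable.nil : Emittable fun _ => [] := fun _ =>
  ⟨fun _ => .skip, 1, fun _ _ s o _ _ _ _ => by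
    rw [output_nil]; simpa using RunsIn.skip s⟩

theorem Emittable.bit (b : Bool) : Emittable fun _ => [b] := fun _ =>
  ⟨fun o => .seq (.push o b) (.push o true), 2, fun _ _ s o _ _ _ _ => by
    have := (RunsIn.push o b s).seq (RunsIn.push o true _)
    simpa [output, marked] using this⟩

theorem EmittableOn.append {D : Env → Prop} {f g : Env → List Bool} (hf : EmittableOn D f)
    (hg : EmittableOn D g) : EmittableOn D fun e => f e ++ g e := by
  intro ℓ
  obtain ⟨p, P, hp⟩ := hf ℓ
  obtain ⟨q, Q, hq⟩ := hg ℓ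
  refine ⟨fun o => .seq (p o) (q o), P + Q, fun e M s o hD hM hs ho => ?_⟩
  rw [output_append, Polynomial.eval_add]
  exact (hp e M s o hD hM hs ho).seq (hq e M _ o hD hM (hs.output ho _) ho)

theorem Emittable.append {f g : Env → List Bool} (hf : Emittable f) (hg : Emittable g) :
    Emittable fun e => f e ++ g e := EmittableOn.append hf hg

/-- Reading a stack destroys it. The variable is first moved to the auxiliary stack and then
restored from there, with two symbols of marked output pushed for each unit. -/
theorem Num.var (y : ℕ) : Num fun e => e.var y := by
  intro ℓ
  refine ⟨fun o => .seq (.loop (.var y) (.push .aux true))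
    (.loop .aux (.seq (.push (.var y) true) (.seq (.push o true) (.push o true)))),
    .X * 2 + 1 + (.X * 4 + 1), fun e M s o _ hM hs ho => ?_⟩
  have h1 := RunsIn.move (k := Reg.var y) (k' := .aux) (by simp) (e.var y) [] (by simp) s
    (by simp [hs.var])
  have hoa : o ≠ .aux := by rintro rfl; cases ho
  have hov : o ≠ .var y := by rintro rfl; cases ho
  refine (h1.seq (RunsIn.congr (s' := update (output o (List.replicate (e.var y) true) s) .aux [])
    ?_ ?_)).mono (T := e.var y * 2 + 1 + (e.var y * 4 + 1)) ?_
  · convert RunsIn.loop (k := Reg.aux) (B := 3) (n := e.var y)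
      (p := .seq (.push (.var y) true) (.seq (.push o true) (.push o true)))
      (fun j => output o (List.replicate j true) (update (update s .aux
        (List.replicate (e.var y - j) true)) (.var y) (List.replicate j true))) ?_ ?_ using 1
    · simp only [List.replicate_zero, output_nil, hs.aux, List.tail_nil, List.append_nil,
        Nat.sub_zero]
      exact update_comm (by simp) _ _ _
    · funext r
      simp only [output, update_apply]
      split_ifs <;> simp_all [hs.var, hs.aux]
    · intro j hj
      refine ⟨List.replicate (e.var y - (j + 1)) true, ?_, ?_⟩
      · have : e.var y - j = (e.var y - (j + 1)) + 1 := by omega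
        simp [output, hoa.symm, this, List.replicate_succ]
      · refine RunsIn.congr ((RunsIn.push _ _ _).seq ((RunsIn.push _ _ _).seq
          (RunsIn.push _ _ _))) ?_
        funext r
        simp only [output, update_apply, marked_replicate, Nat.mul_succ]
        split_ifs <;> simp_all [List.replicate_succ]
    · simp [output, hoa.symm]
  · funext r
    by_cases hr : r = .aux
    · subst hr; simp [output, hoa.symm, hs.aux]
    · simp [hr]
  · simp only [Polynomial.eval_add, Polynomial.eval_mul, Polynomial.eval_X,
      Polynomial.eval_ofNat, Polynomial.eval_one]
    have := hM.1 y
    omega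

theorem Num.const (n : ℕ) : Num fun _ => n := by
  induction n with
  | zero => exact Emittable.nil
  | succ n ih =>
    exact (Emittable.append ih (Emittable.bit true)).congr fun e => by
      rw [List.replicate_succ']

theorem Num.add {h h' : Env → ℕ} (hh : Num h) (hh' : Num h') : Num fun e => h e + h' e :=
  (Emittable.append hh hh').congr fun e => by rw [List.replicate_add]

theorem Num.unary {h : Env → ℕ} (hh : Num h) : Emittable fun e => unary (h e) :=
  Emittable.append hh (Emittable.bit false)

theorem Env.Bdd.mono {e : Env} {M M' : ℕ} (h : e.Bdd M) (hM : M ≤ M') : e.Bdd M' :=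
  ⟨fun i => (h.1 i).trans hM, fun t => ⟨(h.2 t).1.trans hM, fun a ha =>
    ⟨((h.2 t).2 a ha).1.trans hM, ((h.2 t).2 a ha).2.trans hM⟩⟩⟩

theorem Env.Bdd.set {e : Env} {M : ℕ} (h : e.Bdd M) (x : ℕ) {k : ℕ} (hk : k ≤ M) :
    (e.set x k).Bdd M :=
  ⟨fun i => by by_cases hi : i = x <;> simp [Env.set, hi, hk, h.1], h.2⟩

/-- A variable may be used locally. -/
theorem EmittableOn.save {D : Env → Prop} {f : Env → List Bool} (x : ℕ)
    (hf : EmittableOn (fun e => e.var x = 0 ∧ D e) f) (hD : ∀ e, D e → D (e.set x 0)) :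
    EmittableOn D fun e => f (e.set x 0) := by
  intro ℓ
  -- The inner program runs one level higher, since `sav ℓ` holds the old value of `x` meanwhile.
  obtain ⟨p, P, hp⟩ := hf (ℓ + 1)
  refine ⟨fun o => .seq (.loop (.var x) (.push (.sav ℓ) true))
    (.seq (p o) (.loop (.sav ℓ) (.push (.var x) true))),
    .X * 2 + 1 + (P + (.X * 2 + 1)), fun e M s o he hM hs ho => ?_⟩
  have hov : o ≠ .var x := by rintro rfl; cases ho
  have hos : o ≠ .sav ℓ := by rintro rfl; cases ho
  have h1 := RunsIn.move (k := Reg.var x) (k' := .sav ℓ) (by simp) (e.var x) [] (by simp) s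
    (by simp [hs.var])
  rw [hs.sav ℓ le_rfl, List.append_nil, List.tail_nil] at h1
  set s₁ := update (update s (.var x) []) (.sav ℓ) (List.replicate (e.var x) true) with hs₁
  have hs₁' : Rep (e.set x 0) (ℓ + 1) s₁ :=
    ((hs.mono (Nat.le_succ ℓ)).set x 0).update (r := .sav ℓ) (Nat.lt_succ_self ℓ) _
  have h2 := hp (e.set x 0) M s₁ o ⟨by simp [Env.set], hD e he⟩ (hM.set x (by simp)) hs₁'
    (ho.mono (Nat.le_succ ℓ))
  have h3 := RunsIn.move (k := Reg.sav ℓ) (k' := .var x) (by simp) (e.var x) [] (by simp)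
    (output o (f (e.set x 0)) s₁) (by simp [output, hos.symm, hs₁])
  refine ((h1.seq (h2.seq h3)).congr ?_).mono ?_
  · funext r
    simp only [output, update_apply, hs₁]
    have := hs.var x
    have := hs.sav ℓ le_rfl
    split_ifs <;> simp_all
  · simp only [Polynomial.eval_add, Polynomial.eval_mul, Polynomial.eval_X,
      Polynomial.eval_ofNat, Polynomial.eval_one]
    have := hM.1 x
    omega

/-- The bound `h e` is computed on the stack `acc ℓ`, which then serves as a countdown, while `x`
counts up. The bound is stored with marks, so each round pops twice: once by the loop and once by
the `ite`. -/
theorem EmittableOn.forRange {x : ℕ} {h : Env → ℕ} {g : Env → List Bool} (hh : Num h)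
    (hg : Emittable g) : EmittableOn (fun e => e.var x = 0)
      fun e => (List.range (h e)).flatMap fun k => g (e.set x k) := by
  intro ℓ
  obtain ⟨p, P, hp⟩ := hh (ℓ + 1)
  obtain ⟨q, Q, hq⟩ := hg (ℓ + 1)
  refine ⟨fun o => .seq (p (.acc ℓ)) (.seq (.loop (.acc ℓ)
    (.ite (.acc ℓ) (.seq (q o) (.push (.var x) true)) .skip)) (.loop (.var x) .skip)),
    -- During the loop `x` may exceed `M`, but it stays below `h e`, which is at most `P.eval M`. So
    -- the body is run in environments bounded by `M + P.eval M`, whence the composition.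
    P + ((P * (Q.comp (.X + P) + 3) + 1) + (P * 2 + 1)), fun e M s o he hM hs ho => ?_⟩
  have hov : o ≠ .var x := by rintro rfl; cases ho
  have hoa : o ≠ .acc ℓ := by rintro rfl; cases ho; omega
  have hs' : Rep e (ℓ + 1) s := hs.mono (Nat.le_succ ℓ)
  have ho' : IsOut (ℓ + 1) o := ho.mono (Nat.le_succ ℓ)
  have hacc : IsOut (ℓ + 1) (.acc ℓ) := .acc ℓ (by omega)
  have h1 := hp e M s (.acc ℓ) trivial hM hs' hacc
  have hle : h e ≤ P.eval M := by
    obtain ⟨t, ht, hr⟩ := h1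
    have := hr.length_le (.acc ℓ)
    simp [output, marked_replicate] at this
    omega
  have h1' : output (.acc ℓ) (List.replicate (h e) true) s =
      update s (.acc ℓ) (List.replicate (2 * h e) true) := by
    simp [output, hs.acc ℓ le_rfl, marked_replicate]
  set F : ℕ → List Bool := fun j => (List.range j).flatMap fun k => g (e.set x k) with hF
  have hx : s (.var x) = [] := by rw [hs.var, he]; rfl
  have h2 := RunsIn.loop (k := Reg.acc ℓ) (B := Q.eval (M + P.eval M) + 2) (n := h e)
    (p := .ite (.acc ℓ) (.seq (q o) (.push (.var x) true)) .skip)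
    (fun j => output o (F j) (update (update s (.acc ℓ)
        (List.replicate (2 * (h e - j)) true)) (.var x) (List.replicate j true))) (by
      intro j hj
      have hj' : 2 * (h e - j) = (2 * (h e - (j + 1)) + 1) + 1 := by omega
      refine ⟨true :: List.replicate (2 * (h e - (j + 1))) true, ?_, ?_⟩
      · simp [output, hoa.symm, hj', List.replicate_succ]
      · refine ((RunsIn.ite_true (l := List.replicate (2 * (h e - (j + 1))) true)
          (s' := output o (F (j + 1)) (update (update s (.acc ℓ)
            (List.replicate (2 * (h e - (j + 1))) true)) (.var x) (List.replicate (j + 1) true)))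
          (by simp) ?_)).mono (T := 1 + (Q.eval (M + P.eval M) + 1)) (by omega)
        have hrep : Rep (e.set x j) (ℓ + 1) (output o (F j) (update (update s (.acc ℓ)
            (List.replicate (2 * (h e - (j + 1))) true)) (.var x) (List.replicate j true))) :=
          ((hs'.update (r := .acc ℓ) (Nat.lt_succ_self ℓ) _).set x j).output ho' _
        have hb : (e.set x j).Bdd (M + P.eval M) := (hM.mono (by omega)).set x (by omega)
        have := (hq (e.set x j) _ _ o trivial hb hrep ho').seq (RunsIn.push (.var x) true _)
        convert this using 1
        · funext r
          simp only [output, update_apply]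
          split_ifs <;> simp_all
        · have hF' : F (j + 1) = F j ++ g (e.set x j) := by simp [hF, List.range_succ]
          rw [hF', output_append]
          funext r
          simp only [output, update_apply]
          split_ifs <;> simp_all [List.replicate_succ])
    (by simp [output, hoa.symm])
  have h3 := RunsIn.clear (k := Reg.var x) (h e) [] (by simp) (output o (F (h e))
    (update (update s (.acc ℓ) []) (.var x) (List.replicate (h e) true)))
    (by simp [output, hov.symm])
  rw [h1'] at h1
  refine ((h1.seq (RunsIn.seq (s' := output o (F (h e)) (update (update s (.acc ℓ) [])
    (.var x) (List.replicate (h e) true))) ?_ h3)).congr ?_).mono (T := P.eval M +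
    ((h e * (Q.eval (M + P.eval M) + 3) + 1) + (h e * 2 + 1))) ?_
  · convert h2 using 1
    · have : F 0 = [] := by simp [hF]
      rw [this, output_nil]
      funext r
      simp only [update_apply]
      split_ifs <;> simp_all
    · funext r
      simp only [output, update_apply]
      have := hs.acc ℓ le_rfl
      split_ifs <;> simp_all
  · funext r
    simp only [output, update_apply]
    have := hs.acc ℓ le_rfl
    split_ifs <;> simp_all
  · simp only [Polynomial.eval_add, Polynomial.eval_mul, Polynomial.eval_X,
      Polynomial.eval_ofNat, Polynomial.eval_one, Polynomial.eval_comp]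
    gcongr

/-- Output `g` for all values of the variable `x` below `h`. -/
theorem Emittable.forRange (x : ℕ) {h : Env → ℕ} {g : Env → List Bool} (hh : Num h)
    (hx : ∀ e, h (e.set x 0) = h e) (hg : Emittable g) :
    Emittable fun e => (List.range (h e)).flatMap fun k => g (e.set x k) := by
  refine Emittable.congr (EmittableOn.save x ((EmittableOn.forRange (x := x) hh hg).mono ?_) ?_) ?_
  · exact fun e h => h.1
  · exact fun _ _ => trivial
  · intro e
    -- `EmittableOn.save` clears `x` before the loop starts, and the loop overwrites it anyway.
    have : ∀ k, (e.set x 0).set x k = e.set x k := by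
      intro k
      simp only [Env.set]
      congr 1
      funext i
      split_ifs <;> rfl
    simp only [hx, this]

end ILPGraphs

namespace ILPGraphs

open Function

/-- The product is the output of `h'` repeated `h` times. The loop variable `x` is a dummy, so
neither factor may depend on it; for concrete expressions this holds by `rfl`. -/
theorem Num.mul {h h' : Env → ℕ} (x : ℕ) (hh : Num h) (hh' : Num h')
    (hx : ∀ e k, h (e.set x k) = h e := by intros; rfl)
    (hx' : ∀ e k, h' (e.set x k) = h' e := by intros; rfl) : Num fun e => h e * h' e := by
  refine (Emittable.forRange x hh (fun e => hx e 0) hh').congr fun e => ?_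
  simp only [hx']
  induction h e with
  | zero => simp
  | succ n ih => rw [List.range_succ, List.flatMap_append, ih, Nat.succ_mul, List.replicate_add]; simp

/-! ### Tests -/

section Drain

variable {K : Type} [DecidableEq K]

/-- Clear a stack that holds marked bits. -/
theorem RunsIn.drain {k : K} (L : List Bool) (s : K → List Bool)
    (hs : s k = L.flatMap fun b => [true, b]) :
    RunsIn (.loop k (.ite k .skip .skip)) s (update s k []) (L.length * 3 + 1) := by
  convert RunsIn.loop (k := k) (p := .ite k .skip .skip) (B := 2) (n := L.length)
    (fun j => update s k ((L.drop j).flatMap fun b => [true, b])) ?_ ?_ using 1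
  · simp [← hs]
  · simp
  · intro j hj
    refine ⟨L[j] :: ((L.drop (j + 1)).flatMap fun b => [true, b]), ?_, ?_⟩
    · simp only [update_self]
      rw [List.drop_eq_getElem_cons hj, List.flatMap_cons]
      rfl
    · rcases hb : L[j] with _ | _
      · refine (RunsIn.ite_false (T := 1) (by simp) ?_)
        simp only [update_idem, update_self, List.tail_cons]
        exact RunsIn.skip _
      · refine (RunsIn.ite_true (T := 1) (by simp; rfl) ?_)
        simp only [update_idem]
        exact RunsIn.skip _
  · simp

end Drain

/-- The output of the test goes to `acc ℓ`. Because of the marks its top symbol is `true` if and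
only if it is not empty, so a single pop decides the condition. -/
theorem Emittable.ite {b : Env → Prop} [∀ e, Decidable (b e)] {f g : Env → List Bool}
    (hb : Testable b) (hf : Emittable f) (hg : Emittable g) :
    Emittable fun e => if b e then f e else g e := by
  obtain ⟨c, hc, hbc⟩ := hb
  intro ℓ
  obtain ⟨r, R, hr⟩ := hc (ℓ + 1)
  obtain ⟨p, P, hp⟩ := hf ℓ
  obtain ⟨q, Q, hq⟩ := hg ℓ
  -- In the first branch the popped mark is put back, so that the stack again consists of complete
  -- marked bits when it is cleared.
  refine ⟨fun o => .seq (r (.acc ℓ)) (.ite (.acc ℓ) (.seq (.push (.acc ℓ) true)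
    (.seq (.loop (.acc ℓ) (.ite (.acc ℓ) .skip .skip)) (p o))) (q o)),
    R + (R * 3 + P + Q + 3), fun e M s o _ hM hs ho => ?_⟩
  have hs' : Rep e (ℓ + 1) s := hs.mono (Nat.le_succ ℓ)
  have h1 := hr e M s (.acc ℓ) trivial hM hs' (.acc ℓ (Nat.lt_succ_self ℓ))
  have hle : (c e).length ≤ R.eval M := by
    obtain ⟨t, ht, hr⟩ := h1
    have := hr.length_le (.acc ℓ)
    simp [output, marked] at this
    omega
  have h1' : output (.acc ℓ) (c e) s = update s (.acc ℓ) (marked (c e)) := by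
    simp [output, hs.acc ℓ le_rfl]
  have hself : update s (.acc ℓ) [] = s := by rw [← hs.acc ℓ le_rfl, update_eq_self]
  rw [h1'] at h1
  simp only [Polynomial.eval_add, Polynomial.eval_mul, Polynomial.eval_ofNat]
  refine h1.seq ?_
  by_cases hbe : b e
  · rw [if_pos hbe]
    obtain ⟨d, L, hd⟩ : ∃ d L, (c e).reverse = d :: L := by
      cases h : (c e).reverse with
      | nil => exact absurd (List.reverse_eq_nil_iff.1 h) ((hbc e).1 hbe)
      | cons d L => exact ⟨d, L, rfl⟩
    have hlen : L.length + 1 = (c e).length := by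
      simpa using (congrArg List.length hd).symm
    have hm : marked (c e) = true :: d :: L.flatMap fun b => [true, b] := by
      simp [marked, hd]
    refine (RunsIn.ite_true (T := 1 + (((d :: L).length * 3 + 1) + P.eval M))
      (l := d :: L.flatMap fun b => [true, b]) (by simp [hm]) ?_).mono
      (by simp only [List.length_cons, hlen]; omega)
    refine (RunsIn.push _ _ _).seq (RunsIn.seq (RunsIn.drain (d :: L) _ (by simp)) ?_)
    simp only [update_idem, hself]
    exact hp e M s o trivial hM hs ho
  · rw [if_neg hbe]
    have hce : c e = [] := by
      by_contra h
      exact hbe ((hbc e).2 h)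
    refine (RunsIn.ite_false (T := Q.eval M) (by simp [hce, marked]) ?_).mono (by omega)
    simp only [hce, marked, update_self, List.reverse_nil, List.flatMap_nil,
      List.tail_nil, hself]
    exact hq e M s o trivial hM hs ho

theorem Testable.congr {b b' : Env → Prop} (hb : Testable b) (h : ∀ e, b e ↔ b' e) :
    Testable b' :=
  let ⟨c, hc, hbc⟩ := hb
  ⟨c, hc, fun e => (h e).symm.trans (hbc e)⟩

theorem Testable.or {b b' : Env → Prop} (hb : Testable b) (hb' : Testable b') :
    Testable fun e => b e ∨ b' e := by
  obtain ⟨c, hc, hbc⟩ := hb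
  obtain ⟨c', hc', hbc'⟩ := hb'
  refine ⟨_, hc.append hc', fun e => ?_⟩
  change b e ∨ b' e ↔ _
  rw [hbc, hbc', ne_eq, ne_eq, ne_eq, List.append_eq_nil_iff]
  tauto

open Classical in
theorem Testable.and {b b' : Env → Prop} (hb : Testable b) (hb' : Testable b') :
    Testable fun e => b e ∧ b' e := by
  obtain ⟨c', hc', hbc'⟩ := hb'
  refine ⟨_, Emittable.ite hb hc' Emittable.nil, fun e => ?_⟩
  by_cases h : b e <;> simp [h, hbc']

open Classical in
theorem Testable.not {b : Env → Prop} (hb : Testable b) : Testable fun e => ¬ b e :=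
  ⟨_, Emittable.ite hb Emittable.nil (Emittable.bit true), fun e => by
    by_cases h : b e <;> simp [h]⟩

/-- Truncated subtraction: for each symbol of the first number one symbol of the second is popped,
which does nothing once that stack is empty. The inequality holds if and only if something is left.
-/
theorem Testable.lt {h h' : Env → ℕ} (hh : Num h) (hh' : Num h') :
    Testable fun e => h e < h' e := by
  refine ⟨fun e => if h e < h' e then [true] else [], fun ℓ => ?_, fun e => by
    by_cases hlt : h e < h' e <;> simp [hlt]⟩
  obtain ⟨p, P, hp⟩ := hh (ℓ + 1)
  obtain ⟨q, Q, hq⟩ := hh' (ℓ + 2)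
  refine ⟨fun o => .seq (p (.acc ℓ)) (.seq (q (.acc (ℓ + 1))) (.seq
    (.loop (.acc ℓ) (.ite (.acc (ℓ + 1)) .skip .skip))
    (.ite (.acc (ℓ + 1)) (.seq (.loop (.acc (ℓ + 1)) .skip)
      (.seq (.push o true) (.push o true))) .skip))),
    P + (Q + ((P * 6 + 1) + (1 + (Q * 4 + 4)))), fun e M s o _ hM hs ho => ?_⟩
  have hoa : o ≠ .acc ℓ := by rintro rfl; cases ho; omega
  have hoa' : o ≠ .acc (ℓ + 1) := by rintro rfl; cases ho; omega
  have hs₁ : Rep e (ℓ + 1) s := hs.mono (Nat.le_succ ℓ)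
  have h1 := hp e M s (.acc ℓ) trivial hM hs₁ (.acc ℓ (Nat.lt_succ_self ℓ))
  have hle : h e ≤ P.eval M := by
    obtain ⟨t, ht, hr⟩ := h1
    have := hr.length_le (.acc ℓ)
    simp [output, marked_replicate] at this
    omega
  set s₁ := output (.acc ℓ) (List.replicate (h e) true) s with hs₁e
  have hs₂ : Rep e (ℓ + 2) s₁ :=
    (hs.mono (Nat.le_add_right ℓ 2)).output (.acc ℓ (by omega)) _
  have h2 := hq e M s₁ (.acc (ℓ + 1)) trivial hM hs₂ (.acc (ℓ + 1) (by omega))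
  have hle' : h' e ≤ Q.eval M := by
    obtain ⟨t, ht, hr⟩ := h2
    have := hr.length_le (.acc (ℓ + 1))
    simp [output, marked_replicate] at this
    omega
  have hsa := hs.acc ℓ le_rfl
  have hsa' := hs.acc (ℓ + 1) (Nat.le_succ ℓ)
  have h3 := RunsIn.loop (k := Reg.acc ℓ) (B := 2) (n := 2 * h e)
    (p := .ite (.acc (ℓ + 1)) .skip .skip)
    (fun j => update (update s (.acc ℓ) (List.replicate (2 * h e - j) true)) (.acc (ℓ + 1))
      (List.replicate (2 * h' e - j) true)) (by
      intro j hj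
      have hj' : 2 * h e - j = (2 * h e - (j + 1)) + 1 := by omega
      refine ⟨List.replicate (2 * h e - (j + 1)) true, by simp [hj', List.replicate_succ], ?_⟩
      rcases Nat.lt_or_ge j (2 * h' e) with hlt | hge
      · have hj'' : 2 * h' e - j = (2 * h' e - (j + 1)) + 1 := by omega
        refine RunsIn.ite_true (T := 1) (l := List.replicate (2 * h' e - (j + 1)) true)
          (by simp [hj'', List.replicate_succ]) (RunsIn.congr (RunsIn.skip _) ?_)
        funext r
        simp only [update_apply]
        split_ifs <;> simp_all
      · have hj1 : 2 * h' e - j = 0 := by omega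
        have hj2 : 2 * h' e - (j + 1) = 0 := by omega
        refine RunsIn.ite_false (T := 1) (by simp [hj1]) (RunsIn.congr (RunsIn.skip _) ?_)
        funext r
        simp only [update_apply, hj1, hj2]
        split_ifs <;> simp_all)
    (by simp)
  simp only [Polynomial.eval_add, Polynomial.eval_mul, Polynomial.eval_ofNat, Polynomial.eval_one]
  refine h1.seq (h2.seq (RunsIn.seq (s' := update (update s (.acc ℓ) []) (.acc (ℓ + 1))
    (List.replicate (2 * h' e - 2 * h e) true)) (RunsIn.mono (T := 2 * h e * 3 + 1) ?_ (by omega))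
    ?_))
  · convert h3 using 1
    · funext r
      simp only [hs₁e, output, marked_replicate, update_apply]
      split_ifs <;> simp_all
    · funext r
      simp only [update_apply]
      split_ifs <;> simp_all
  · by_cases hlt : h e < h' e
    · rw [if_pos hlt]
      have hd : 2 * h' e - 2 * h e = (2 * h' e - 2 * h e - 1) + 1 := by omega
      refine RunsIn.ite_true (l := List.replicate (2 * h' e - 2 * h e - 1) true)
        (by rw [hd]; simp [List.replicate_succ]) ?_
      refine ((RunsIn.clear (2 * h' e - 2 * h e - 1) [] (by simp) _ (by simp)).seq
        ((RunsIn.push _ _ _).seq (RunsIn.push _ _ _))).mono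
        (T := ((2 * h' e - 2 * h e - 1) * 2 + 1) + (1 + 1)) (by omega) |>.congr ?_
      clear hd
      funext r
      simp only [output, marked, update_apply]
      split_ifs <;> simp_all
    · rw [if_neg hlt, output_nil]
      have hd : 2 * h' e - 2 * h e = 0 := by omega
      refine RunsIn.ite_false (by simp [hd]) (((RunsIn.skip _).congr ?_).mono (by omega))
      funext r
      simp only [update_apply]
      split_ifs <;> simp_all

theorem Testable.le {h h' : Env → ℕ} (hh : Num h) (hh' : Num h') :
    Testable fun e => h e ≤ h' e :=
  (Testable.lt hh' hh).not.congr fun _ => not_lt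

theorem Testable.eq {h h' : Env → ℕ} (hh : Num h) (hh' : Num h') :
    Testable fun e => h e = h' e :=
  ((Testable.le hh hh').and (Testable.le hh' hh)).congr fun _ => antisymm_iff

end ILPGraphs

namespace ILPGraphs

open Function

/-! ### Tables -/

theorem tableCode_cons (a : ℕ × ℕ) (L : List (ℕ × ℕ)) :
    tableCode (a :: L) = true :: (unary a.1 ++ unary a.2) ++ tableCode L := rfl

theorem tableCode_append (L L' : List (ℕ × ℕ)) :
    tableCode (L ++ L') = tableCode L ++ tableCode L' := List.flatMap_append

/-! ### Moving tables between stacks -/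

section Transfer

variable {K : Type} [DecidableEq K]

theorem RunsIn.loop_cons {p : Prog K} {k : K} {s s' s'' : K → List Bool} {T T' : ℕ}
    {l : List Bool} (hs : s k = true :: l) (h : RunsIn p (update s k l) s' T)
    (h' : RunsIn (.loop k p) s' s'' T') : RunsIn (.loop k p) s s'' (1 + T + T') :=
  let ⟨t, ht, hr⟩ := h
  let ⟨t', ht', hr'⟩ := h'
  ⟨1 + t + t', by omega, .loop_step (by simp [hs]) (by simpa [hs] using hr) hr'⟩

theorem RunsIn.loop_nil {p : Prog K} {k : K} {s : K → List Bool} (hs : (s k).head? ≠ some true) :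
    RunsIn (.loop k p) s (update s k (s k).tail) 1 := ⟨1, le_rfl, .loop_done hs⟩

/-- `tick` pushes bits to stacks other than `k`; `pre` describes the effect. -/
structure Ticker (k : K) where
  tick : Bool → Prog K
  pre : List Bool → (K → List Bool) → K → List Bool
  cost : ℕ
  run : ∀ b s, RunsIn (tick b) s (pre [b] s) cost
  pre_nil : ∀ s, pre [] s = s
  pre_append : ∀ w w' s, pre w (pre w' s) = pre (w ++ w') s
  pre_self : ∀ w s, pre w s k = s k
  pre_update : ∀ w s l, pre w (update s k l) = update (pre w s) k l

/-- Push to one stack. -/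
def Ticker.single {k d : K} (h : k ≠ d) : Ticker k where
  tick b := .push d b
  pre w s := update s d (w ++ s d)
  cost := 1
  run b s := RunsIn.push d b s
  pre_nil s := by simp
  pre_append w w' s := by simp
  pre_self w s := by simp [h]
  pre_update w s l := by rw [update_comm h, update_of_ne h.symm]

/-- Push to two stacks. -/
def Ticker.double {k d d' : K} (h : k ≠ d) (h' : k ≠ d') (hd : d ≠ d') : Ticker k where
  tick b := .seq (.push d b) (.push d' b)
  pre w s := update (update s d (w ++ s d)) d' (w ++ s d')
  cost := 2
  run b s := by
    refine ((RunsIn.push d b s).seq (RunsIn.push d' b _)).congr ?_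
    simp [hd.symm]
  pre_nil s := by simp
  pre_append w w' s := by
    funext r
    simp only [update_apply]
    split_ifs <;> simp_all
  pre_self w s := by simp [h, h']
  pre_update w s l := by
    funext r
    simp only [update_apply]
    split_ifs <;> simp_all

namespace Ticker

variable {k : K} (τ : Ticker k)

/-- Read a unary number from the stack `k`. -/
theorem runsIn_read (n : ℕ) (l : List Bool) (hl : l.head? ≠ some true)
    (s : K → List Bool) (hs : s k = List.replicate n true ++ l) :
    RunsIn (.loop k (τ.tick true)) s (update (τ.pre (List.replicate n true) s) k l.tail)
      (n * (τ.cost + 1) + 1) := by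
  induction n generalizing s with
  | zero =>
    have hs' : s k = l := by simpa using hs
    have := RunsIn.loop_nil (p := τ.tick true) (k := k) (s := s) (by rwa [hs'])
    simpa [τ.pre_nil, hs'] using this
  | succ n ih =>
    have := RunsIn.loop_cons (s := s) (k := k) (p := τ.tick true)
      (l := List.replicate n true ++ l) (by rw [hs]; rfl) (τ.run true _)
      (ih _ (by rw [τ.pre_self]; simp))
    refine (this.congr ?_).mono (by rw [Nat.succ_mul]; omega)
    rw [τ.pre_append, τ.pre_update, update_idem, List.replicate_succ']

/-- Move a table from the stack `k`; this reverses the table and swaps its columns. -/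
def transfer : Prog K :=
  -- Read from the top, a row is `true`, the first number, `false`, the second number, `false`.
  -- Pushing the separator before each number and `true` at the end gives, again read from the top,
  -- a row in the same format with the two numbers exchanged.
  .loop k (.seq (τ.tick false) (.seq (.loop k (τ.tick true)) (.seq (τ.tick false)
    (.seq (.loop k (τ.tick true)) (τ.tick true)))))

theorem runsIn_transfer (L : List (ℕ × ℕ)) (M : ℕ) (hM : ∀ a ∈ L, a.1 ≤ M ∧ a.2 ≤ M)
    (l : List Bool) (hl : l.head? ≠ some true) (s : K → List Bool)
    (hs : s k = tableCode L ++ l) :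
    RunsIn τ.transfer s (update (τ.pre (tableCode (L.reverse.map Prod.swap)) s) k l.tail)
      (L.length * (2 * M * (τ.cost + 1) + 3 * τ.cost + 3) + 1) := by
  induction L generalizing s with
  | nil =>
    have hs' : s k = l := by simpa [tableCode] using hs
    have := RunsIn.loop_nil (p := .seq (τ.tick false) (.seq (.loop k (τ.tick true))
      (.seq (τ.tick false) (.seq (.loop k (τ.tick true)) (τ.tick true))))) (k := k) (s := s)
      (by rwa [hs'])
    simpa [tableCode, τ.pre_nil, hs', transfer] using this
  | cons a L ih =>
    have h1 := τ.run false (update s k (unary a.1 ++ (unary a.2 ++ (tableCode L ++ l))))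
    rw [τ.pre_update] at h1
    have h2 := τ.runsIn_read a.1 (false :: (unary a.2 ++ (tableCode L ++ l))) (by simp)
      (update (τ.pre [false] s) k (unary a.1 ++ (unary a.2 ++ (tableCode L ++ l))))
      (by simp [unary])
    rw [τ.pre_update, update_idem, τ.pre_append, List.tail_cons] at h2
    have h3 := τ.run false
      (update (τ.pre (List.replicate a.1 true ++ [false]) s) k (unary a.2 ++ (tableCode L ++ l)))
    rw [τ.pre_update, τ.pre_append] at h3
    have h4 := τ.runsIn_read a.2 (false :: (tableCode L ++ l)) (by simp)
      (update (τ.pre ([false] ++ (List.replicate a.1 true ++ [false])) s) k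
        (unary a.2 ++ (tableCode L ++ l)))
      (by simp [unary])
    rw [τ.pre_update, update_idem, τ.pre_append, List.tail_cons] at h4
    have h5 := τ.run true (update (τ.pre (List.replicate a.2 true ++
      ([false] ++ (List.replicate a.1 true ++ [false]))) s) k (tableCode L ++ l))
    rw [τ.pre_update, τ.pre_append] at h5
    have h6 := ih (fun b hb => hM b (by simp [hb])) _
      (by rw [update_self] : update (τ.pre ([true] ++ (List.replicate a.2 true ++
      ([false] ++ (List.replicate a.1 true ++ [false])))) s) k (tableCode L ++ l) k = _)
    have := RunsIn.loop_cons (by rw [hs, tableCode_cons]; simp)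
      (h1.seq (h2.seq (h3.seq (h4.seq h5)))) h6
    refine (this.congr ?_).mono ?_
    · rw [τ.pre_update, update_idem, τ.pre_append]
      congr 2
      simp [tableCode, unary]
    -- A row costs two loops over numbers of size at most `M`, three further ticks, and one step for
    -- each of the three tests that are not followed by a tick of a number.
    · have h₁ := Nat.mul_le_mul_right (τ.cost + 1) (hM a (by simp)).1
      have h₂ := Nat.mul_le_mul_right (τ.cost + 1) (hM a (by simp)).2
      rw [List.length_cons, Nat.succ_mul L.length, Nat.mul_assoc 2]
      omega

end Ticker

end Transfer

/-- A transfer reverses the table and swaps its columns, so two transfers restore it. -/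
theorem reverse_map_swap_twice (L : List (ℕ × ℕ)) :
    (L.reverse.map Prod.swap).reverse.map Prod.swap = L := by
  simp [List.map_reverse]

/-- The state of a loop over a table after a row has been read. -/
theorem tableLoop_read {ℓ x a b : ℕ} {o : Reg} (hxa : x ≠ a) (hxb : x ≠ b) (hab : a ≠ b)
    (hov : ∀ i, o ≠ .var i) (hot : o ≠ .tmp ℓ) {s : Reg → List Bool} (hsa : s (.var a) = [])
    (hsb : s (.var b) = []) (F w₀ w₁ w₂ w₃ X A B : List Bool) {s₀ s₁ : Reg → List Bool}
    (hs₀ : s₀ = update (output o F (update (update s (.tmp ℓ) w₀) (.var x) X)) (.tmp ℓ) w₁)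
    (hs₁ : s₁ = update (update s₀ (.tmp ℓ) w₂) (.var a) (A ++ s₀ (.var a))) :
    update (update s₁ (.tmp ℓ) w₃) (.var b) (B ++ s₁ (.var b)) =
      update (update (output o F (update (update s (.tmp ℓ) w₃) (.var x) X)) (.var a) A)
        (.var b) B := by
  have h₁ := (hov a).symm
  have h₂ := (hov b).symm
  have h₃ := hot.symm
  have h₄ : (Reg.var a : Reg) ≠ .var x := by simpa using hxa.symm
  have h₅ : (Reg.var b : Reg) ≠ .var x := by simpa using hxb.symm
  have h₆ : (Reg.var b : Reg) ≠ .var a := by simpa using hab.symm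
  subst hs₁ hs₀
  funext r
  by_cases hrb : r = .var b
  · subst hrb; simp [output, h₂, h₅, h₆, hsb]
  by_cases hra : r = .var a
  · subst hra; simp [output, h₁, h₄, hrb, hsa]
  by_cases hrt : r = .tmp ℓ
  · subst hrt; simp [output, h₃]
  by_cases hro : r = o
  · subst hro; simp [output, hra, hrb, hrt, update_apply]
  · simp [output, hra, hrb, hrt, hro, update_apply]

/-- The state of a loop over a table after one iteration. -/
theorem tableLoop_next {ℓ x a b : ℕ} {o : Reg} (hxa : x ≠ a) (hxb : x ≠ b) (hab : a ≠ b)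
    (hov : ∀ i, o ≠ .var i) (hot : o ≠ .tmp ℓ) {s : Reg → List Bool} (hsa : s (.var a) = [])
    (hsb : s (.var b) = []) (F G w₃ A B : List Bool) (j : ℕ) {s₂ s₃ : Reg → List Bool}
    (hs₂ : s₂ = update (update (output o F (update (update s (.tmp ℓ) w₃) (.var x)
      (List.replicate j true))) (.var a) A) (.var b) B)
    (hs₃ : s₃ = update (update (output o G s₂) (.var a) []) (.var b) []) :
    update s₃ (.var x) (true :: s₃ (.var x)) =
      output o (F ++ G) (update (update s (.tmp ℓ) w₃) (.var x)
        (List.replicate (j + 1) true)) := by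
  have h₀ := (hov x).symm
  have h₁ := (hov a).symm
  have h₂ := (hov b).symm
  have h₃ := hot.symm
  have h₄ : (Reg.var x : Reg) ≠ .var a := by simpa using hxa
  have h₅ : (Reg.var x : Reg) ≠ .var b := by simpa using hxb
  have h₆ : (Reg.var b : Reg) ≠ .var a := by simpa using hab.symm
  subst hs₃ hs₂
  rw [output_append]
  funext r
  by_cases hrx : r = .var x
  · subst hrx; simp [output, h₀, h₄, h₅, List.replicate_succ]
  by_cases hrb : r = .var b
  · subst hrb; simp [output, h₂, hrx, hsb]
  by_cases hra : r = .var a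
  · subst hra; simp [output, h₁, hrx, hrb, hsa]
  by_cases hro : r = o
  · subst hro; simp [output, hra, hrb, hrx]
  · simp [output, hra, hrb, hrx, hro, update_apply]

/-- The table goes to the auxiliary stack and then back to its place, where the second transfer also
writes a copy to `tmp ℓ`. Only the copy is consumed by the loop, so the body may use the table
itself. -/
theorem EmittableOn.forTable {t x a b : ℕ} {g : Env → List Bool} (hxa : x ≠ a) (hxb : x ≠ b)
    (hab : a ≠ b) (hg : Emittable g) :
    EmittableOn (fun e => e.var b = 0 ∧ e.var a = 0 ∧ e.var x = 0)
      fun e => (List.range (e.tab t).length).flatMap fun k =>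
        g (((e.set x k).set a ((e.tab t).getD k (0, 0)).1).set b
          ((e.tab t).getD k (0, 0)).2) := by
  intro ℓ
  obtain ⟨q, Q, hq⟩ := hg (ℓ + 1)
  let τ₁ : Ticker (Reg.tab t) := Ticker.single (d := .aux) (by simp)
  let τ₂ : Ticker Reg.aux := Ticker.double (d := .tab t) (d' := .tmp ℓ) (by simp) (by simp)
    (by simp)
  refine ⟨fun o => .seq τ₁.transfer (.seq τ₂.transfer (.seq (.loop (.tmp ℓ)
    (.seq (.loop (.tmp ℓ) (.push (.var a) true)) (.seq (.loop (.tmp ℓ) (.push (.var b) true))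
      (.seq (q o) (.seq (.loop (.var a) .skip) (.seq (.loop (.var b) .skip)
        (.push (.var x) true))))))) (.loop (.var x) .skip))),
    (.X * (2 * .X * 2 + 3 * 1 + 3) + 1) + ((.X * (2 * .X * 3 + 3 * 2 + 3) + 1) +
      ((.X * ((.X * 8 + Q + 5) + 1) + 1) + (.X * 2 + 1))), fun e M s o he hM hs ho => ?_⟩
  obtain ⟨heb, hea, hex⟩ := he
  set L := e.tab t with hL
  have hML : ∀ a ∈ L, a.1 ≤ M ∧ a.2 ≤ M := (hM.2 t).2
  have hlen : L.length ≤ M := (hM.2 t).1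
  have hov : ∀ i, o ≠ .var i := by rintro i rfl; cases ho
  have hot : o ≠ .tmp ℓ := by rintro rfl; cases ho
  have hs' : Rep e (ℓ + 1) s := hs.mono (Nat.le_succ ℓ)
  have ho' : IsOut (ℓ + 1) o := ho.mono (Nat.le_succ ℓ)
  have hsx : s (.var x) = [] := by rw [hs.var, hex]; rfl
  have hsa : s (.var a) = [] := by rw [hs.var, hea]; rfl
  have hsb : s (.var b) = [] := by rw [hs.var, heb]; rfl
  have hst : s (.tmp ℓ) = [] := hs.tmp ℓ le_rfl
  have h1 : RunsIn τ₁.transfer s _ (L.length * (2 * M * 2 + 3 * 1 + 3) + 1) :=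
    τ₁.runsIn_transfer L M hML [] (by simp) s (by simp [hs.tab, hL])
  have h2 : RunsIn τ₂.transfer
      (update (τ₁.pre (tableCode (L.reverse.map Prod.swap)) s) (.tab t) []) (update s (.tmp ℓ) (tableCode L))
      (L.length * (2 * M * 3 + 3 * 2 + 3) + 1) := by
    have := τ₂.runsIn_transfer (L.reverse.map Prod.swap) M (by
        intro a ha
        obtain ⟨b, hb, rfl⟩ := List.mem_map.1 ha
        have := hML b (List.mem_reverse.1 hb)
        exact ⟨this.2, this.1⟩) [] (by simp)
      (update (τ₁.pre (tableCode (L.reverse.map Prod.swap)) s) (.tab t) [])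
      (by simp [τ₁, Ticker.single, hs.aux])
    rw [reverse_map_swap_twice, List.length_map, List.length_reverse] at this
    refine this.congr ?_
    have := hs.tab t
    have := hs.aux
    funext r
    simp only [τ₁, τ₂, Ticker.single, Ticker.double, update_apply]
    split_ifs <;> simp_all
  set G : ℕ → List Bool := fun k => g (((e.set x k).set a (L.getD k (0, 0)).1).set b
          (L.getD k (0, 0)).2) with hG
  set F : ℕ → List Bool := fun j => (List.range j).flatMap G with hF
  set st : ℕ → Reg → List Bool := fun j => output o (F j) (update (update s (.tmp ℓ)
    (tableCode (L.drop j))) (.var x) (List.replicate j true)) with hst'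
  have h3 := RunsIn.loop (k := Reg.tmp ℓ) (B := M * 8 + Q.eval M + 5) (n := L.length)
    (p := .seq (.loop (.tmp ℓ) (.push (.var a) true)) (.seq (.loop (.tmp ℓ) (.push (.var b) true))
      (.seq (q o) (.seq (.loop (.var a) .skip) (.seq (.loop (.var b) .skip)
        (.push (.var x) true))))))
    st (by
      intro j hj
      have hdrop : L.drop j = L[j] :: L.drop (j + 1) := List.drop_eq_getElem_cons hj
      have hget : L.getD j (0, 0) = L[j] := by simp [hj]
      have hmem := hML L[j] (List.getElem_mem hj)
      refine ⟨unary L[j].1 ++ (unary L[j].2 ++ tableCode (L.drop (j + 1))), ?_, ?_⟩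
      · simp only [st, output]
        rw [update_of_ne hot.symm, update_of_ne (by simp), update_self, hdrop, tableCode_cons]
        simp
      set s₀ := update (st j) (.tmp ℓ)
        (unary L[j].1 ++ (unary L[j].2 ++ tableCode (L.drop (j + 1)))) with hs₀
      set s₂ := update (update (output o (F j) (update (update s (.tmp ℓ)
        (tableCode (L.drop (j + 1)))) (.var x) (List.replicate j true)))
        (.var a) (List.replicate L[j].1 true)) (.var b) (List.replicate L[j].2 true) with hs₂
      have ha := RunsIn.move (k := Reg.tmp ℓ) (k' := .var a) (by simp) L[j].1
        (false :: (unary L[j].2 ++ tableCode (L.drop (j + 1)))) (by simp) s₀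
        (by simp [s₀, unary])
      have hb := RunsIn.move (k := Reg.tmp ℓ) (k' := .var b) (by simp) L[j].2
        (false :: tableCode (L.drop (j + 1))) (by simp) _
        (by simp [unary] : update (update s₀ (.tmp ℓ)
          (false :: (unary L[j].2 ++ tableCode (L.drop (j + 1)))).tail) (.var a)
          (List.replicate L[j].1 true ++ s₀ (.var a)) (.tmp ℓ) = _)
      have hb' := hb.congr (s'' := s₂) (tableLoop_read hxa hxb hab hov hot hsa hsb _ _ _ _ _ _ _ _ rfl rfl)
      have hrep : Rep (((e.set x j).set a L[j].1).set b L[j].2) (ℓ + 1) s₂ :=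
        ((((hs'.update (r := .tmp ℓ) (Nat.lt_succ_self ℓ) _).set x j).output ho' _).set a _).set
          b _
      have hbd : (((e.set x j).set a L[j].1).set b L[j].2).Bdd M :=
        ((hM.set x (by omega)).set a hmem.1).set b hmem.2
      have hc := hq _ M s₂ o trivial hbd hrep ho'
      set G' := g (((e.set x j).set a L[j].1).set b L[j].2) with hG'
      have hca := RunsIn.clear (k := Reg.var a) L[j].1 [] (by simp) (output o G' s₂)
        (by simp [s₂, output, hab, (hov a).symm])
      have hcb := RunsIn.clear (k := Reg.var b) L[j].2 [] (by simp) _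
        (by simp [s₂, output, hab.symm, (hov b).symm] :
          update (output o G' s₂) (.var a) ([] : List Bool).tail (.var b) = _)
      have hp := RunsIn.push (Reg.var x) true
        (update (update (output o G' s₂) (.var a) ([] : List Bool).tail) (.var b)
          ([] : List Bool).tail)
      refine ((ha.seq (hb'.seq (hc.seq (hca.seq (hcb.seq hp))))).congr ?_).mono (by omega)
      have hF' : F (j + 1) = F j ++ G' := by
        simp [hF, List.range_succ, hG, hj, hG']
      simp only [hst', hF']
      exact tableLoop_next hxa hxb hab hov hot hsa hsb _ _ _ _ _ _ rfl rfl)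
    (by simp [st, output, hot.symm, tableCode])
  have h4 := RunsIn.clear (k := Reg.var x) L.length [] (by simp) (output o (F L.length)
    (update s (.var x) (List.replicate L.length true))) (by simp [output, (hov x).symm])
  refine ((h1.seq (h2.seq (RunsIn.seq (s' := output o (F L.length)
    (update s (.var x) (List.replicate L.length true))) ?_ h4))).congr ?_).mono
    (T := (L.length * (2 * M * 2 + 3 * 1 + 3) + 1) + ((L.length * (2 * M * 3 + 3 * 2 + 3) + 1) +
      ((L.length * ((M * 8 + Q.eval M + 5) + 1) + 1) + (L.length * 2 + 1)))) ?_
  · have hx0 : update s (.var x) [] = s := by rw [← hsx, update_eq_self]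
    have ht0 : update s (.tmp ℓ) [] = s := by rw [← hst, update_eq_self]
    have htn : tableCode [] = [] := rfl
    convert h3 using 1
    · have : F 0 = [] := by simp [hF]
      simp only [hst', this, output_nil, List.drop_zero, List.replicate_zero]
      rw [update_comm (by simp), hx0]
    · simp only [hst', List.drop_length, htn, ht0]
      rw [eq_comm, update_eq_self_iff]
      simp [output, hot.symm, hst]
  · change _ = output o (F L.length) s
    funext r
    by_cases hrx : r = .var x
    · subst hrx; simp [output, (hov x).symm, hsx]
    · by_cases hro : r = o
      · subst hro; simp [output, hrx]
      · simp [output, hrx, hro]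
  · simp only [Polynomial.eval_add, Polynomial.eval_mul, Polynomial.eval_X,
      Polynomial.eval_ofNat, Polynomial.eval_one]
    gcongr

/-- Output `g` for all rows `(a, b)` of the table `t`, with `x` the number of the row. -/
theorem Emittable.forTable (t x a b : ℕ) {g : Env → List Bool} (hg : Emittable g)
    (hxa : x ≠ a := by decide) (hxb : x ≠ b := by decide) (hab : a ≠ b := by decide) :
    Emittable fun e => (List.range (e.tab t).length).flatMap fun k =>
      g (((e.set x k).set a ((e.tab t).getD k (0, 0)).1).set b
        ((e.tab t).getD k (0, 0)).2) := by
  -- The conditions that `b`, `a` and `x` vanish are removed one after the other; each `save` must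
  -- preserve those that remain, hence the distinctness of the variables.
  have h1 := EmittableOn.save (D := fun e => e.var a = 0 ∧ e.var x = 0) b
    (EmittableOn.forTable hxa hxb hab hg (t := t)) (by
      intro e he
      simp [Env.set, hab, hxb, he])
  have h2 := EmittableOn.save (D := fun e => e.var x = 0) a h1 (by
      intro e he
      simp [Env.set, hxa, he])
  have h3 := EmittableOn.save (D := fun _ => True) x (h2.mono fun e he => he.1)
    fun _ _ => trivial
  refine Emittable.congr h3 fun e => ?_
  simp only [Env.set]
  congr 1
  funext k
  congr 2
  funext i
  split_ifs <;> rfl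

end ILPGraphs

namespace ILPGraphs

open Function

/-! ### Reading the input -/

/-- Assign the value `L` to the table `t`. -/
def Env.setTab (e : Env) (t : ℕ) (L : List (ℕ × ℕ)) : Env :=
  ⟨e.var, fun i => if i = t then L else e.tab i⟩

/-- The environment without any data. -/
def Env.empty : Env := ⟨fun _ => 0, fun _ => []⟩

/-- The stacks that hold the environment `e` and nothing else. -/
def Env.stacks (e : Env) : Reg → List Bool
  | .var i => List.replicate (e.var i) true
  | .tab t => tableCode (e.tab t)
  | _ => []

theorem Env.rep_stacks (e : Env) : Rep e 0 e.stacks :=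
  ⟨fun _ => rfl, fun _ => rfl, rfl, fun _ _ => rfl, fun _ _ => rfl, fun _ _ => rfl⟩

theorem Env.stacks_set (e : Env) (x k : ℕ) :
    (e.set x k).stacks = update e.stacks (.var x) (List.replicate k true) := by
  funext r
  cases r with
  | var i => by_cases h : i = x <;> simp [Env.stacks, Env.set, h]
  | _ => simp [Env.stacks, Env.set]

theorem Env.stacks_setTab (e : Env) (t : ℕ) (L : List (ℕ × ℕ)) :
    (e.setTab t L).stacks = update e.stacks (.tab t) (tableCode L) := by
  funext r
  cases r with
  | tab i => by_cases h : i = t <;> simp [Env.stacks, Env.setTab, h]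
  | _ => simp [Env.stacks, Env.setTab]

theorem Env.stacks_empty : Env.empty.stacks = fun _ => [] := by
  funext r
  cases r <;> simp [Env.stacks, Env.empty, tableCode]

theorem Env.Bdd.setTab {e : Env} {M : ℕ} (h : e.Bdd M) (t : ℕ) {L : List (ℕ × ℕ)}
    (hL : L.length ≤ M) (hL' : ∀ a ∈ L, a.1 ≤ M ∧ a.2 ≤ M) : (e.setTab t L).Bdd M :=
  ⟨h.1, fun i => by by_cases hi : i = t <;> simp only [Env.setTab, hi, if_true, if_false] <;>
    [exact ⟨hL, hL'⟩; exact h.2 i]⟩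

theorem Env.bdd_empty (M : ℕ) : Env.empty.Bdd M := by
  simp [Env.Bdd, Env.empty]

/-- The stacks that hold the environment `e` and the remaining input `w`. -/
def Env.reading (e : Env) (w : List Bool) : Reg → List Bool := update e.stacks .inp w

/-- The edges of a graph as pairs of numbers. -/
def GraphCode.natEdges (x : GraphCode) : List (ℕ × ℕ) := x.edges.map fun e => (e.1.1, e.2.1)

/-- The edge part of an input has the format of a table and is followed by `false`, which is where a
transfer stops. So reading a graph amounts to moving a table. -/
theorem GraphCode.encode_eq (x : GraphCode) :
    x.encode = unary x.n ++ tableCode x.natEdges ++ [false] := by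
  simp only [GraphCode.encode, tableCode, GraphCode.natEdges, List.flatMap_map]

/-- Move a table from the auxiliary stack to its place. -/
def storeTable (t : ℕ) : Prog Reg :=
  (Ticker.single (k := Reg.aux) (d := .tab t) (by simp)).transfer

theorem runsIn_storeTable {e : Env} {t : ℕ} {L : List (ℕ × ℕ)} {M : ℕ} (ht : e.tab t = [])
    (hlen : L.length ≤ M) (hL : ∀ a ∈ L, a.1 ≤ M ∧ a.2 ≤ M) (w : List Bool) :
    RunsIn (storeTable t) (update (e.reading w) .aux (tableCode (L.reverse.map Prod.swap)))
      ((e.setTab t L).reading w) (M * (2 * M * 2 + 6) + 1) := by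
  have := (Ticker.single (k := Reg.aux) (d := .tab t) (by simp)).runsIn_transfer
    (L.reverse.map Prod.swap) M (by
        intro a ha
        obtain ⟨b, hb, rfl⟩ := List.mem_map.1 ha
        have := hL b (List.mem_reverse.1 hb)
        exact ⟨this.2, this.1⟩) [] (by simp)
      (update (e.reading w) .aux (tableCode (L.reverse.map Prod.swap))) (by simp)
  rw [reverse_map_swap_twice, List.length_map, List.length_reverse] at this
  refine (this.congr ?_).mono (T := L.length * (2 * M * 2 + 6) + 1) (by gcongr)
  rw [Env.reading, Env.reading, Env.stacks_setTab]
  funext r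
  have h1 : e.stacks .aux = [] := rfl
  have h2 : e.stacks (.tab t) = [] := by simp [Env.stacks, ht, tableCode]
  simp only [Ticker.single, update_apply]
  split_ifs <;> simp_all

/-- Read a graph from the input. -/
def readGraph (j : ℕ) : Prog Reg :=
  .seq (.loop .inp (.push (.var j) true)) (.seq
    (Ticker.single (k := Reg.inp) (d := .aux) (by simp)).transfer (storeTable j))

/-- The bounds that are needed for the time analysis of the input routine. -/
def GraphCode.Bdd (x : GraphCode) (M : ℕ) : Prop := x.n ≤ M ∧ x.edges.length ≤ M

theorem GraphCode.Bdd.natEdges {x : GraphCode} {M : ℕ} (h : x.Bdd M) :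
    ∀ a ∈ x.natEdges, a.1 ≤ M ∧ a.2 ≤ M := by
  intro a ha
  obtain ⟨b, -, rfl⟩ := List.mem_map.1 ha
  have := h.1
  constructor <;> simp only <;> omega

theorem runsIn_readGraph {e : Env} {j : ℕ} {x : GraphCode} {M : ℕ} (hv : e.var j = 0)
    (ht : e.tab j = []) (hx : x.Bdd M) (w : List Bool) :
    RunsIn (readGraph j) (e.reading (x.encode ++ w))
      (((e.set j x.n).setTab j x.natEdges).reading w)
      ((M * 2 + 1) + ((M * (2 * M * 2 + 6) + 1) + (M * (2 * M * 2 + 6) + 1))) := by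
  have hlen : x.natEdges.length ≤ M := by simpa [GraphCode.natEdges] using hx.2
  have h1 := RunsIn.move (k := Reg.inp) (k' := .var j) (by simp) x.n
    (false :: (tableCode x.natEdges ++ false :: w)) (by simp) (e.reading (x.encode ++ w))
    (by simp [Env.reading, GraphCode.encode_eq, unary])
  have h1' : RunsIn (.loop .inp (.push (.var j) true)) (e.reading (x.encode ++ w))
      ((e.set j x.n).reading (tableCode x.natEdges ++ false :: w)) (M * 2 + 1) := by
    refine (h1.congr ?_).mono (by have := hx.1; omega)
    rw [Env.reading, Env.reading, Env.stacks_set]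
    have h2 : e.stacks (.var j) = [] := by simp [Env.stacks, hv]
    funext r
    simp only [update_apply]
    split_ifs <;> simp_all
  have h2 := (Ticker.single (k := Reg.inp) (d := .aux) (by simp)).runsIn_transfer x.natEdges M
    hx.natEdges (false :: w) (by simp)
    ((e.set j x.n).reading (tableCode x.natEdges ++ false :: w)) (by simp [Env.reading])
  refine h1'.seq (RunsIn.seq ((h2.congr ?_).mono (T := x.natEdges.length * (2 * M * 2 + 6) + 1)
    (by gcongr)) (runsIn_storeTable (e := e.set j x.n) ht hlen hx.natEdges w))
  have h3 : (e.set j x.n).stacks .aux = [] := rfl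
  rw [Env.reading, Env.reading]
  funext r
  simp only [Ticker.single, update_apply]
  split_ifs <;> simp_all

/-- Read the labels of a graph from the input. -/
def readLabels (j : ℕ) : Prog Reg :=
  -- The list of labels has no end mark, so the number of nodes, moved to `tmp 0`, counts the rounds
  -- and is restored in the process. A label `k` is written to the auxiliary stack as the row `(0,
  -- k)`, which `storeTable` turns into `(k, 0)`.
  .seq (.loop (.var j) (.push (.tmp 0) true)) (.seq
    (.loop (.tmp 0) (.seq (.push (.var j) true) (.seq (.push .aux false)
      (.seq (.loop .inp (.push .aux true)) (.seq (.push .aux false) (.push .aux true))))))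
    (storeTable (j + 2)))

/-- The labels of a graph, as a table. -/
def labelTable (L : List ℕ) : List (ℕ × ℕ) := L.map fun k => (k, 0)

theorem runsIn_readLabels {e : Env} {j : ℕ} {L : List ℕ} {M : ℕ} (hv : e.var j = L.length)
    (ht : e.tab (j + 2) = []) (hlen : L.length ≤ M) (hL : ∀ a ∈ L, a ≤ M) (w : List Bool) :
    RunsIn (readLabels j) (e.reading (L.flatMap unary ++ w))
      ((e.setTab (j + 2) (labelTable L)).reading w)
      ((M * 2 + 1) + ((M * ((M * 2 + 5) + 1) + 1) + (M * (2 * M * 2 + 6) + 1))) := by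
  have h1 := RunsIn.move (k := Reg.var j) (k' := .tmp 0) (by simp) L.length []
    (by simp) (e.reading (L.flatMap unary ++ w)) (by simp [Env.reading, Env.stacks, hv])
  set st : ℕ → Reg → List Bool := fun i => update (update (update (e.reading
    ((L.drop i).flatMap unary ++ w)) (.var j) (List.replicate i true)) (.tmp 0)
    (List.replicate (L.length - i) true)) .aux
    (tableCode ((labelTable (L.take i)).reverse.map Prod.swap)) with hst
  have h2 := RunsIn.loop (k := Reg.tmp 0) (B := M * 2 + 5) (n := L.length)
    (p := .seq (.push (.var j) true) (.seq (.push .aux false)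
      (.seq (.loop .inp (.push .aux true)) (.seq (.push .aux false) (.push .aux true)))))
    st (by
      intro i hi
      have hi' : L.length - i = (L.length - (i + 1)) + 1 := by omega
      refine ⟨List.replicate (L.length - (i + 1)) true, by simp [st, hi', List.replicate_succ], ?_⟩
      set s₀ := update (st i) (.tmp 0) (List.replicate (L.length - (i + 1)) true) with hs₀
      set s₁ := update s₀ (.var j) (true :: s₀ (.var j)) with hs₁
      set s₂ := update s₁ .aux (false :: s₁ .aux) with hs₂
      have hin : s₂ .inp = List.replicate L[i] true ++
          false :: ((L.drop (i + 1)).flatMap unary ++ w) := by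
        have hd : L.drop i = L[i] :: L.drop (i + 1) := List.drop_eq_getElem_cons hi
        have : s₂ .inp = (L.drop i).flatMap unary ++ w := by
          simp [s₂, s₁, s₀, st, Env.reading]
        rw [this, hd, List.flatMap_cons]
        simp [unary]
      have h3 := RunsIn.move (k := Reg.inp) (k' := .aux) (by simp) L[i] _ (by simp) s₂ hin
      have hLi : L[i] ≤ M := hL _ (List.getElem_mem hi)
      refine (((RunsIn.push _ _ s₀).seq ((RunsIn.push _ _ s₁).seq (h3.seq
        ((RunsIn.push _ _ _).seq (RunsIn.push _ _ _))))).congr ?_).mono (by omega)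
      have htake : L.take (i + 1) = L.take i ++ [L[i]] := by
        rw [List.take_add_one]; simp [hi]
      have htab : tableCode ((labelTable (L.take (i + 1))).reverse.map Prod.swap) =
          true :: false :: (List.replicate L[i] true ++
            false :: tableCode ((labelTable (L.take i)).reverse.map Prod.swap)) := by
        have : ∀ (l : List ℕ) (a : ℕ),
            tableCode ((labelTable (l ++ [a])).reverse.map Prod.swap) =
              true :: false :: (List.replicate a true ++
                false :: tableCode ((labelTable l).reverse.map Prod.swap)) := by
          intro l a
          simp [labelTable, tableCode, unary]
        rw [htake, this]
      clear h3 hin h1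
      simp only [hst, hs₂, hs₁, hs₀, htab, List.tail_cons, Env.reading]
      clear_value st s₀ s₁ s₂
      clear hst hs₀ hs₁ hs₂ htab
      funext r
      simp only [update_apply]
      split_ifs <;> simp_all [List.replicate_succ])
    (by simp [st])
  have h2' := (h2.mono (T' := M * ((M * 2 + 5) + 1) + 1) (by gcongr)).congr
    (s'' := update (e.reading w) .aux (tableCode ((labelTable L).reverse.map Prod.swap))) (by
      simp only [hst, Env.reading]
      clear h2 h1
      have h3 : e.stacks (.var j) = List.replicate L.length true := by simp [Env.stacks, hv]
      have h4 : e.stacks (.tmp 0) = [] := rfl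
      funext r
      simp only [update_apply]
      split_ifs <;> simp_all)
  refine RunsIn.seq (s' := st 0) ((h1.congr ?_).mono (T := L.length * 2 + 1) (by omega))
    (h2'.seq ((runsIn_storeTable (L := labelTable L) ht (by simpa [labelTable] using hlen) (by
      intro a ha
      obtain ⟨k, hk, rfl⟩ := List.mem_map.1 ha
      exact ⟨hL k hk, by simp⟩) w)))
  simp only [hst, Env.reading]
  have h3 : e.stacks .aux = [] := rfl
  have h4 : e.stacks (.tmp 0) = [] := rfl
  clear h2 h2' h1
  funext r
  simp only [update_apply]
  split_ifs <;> simp_all [labelTable, tableCode]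

/-! ### From output programs to polynomial time -/

/-- Reverse the output and remove the marks. -/
def finish : Prog Reg := .loop .out (.ite .out (.push .fin true) (.push .fin false))

theorem runsIn_finish (s : Reg → List Bool) (L : List Bool) (hs : s .out = marked L) :
    RunsIn finish s (update (update s .out []) .fin (L ++ s .fin)) (L.length * 3 + 1) := by
  induction L using List.reverseRecOn generalizing s with
  | nil =>
    have hs' : s .out = [] := hs
    have := RunsIn.loop_nil (p := .ite .out (.push .fin true) (.push .fin false)) (k := Reg.out)
      (s := s) (by simp [hs'])
    refine (this.congr ?_).mono (by simp)
    funext r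
    simp only [update_apply]
    split_ifs <;> simp_all
  | append_singleton L b ih =>
    have hs' : s .out = true :: b :: marked L := by rw [hs]; simp [marked]
    set s' := update (update s .out (marked L)) .fin (b :: s .fin) with hs'e
    have h1 : RunsIn (.ite .out (.push .fin true) (.push .fin false))
        (update s .out (b :: marked L)) s' 2 := by
      cases b with
      | false =>
        refine RunsIn.ite_false (T := 1) (by simp) ((RunsIn.push _ _ _).congr ?_)
        simp [s']
      | true =>
        refine RunsIn.ite_true (T := 1) (l := marked L) (by simp) ((RunsIn.push _ _ _).congr ?_)
        simp [s']
    have := RunsIn.loop_cons hs' h1 (ih s' (by simp [s']))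
    refine (this.congr ?_).mono (by simp; omega)
    funext r
    simp only [hs'e, update_apply]
    split_ifs <;> simp_all

/-- The trivial ticker. -/
def Ticker.silent {K : Type} [DecidableEq K] (k : K) : Ticker k where
  tick _ := .skip
  pre _ s := s
  cost := 1
  run _ s := RunsIn.skip s
  pre_nil _ := rfl
  pre_append _ _ _ := rfl
  pre_self _ _ := rfl
  pre_update _ _ _ := rfl

theorem runsIn_clearVar {e : Env} {M : ℕ} (he : e.Bdd M) (i : ℕ) (w : List Bool) :
    RunsIn (.loop (.var i) .skip) (update e.stacks .fin w) (update (e.set i 0).stacks .fin w)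
      (M * 2 + 1) := by
  refine ((RunsIn.clear (e.var i) [] (by simp) _ (by simp [Env.stacks])).congr ?_).mono
    (by have := he.1 i; omega)
  rw [Env.stacks_set, update_comm (by simp)]
  rfl

theorem runsIn_clearTab {e : Env} {M : ℕ} (he : e.Bdd M) (t : ℕ) (w : List Bool) :
    RunsIn (Ticker.silent (.tab t)).transfer (update e.stacks .fin w)
      (update (e.setTab t []).stacks .fin w) (M * (2 * M * 2 + 6) + 1) := by
  have hlen := (he.2 t).1
  refine (((Ticker.silent (Reg.tab t)).runsIn_transfer (e.tab t) M (he.2 t).2 [] (by simp) _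
    (by simp [Env.stacks])).congr ?_).mono (T := (e.tab t).length * (2 * M * 2 + 6) + 1)
    (by gcongr)
  rw [Env.stacks_setTab, update_comm (by simp)]
  rfl

/-- Clear all variables and tables in use. -/
def cleanup : Prog Reg :=
  .seq (.loop (.var 0) .skip) (.seq (.loop (.var 1) .skip)
    (.seq (Ticker.silent (.tab 0)).transfer (.seq (Ticker.silent (.tab 1)).transfer
      (.seq (Ticker.silent (.tab 2)).transfer (Ticker.silent (.tab 3)).transfer))))

/-- A halting configuration must have all stacks empty except the one with the result. Input data
lie only in the variables 0, 1 and the tables 0 to 3; all other variables and tables are empty by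
hypothesis. -/
theorem runsIn_cleanup {e : Env} {M : ℕ} (he : e.Bdd M) (hv : ∀ i, 2 ≤ i → e.var i = 0)
    (ht : ∀ t, 4 ≤ t → e.tab t = []) (w : List Bool) :
    RunsIn cleanup (update e.stacks .fin w) (update (fun _ => []) .fin w)
      (2 * (M * 2 + 1) + 4 * (M * (2 * M * 2 + 6) + 1)) := by
  have b0 := he.set 0 (Nat.zero_le M)
  have b1 := b0.set 1 (Nat.zero_le M)
  have b2 := b1.setTab 0 (L := []) (Nat.zero_le M) (by simp)
  have b3 := b2.setTab 1 (L := []) (Nat.zero_le M) (by simp)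
  have b4 := b3.setTab 2 (L := []) (Nat.zero_le M) (by simp)
  have := (runsIn_clearVar he 0 w).seq ((runsIn_clearVar b0 1 w).seq ((runsIn_clearTab b1 0 w).seq
    ((runsIn_clearTab b2 1 w).seq ((runsIn_clearTab b3 2 w).seq (runsIn_clearTab b4 3 w)))))
  refine (this.congr ?_).mono (by omega)
  rw [← Env.stacks_empty]
  congr 2
  simp only [Env.setTab, Env.set, Env.empty, Env.mk.injEq]
  constructor
  · funext i
    by_cases h1 : i = 1 <;> by_cases h0 : i = 0 <;> simp [h0, h1]
    exact hv i (by omega)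
  · funext t
    by_cases h0 : t = 0
    · simp [h0]
    by_cases h1 : t = 1
    · simp [h1]
    by_cases h2 : t = 2
    · simp [h2]
    by_cases h3 : t = 3
    · simp [h3]
    simp only [h0, h1, h2, h3, if_false]
    exact ht t (by omega)

/-- A function is computable in polynomial time if its input can be read and its output can be
emitted in polynomial time. -/
theorem polyTime_of_emittable {α β : Type} {ea : α → List Bool} {eb : β → List Bool} {f : α → β}
    (env : α → Env) (read : Prog Reg) (R : Polynomial ℕ)
    (hread : ∀ a, RunsIn read (update (fun _ => []) .inp (ea a)) (env a).stacks
      (R.eval (ea a).length))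
    (hb : ∀ a, (env a).Bdd (ea a).length) (hv : ∀ a i, 2 ≤ i → (env a).var i = 0)
    (ht : ∀ a t, 4 ≤ t → (env a).tab t = []) (g : Env → List Bool) (hg : Emittable g)
    (h : ∀ a, eb (f a) = g (env a)) : Nonempty (Turing.TM2ComputableInPolyTime ea eb f) := by
  obtain ⟨p, P, hp⟩ := hg 0
  refine polyTime_of_run (.seq read (.seq (p .out) (.seq finish cleanup))) Reg.inp Reg.fin
    (R + (P + ((P * 3 + 1) + (2 * (.X * 2 + 1) + 4 * (.X * (2 * .X * 2 + 6) + 1))))) fun a => ?_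
  have h1 := hp (env a) _ _ .out trivial (hb a) (env a).rep_stacks .out
  -- The time for reversing the output is bounded through its length, which is bounded by the time
  -- spent on producing it.
  have hle : (eb (f a)).length ≤ P.eval (ea a).length := by
    obtain ⟨t, ht, hr⟩ := h1
    have := hr.length_le .out
    simp [output, marked] at this
    rw [h]
    omega
  rw [← h] at h1
  have ho : (env a).stacks .out = [] := rfl
  have hf : (env a).stacks .fin = [] := rfl
  have h2 := runsIn_finish (output .out (eb (f a)) (env a).stacks) (eb (f a))
    (by simp [output, ho])
  have h3 := runsIn_cleanup (hb a) (hv a) (ht a) (eb (f a))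
  simp only [Polynomial.eval_add, Polynomial.eval_mul, Polynomial.eval_X,
      Polynomial.eval_ofNat, Polynomial.eval_one]
  refine (hread a).seq (h1.seq (RunsIn.seq ((h2.congr ?_).mono (by omega)) h3))
  funext r
  simp only [output, update_apply]
  split_ifs <;> simp_all

/-- The environment that holds two graphs. -/
def pairEnv (p : GraphCode × GraphCode) : Env :=
  (((Env.empty.set 0 p.1.n).setTab 0 p.1.natEdges).set 1 p.2.n).setTab 1 p.2.natEdges

/-- The environment that holds two labeled graphs. -/
def labeledPairEnv (p : LabeledGraphCode × LabeledGraphCode) : Env :=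
  (((((Env.empty.set 0 p.1.n).setTab 0 p.1.natEdges).setTab 2
    (labelTable (List.ofFn p.1.label))).set 1 p.2.n).setTab 1 p.2.natEdges).setTab 3
    (labelTable (List.ofFn p.2.label))

theorem length_le_length_flatMap {α β : Type} (f : α → List β) (hf : ∀ a, f a ≠ [])
    (L : List α) : L.length ≤ (L.flatMap f).length := by
  induction L with
  | nil => simp
  | cons a L ih =>
    have := List.length_pos_iff.2 (hf a)
    simp only [List.flatMap_cons, List.length_append, List.length_cons]
    omega

theorem GraphCode.bdd_of_le {x : GraphCode} {M : ℕ} (h : x.encode.length ≤ M) : x.Bdd M := by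
  have := length_le_length_flatMap
    (fun e : Fin x.n × Fin x.n => true :: (unary e.1 ++ unary e.2)) (by simp) x.edges
  simp only [GraphCode.encode, List.length_append, unary, List.length_replicate] at h this
  constructor <;> omega

theorem polyTime_of_emittable_pair {β : Type} {eb : β → List Bool}
    {f : GraphCode × GraphCode → β} {g : Env → List Bool} (hg : Emittable g)
    (h : ∀ p, eb (f p) = g (pairEnv p)) :
    Nonempty (Turing.TM2ComputableInPolyTime encodePair eb f) := by
  have hbd : ∀ p : GraphCode × GraphCode,
      p.1.Bdd (encodePair p).length ∧ p.2.Bdd (encodePair p).length := fun p =>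
    ⟨GraphCode.bdd_of_le (by simp [encodePair]), GraphCode.bdd_of_le (by simp [encodePair])⟩
  refine polyTime_of_emittable pairEnv (.seq (readGraph 0) (readGraph 1))
    (2 * ((.X * 2 + 1) + ((.X * (2 * .X * 2 + 6) + 1) + (.X * (2 * .X * 2 + 6) + 1))))
    (fun p => ?_) (fun p => ?_) (fun p i hi => ?_) (fun p t ht => ?_) g hg h
  · have h1 := runsIn_readGraph (e := Env.empty) (j := 0) rfl rfl (hbd p).1 p.2.encode
    have h2 := runsIn_readGraph
      (e := (Env.empty.set 0 p.1.n).setTab 0 p.1.natEdges) (j := 1) rfl rfl (hbd p).2 []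
    rw [List.append_nil] at h2
    rw [Env.reading, Env.stacks_empty] at h1
    simp only [Polynomial.eval_add, Polynomial.eval_mul, Polynomial.eval_X,
      Polynomial.eval_ofNat, Polynomial.eval_one]
    refine ((h1.seq h2).congr ?_).mono (by omega)
    exact update_eq_self_iff.2 rfl
  · obtain ⟨h1, h2⟩ := hbd p
    refine (((Env.bdd_empty _).set 0 h1.1).setTab 0 ?_ h1.natEdges).set 1 h2.1 |>.setTab 1 ?_
      h2.natEdges
    · simpa [GraphCode.natEdges] using h1.2
    · simpa [GraphCode.natEdges] using h2.2
  · simp [pairEnv, Env.setTab, Env.set, Env.empty, show i ≠ 0 by omega, show i ≠ 1 by omega]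
  · simp [pairEnv, Env.setTab, Env.set, Env.empty, show t ≠ 0 by omega, show t ≠ 1 by omega]

theorem mem_le_length_flatMap_unary {L : List ℕ} {a : ℕ} (ha : a ∈ L) :
    a ≤ (L.flatMap unary).length := by
  induction L with
  | nil => simp at ha
  | cons b L ih =>
    simp only [List.flatMap_cons, List.length_append, unary, List.length_replicate]
    rcases List.mem_cons.1 ha with rfl | ha
    · omega
    · have := ih ha
      omega

theorem polyTime_of_emittable_labeledPair {β : Type} {eb : β → List Bool}
    {f : LabeledGraphCode × LabeledGraphCode → β} {g : Env → List Bool} (hg : Emittable g)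
    (h : ∀ p, eb (f p) = g (labeledPairEnv p)) :
    Nonempty (Turing.TM2ComputableInPolyTime encodeLabeledPair eb f) := by
  have hbd : ∀ (x : LabeledGraphCode) (M : ℕ), x.encode.length ≤ M →
      x.toGraphCode.Bdd M ∧ (List.ofFn x.label).length ≤ M ∧ ∀ a ∈ List.ofFn x.label, a ≤ M := by
    intro x M hM
    rw [LabeledGraphCode.encode, List.length_append] at hM
    have h1 := GraphCode.bdd_of_le (x := x.toGraphCode) (M := M) (by omega)
    refine ⟨h1, by simpa using h1.1, fun a ha => ?_⟩
    have := mem_le_length_flatMap_unary ha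
    omega
  have hbd' : ∀ p : LabeledGraphCode × LabeledGraphCode, p.1.encode.length ≤
      (encodeLabeledPair p).length ∧ p.2.encode.length ≤ (encodeLabeledPair p).length :=
    fun p => ⟨by simp [encodeLabeledPair], by simp [encodeLabeledPair]⟩
  refine polyTime_of_emittable labeledPairEnv
    (.seq (readGraph 0) (.seq (readLabels 0) (.seq (readGraph 1) (readLabels 1))))
    (2 * ((.X * 2 + 1) + ((.X * (2 * .X * 2 + 6) + 1) + (.X * (2 * .X * 2 + 6) + 1))) +
      2 * ((.X * 2 + 1) + ((.X * ((.X * 2 + 5) + 1) + 1) + (.X * (2 * .X * 2 + 6) + 1))))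
    (fun p => ?_) (fun p => ?_) (fun p i hi => ?_) (fun p t ht => ?_) g hg h
  · obtain ⟨g1, l1, m1⟩ := hbd p.1 _ (hbd' p).1
    obtain ⟨g2, l2, m2⟩ := hbd p.2 _ (hbd' p).2
    have h1 := runsIn_readGraph (e := Env.empty) (j := 0) rfl rfl g1
      ((List.ofFn p.1.label).flatMap unary ++ p.2.encode)
    have h2 := runsIn_readLabels (e := (Env.empty.set 0 p.1.n).setTab 0 p.1.natEdges) (j := 0)
      (L := List.ofFn p.1.label) (by simp [Env.setTab, Env.set]) rfl l1 m1 p.2.encode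
    have h3 := runsIn_readGraph (e := ((Env.empty.set 0 p.1.n).setTab 0 p.1.natEdges).setTab 2
      (labelTable (List.ofFn p.1.label))) (j := 1) rfl rfl g2
      ((List.ofFn p.2.label).flatMap unary)
    have h4 := runsIn_readLabels (e := ((((Env.empty.set 0 p.1.n).setTab 0 p.1.natEdges).setTab 2
      (labelTable (List.ofFn p.1.label))).set 1 p.2.n).setTab 1 p.2.natEdges) (j := 1)
      (L := List.ofFn p.2.label) (by simp [Env.setTab, Env.set]) rfl l2 m2 []
    rw [List.append_nil] at h4
    rw [Env.reading, Env.stacks_empty] at h1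
    have he : encodeLabeledPair p = p.1.toGraphCode.encode ++
        ((List.ofFn p.1.label).flatMap unary ++ p.2.encode) := by
      simp [encodeLabeledPair, LabeledGraphCode.encode]
    rw [← he] at h1
    simp only [Polynomial.eval_add, Polynomial.eval_mul, Polynomial.eval_X,
      Polynomial.eval_ofNat, Polynomial.eval_one]
    refine ((h1.seq (h2.seq (h3.seq h4))).congr ?_).mono (by omega)
    exact update_eq_self_iff.2 rfl
  · obtain ⟨g1, l1, m1⟩ := hbd p.1 _ (hbd' p).1
    obtain ⟨g2, l2, m2⟩ := hbd p.2 _ (hbd' p).2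
    have hl : ∀ {L : List ℕ} {M : ℕ}, (∀ a ∈ L, a ≤ M) →
        ∀ a ∈ labelTable L, a.1 ≤ M ∧ a.2 ≤ M := by
      intro L M hL a ha
      obtain ⟨k, hk, rfl⟩ := List.mem_map.1 ha
      exact ⟨hL k hk, by simp⟩
    refine ((((((Env.bdd_empty _).set 0 g1.1).setTab 0 ?_ g1.natEdges).setTab 2 ?_ (hl m1)).set 1
      g2.1).setTab 1 ?_ g2.natEdges).setTab 3 ?_ (hl m2)
    · simpa [GraphCode.natEdges] using g1.2
    · simpa [labelTable] using l1
    · simpa [GraphCode.natEdges] using g2.2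
    · simpa [labelTable] using l2
  · simp [labeledPairEnv, Env.setTab, Env.set, Env.empty, show i ≠ 0 by omega,
      show i ≠ 1 by omega]
  · simp [labeledPairEnv, Env.setTab, Env.set, Env.empty, show t ≠ 0 by omega,
      show t ≠ 1 by omega, show t ≠ 2 by omega, show t ≠ 3 by omega]

end ILPGraphs

namespace ILPGraphs

/-! ### The gadget graph -/

/-- The vertices of a graph, and six more. -/
abbrev PaddedVertex (n : ℕ) := Fin n ⊕ Fin 6

/-- The nodes of the gadget graph.  The rows are indexed by the padded vertices and one additional
index, the columns by pairs of padded vertices; there are `σ` copies of the columns. -/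
inductive GadgetNode (σ n : ℕ) : Type
  | pos (s : Fin σ) (i : Option (PaddedVertex n)) (u v : PaddedVertex n)
  | row (i : Option (PaddedVertex n))
  | col (s : Fin σ) (u v : PaddedVertex n)
  | kap (s : Fin σ) (t : Bool)
  | lam
  | mu (s : Fin σ) (t : Bool)

/-- The columns of the diagonal that belong to an additional vertex. -/
def IsMarked {n : ℕ} (u v : PaddedVertex n) : Prop := u = v ∧ ∃ k, u = Sum.inr k

/-- The positions at which the matrix has the entry `2`; all other entries are `1`. -/
def IsTwo {n : ℕ} (G : SimpleGraph (Fin n)) : Option (PaddedVertex n) → PaddedVertex n →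
    PaddedVertex n → Prop
  -- Diagonal columns distinguish the rows from each other; the columns of edges encode `G`. An
  -- off-diagonal column that does not come from an edge has no entry 2 in these rows.
  | some i, u, v => (i = u ∨ i = v) ∧
      (u = v ∨ ∃ a b, u = Sum.inl a ∧ v = Sum.inl b ∧ G.Adj a b)
  | none, u, v => IsMarked u v

/-- The edges of the gadget graph. -/
inductive GadgetEdge (σ : ℕ) {n : ℕ} (G : SimpleGraph (Fin n)) :
    GadgetNode σ n → GadgetNode σ n → Prop
  | pos_row (s i u v) : GadgetEdge σ G (.pos s i u v) (.row i)
  | pos_col (s i u v) : GadgetEdge σ G (.pos s i u v) (.col s u v)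
  | pos_kap (s i u v) (t : Bool) (h : t = true ↔ IsTwo G i u v) :
      GadgetEdge σ G (.pos s i u v) (.kap s t)
  | row_lam (i) : GadgetEdge σ G (.row i) .lam
  | col_mu (s u v) (t : Bool) (h : t = true ↔ IsMarked u v) :
      GadgetEdge σ G (.col s u v) (.mu s t)
  | pos_pos (s s' i u v) (h : s < s') : GadgetEdge σ G (.pos s i u v) (.pos s' i u v)
  | col_col (s s' u v) (h : s < s') : GadgetEdge σ G (.col s u v) (.col s' u v)

/-- The gadget graph. -/
def gadget (σ : ℕ) {n : ℕ} (G : SimpleGraph (Fin n)) : SimpleGraph (GadgetNode σ n) :=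
  SimpleGraph.fromRel (GadgetEdge σ G)

theorem GadgetEdge.ne {σ n : ℕ} {G : SimpleGraph (Fin n)} {x y : GadgetNode σ n}
    (h : GadgetEdge σ G x y) : x ≠ y := by
  cases h <;> simp <;> omega

theorem gadget_adj {σ n : ℕ} {G : SimpleGraph (Fin n)} {x y : GadgetNode σ n} :
    (gadget σ G).Adj x y ↔ GadgetEdge σ G x y ∨ GadgetEdge σ G y x := by
  rw [gadget, SimpleGraph.fromRel_adj]
  refine ⟨fun h => h.2, fun h => ⟨?_, h⟩⟩
  rcases h with h | h
  · exact h.ne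
  · exact h.ne.symm

/-- The labels of the nodes of the gadget graph. -/
def GadgetNode.label {σ n : ℕ} : GadgetNode σ n → ℕ
  | pos _ _ _ _ => 0
  | row _ => 1
  | col _ _ _ => 2
  -- For `σ ≤ 2` the coefficients of the matrix use the labels 3 to 6 and those of the objective the
  -- labels 8 to 11.
  | kap s t => 3 + (2 * s + t.toNat)
  | lam => 7
  | mu s t => 8 + (2 * s + t.toNat)

/-! #### Functoriality -/

section Functoriality

variable {σ n n' : ℕ} {G : SimpleGraph (Fin n)} {G' : SimpleGraph (Fin n')}

theorem isMarked_map (e : Fin n ≃ Fin n') (u v : PaddedVertex n) :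
    IsMarked (Sum.map e id u) (Sum.map e id v) ↔ IsMarked u v := by
  rcases u with u | u <;> rcases v with v | v <;> simp [IsMarked]

theorem isTwo_map (e : G ≃g G') (i : Option (PaddedVertex n)) (u v : PaddedVertex n) :
    IsTwo G' (i.map (Sum.map e id)) (Sum.map e id u) (Sum.map e id v) ↔ IsTwo G i u v := by
  cases i with
  | none => exact isMarked_map e.toEquiv u v
  | some i =>
    rcases i with i | i <;> rcases u with u | u <;> rcases v with v | v <;>
      simp [IsTwo, e.map_adj_iff]

/-- The map of nodes that is induced by a map of vertices. -/
def GadgetNode.map (σ : ℕ) (f : Fin n → Fin n') : GadgetNode σ n → GadgetNode σ n'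
  | pos s i u v => pos s (i.map (Sum.map f id)) (Sum.map f id u) (Sum.map f id v)
  | row i => row (i.map (Sum.map f id))
  | col s u v => col s (Sum.map f id u) (Sum.map f id v)
  | kap s t => kap s t
  | lam => lam
  | mu s t => mu s t

theorem GadgetNode.map_map_of_leftInverse {f : Fin n → Fin n'} {g : Fin n' → Fin n}
    (h : Function.LeftInverse g f) (x : GadgetNode σ n) : (x.map σ f).map σ g = x := by
  have h1 : ∀ u : PaddedVertex n, Sum.map g id (Sum.map f id u) = u := by
    rintro (u | u)
    · simp [h u]
    · rfl
  have h2 : ∀ i : Option (PaddedVertex n),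
      (i.map (Sum.map f id)).map (Sum.map g id) = i := by
    rintro (_ | i)
    · rfl
    · exact congrArg some (h1 i)
  cases x <;> simp only [GadgetNode.map, h1, h2]

theorem GadgetNode.label_map (f : Fin n → Fin n') (x : GadgetNode σ n) :
    (x.map σ f).label = x.label := by
  cases x <;> rfl

theorem GadgetEdge.map (e : G ≃g G') {x y : GadgetNode σ n} (h : GadgetEdge σ G x y) :
    GadgetEdge σ G' (x.map σ e) (y.map σ e) := by
  cases h with
  | pos_kap s i u v t h => exact .pos_kap _ _ _ _ _ (h.trans (isTwo_map e i u v).symm)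
  | col_mu s u v t h => exact .col_mu _ _ _ _ (h.trans (isMarked_map e.toEquiv u v).symm)
  | pos_row => exact .pos_row ..
  | pos_col => exact .pos_col ..
  | row_lam => exact .row_lam _
  | pos_pos s s' i u v h => exact .pos_pos _ _ _ _ _ h
  | col_col s s' u v h => exact .col_col _ _ _ _ h

theorem gadget_adj_map (e : G ≃g G') {x y : GadgetNode σ n} (h : (gadget σ G).Adj x y) :
    (gadget σ G').Adj (x.map σ e) (y.map σ e) := by
  rw [gadget_adj] at h ⊢
  exact h.imp (GadgetEdge.map e) (GadgetEdge.map e)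

/-- The isomorphism of gadget graphs that is induced by an isomorphism of graphs. -/
def gadgetIso (σ : ℕ) (e : G ≃g G') : gadget σ G ≃g gadget σ G' where
  toFun := GadgetNode.map σ e
  invFun := GadgetNode.map σ e.symm
  left_inv := GadgetNode.map_map_of_leftInverse e.symm_apply_apply
  right_inv := GadgetNode.map_map_of_leftInverse e.apply_symm_apply
  map_rel_iff' := by
    intro x y
    refine ⟨fun h => ?_, gadget_adj_map e⟩
    have := gadget_adj_map e.symm h
    simpa only [Equiv.coe_fn_mk,
      GadgetNode.map_map_of_leftInverse e.symm_apply_apply] using this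

end Functoriality

/-! ### Recognition of the vertices and edges in the gadget graph -/

section Recognition

variable {V V' : Type} (H : SimpleGraph V) {H' : SimpleGraph V'}

/-- The degree of a node. -/
noncomputable def deg (x : V) : ℕ := (H.neighborSet x).ncard

/-- Nodes of degree at most four. -/
def IsSmall (x : V) : Prop := deg H x ≤ 4

/-- Larger nodes with a larger neighbor. -/
def IsLine (x : V) : Prop := ¬ IsSmall H x ∧ ∃ w, H.Adj x w ∧ ¬ IsSmall H w

/-- Larger nodes all of whose neighbors are small. -/
def IsEntry (x : V) : Prop := ¬ IsSmall H x ∧ ∀ w, H.Adj x w → IsSmall H w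

/-- Larger nodes all of whose neighbors are larger. -/
def IsOuter (x : V) : Prop := ¬ IsSmall H x ∧ ∀ w, H.Adj x w → ¬ IsSmall H w

/-- Small nodes adjacent to an entry that does not have maximal degree. -/
def IsRare (x : V) : Prop :=
  IsSmall H x ∧ ∃ k, H.Adj x k ∧ IsEntry H k ∧ ∃ k', IsEntry H k' ∧ deg H k < deg H k'

/-- The relation that recovers a graph from its gadget graph. -/
def Linked (x y : V) : Prop :=
  -- In the gadget, `z` is a column and `a`, `a'` are entries 2 in it, in the rows `x` and `y`. The
  -- outer neighbor of degree more than 6 says that the column is not marked, and the comparisons of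
  -- degrees say that `z` is a column while `x` and `y` are rows.
  ∃ z a a', IsRare H a ∧ IsRare H a' ∧ H.Adj z a ∧ H.Adj z a' ∧ H.Adj x a ∧ H.Adj y a' ∧
    IsLine H x ∧ IsLine H y ∧ IsLine H z ∧ (∃ w, H.Adj z w ∧ IsOuter H w ∧ 6 < deg H w) ∧
    deg H z < deg H x ∧ deg H z < deg H y

variable {H}

theorem deg_map (e : H ≃g H') (x : V) : deg H' (e x) = deg H x := by
  have : H'.neighborSet (e x) = e '' H.neighborSet x := by
    ext y
    constructor
    · intro hy
      refine ⟨e.symm y, ?_, e.apply_symm_apply y⟩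
      rw [SimpleGraph.mem_neighborSet] at hy ⊢
      rwa [← e.map_adj_iff, e.apply_symm_apply]
    · rintro ⟨z, hz, rfl⟩
      exact e.map_adj_iff.2 hz
  rw [deg, this, Set.ncard_image_of_injective _ e.injective, deg]

theorem isSmall_map (e : H ≃g H') (x : V) : IsSmall H' (e x) ↔ IsSmall H x := by
  rw [IsSmall, IsSmall, deg_map]

theorem isLine_map (e : H ≃g H') {x : V} (h : IsLine H x) : IsLine H' (e x) := by
  obtain ⟨h1, w, h2, h3⟩ := h
  exact ⟨by rwa [isSmall_map], e w, e.map_adj_iff.2 h2, by rwa [isSmall_map]⟩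

theorem isEntry_map (e : H ≃g H') {x : V} (h : IsEntry H x) : IsEntry H' (e x) := by
  refine ⟨by rw [isSmall_map]; exact h.1, fun w hw => ?_⟩
  obtain ⟨w, rfl⟩ := e.surjective w
  rw [isSmall_map]
  exact h.2 w (e.map_adj_iff.1 hw)

theorem isOuter_map (e : H ≃g H') {x : V} (h : IsOuter H x) : IsOuter H' (e x) := by
  refine ⟨by rw [isSmall_map]; exact h.1, fun w hw => ?_⟩
  obtain ⟨w, rfl⟩ := e.surjective w
  rw [isSmall_map]
  exact h.2 w (e.map_adj_iff.1 hw)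

theorem isRare_map (e : H ≃g H') {x : V} (h : IsRare H x) : IsRare H' (e x) := by
  obtain ⟨h1, k, h2, h3, k', h4, h5⟩ := h
  exact ⟨by rwa [isSmall_map], e k, e.map_adj_iff.2 h2, isEntry_map e h3, e k', isEntry_map e h4,
    by rwa [deg_map, deg_map]⟩

theorem linked_map (e : H ≃g H') {x y : V} (h : Linked H x y) : Linked H' (e x) (e y) := by
  obtain ⟨z, a, a', h1, h2, h3, h4, h5, h6, h7, h8, h9, ⟨w, h10, h11, h12⟩, h13, h14⟩ := h
  refine ⟨e z, e a, e a', isRare_map e h1, isRare_map e h2, e.map_adj_iff.2 h3,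
    e.map_adj_iff.2 h4, e.map_adj_iff.2 h5, e.map_adj_iff.2 h6, isLine_map e h7, isLine_map e h8,
    isLine_map e h9, ⟨e w, e.map_adj_iff.2 h10, isOuter_map e h11, ?_⟩, ?_, ?_⟩
  · rwa [deg_map]
  · rwa [deg_map, deg_map]
  · rwa [deg_map, deg_map]

theorem linked_map_iff (e : H ≃g H') {x y : V} : Linked H' (e x) (e y) ↔ Linked H x y := by
  refine ⟨fun h => ?_, linked_map e⟩
  simpa using linked_map e.symm h

theorem card_le_deg [Finite V] {ι : Type} [Fintype ι] {x : V} (f : ι → V)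
    (hf : Function.Injective f) (h : ∀ i, H.Adj x (f i)) : Fintype.card ι ≤ deg H x := by
  rw [← Nat.card_eq_fintype_card, ← Set.ncard_univ, ← Set.ncard_image_of_injective _ hf]
  refine Set.ncard_le_ncard ?_ (Set.toFinite _)
  rintro _ ⟨i, -, rfl⟩
  exact h i

theorem ncard_range_le {ι : Type} [Fintype ι] (f : ι → V) :
    (Set.range f).ncard ≤ Fintype.card ι := by
  rw [← Set.image_univ, ← Nat.card_eq_fintype_card, ← Set.ncard_univ]
  exact Set.ncard_image_le (Set.toFinite _)

end Recognition

end ILPGraphs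

namespace ILPGraphs

/-! ### Numbering of the nodes -/

/-- The number of a padded vertex. -/
def vertexNum {n : ℕ} : PaddedVertex n → ℕ
  | .inl a => a
  | .inr b => n + b

/-- The number of a row. -/
def rowNum {n : ℕ} : Option (PaddedVertex n) → ℕ
  | some u => vertexNum u
  | none => n + 6

/-- The number of nodes of the gadget graph. -/
abbrev gadgetSize (σ n : ℕ) : ℕ :=
  σ * (n + 7) * (n + 6) * (n + 6) + ((n + 7) + (σ * (n + 6) * (n + 6) + (σ * 2 + (1 + σ * 2))))

/-- The number of a node of the gadget graph. -/
def GadgetNode.num {σ n : ℕ} : GadgetNode σ n → ℕ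
  | pos s i u v => ((s * (n + 7) + rowNum i) * (n + 6) + vertexNum u) * (n + 6) + vertexNum v
  | row i => σ * (n + 7) * (n + 6) * (n + 6) + rowNum i
  | col s u v => σ * (n + 7) * (n + 6) * (n + 6) + ((n + 7) +
      ((s * (n + 6) + vertexNum u) * (n + 6) + vertexNum v))
  | kap s t => σ * (n + 7) * (n + 6) * (n + 6) + ((n + 7) + (σ * (n + 6) * (n + 6) +
      (s * 2 + t.toNat)))
  | lam => σ * (n + 7) * (n + 6) * (n + 6) + ((n + 7) + (σ * (n + 6) * (n + 6) + σ * 2))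
  | mu s t => σ * (n + 7) * (n + 6) * (n + 6) + ((n + 7) + (σ * (n + 6) * (n + 6) +
      (σ * 2 + (1 + (s * 2 + t.toNat)))))

/-- The numbering of the padded vertices. -/
def vertexEquiv (n : ℕ) : PaddedVertex n ≃ Fin (n + 6) := finSumFinEquiv

theorem vertexEquiv_val {n : ℕ} (u : PaddedVertex n) : (vertexEquiv n u : ℕ) = vertexNum u := by
  rcases u with u | u <;> simp [vertexEquiv, vertexNum]

/-- The numbering of the rows. -/
def rowEquiv (n : ℕ) : Option (PaddedVertex n) ≃ Fin (n + 7) :=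
  (Equiv.optionCongr (vertexEquiv n)).trans finSuccEquivLast.symm

theorem rowEquiv_val {n : ℕ} (i : Option (PaddedVertex n)) : (rowEquiv n i : ℕ) = rowNum i := by
  cases i with
  | none => simp [rowEquiv, rowNum]
  | some u => simp [rowEquiv, rowNum, vertexEquiv_val]

/-- The nodes of the gadget graph as a sum type. -/
def GadgetNode.sumEquiv (σ n : ℕ) : GadgetNode σ n ≃
    (((Fin σ × Option (PaddedVertex n)) × PaddedVertex n) × PaddedVertex n) ⊕
      (Option (PaddedVertex n) ⊕ (((Fin σ × PaddedVertex n) × PaddedVertex n) ⊕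
        ((Fin σ × Bool) ⊕ (Unit ⊕ (Fin σ × Bool))))) where
  toFun
    | pos s i u v => .inl (((s, i), u), v)
    | row i => .inr (.inl i)
    | col s u v => .inr (.inr (.inl ((s, u), v)))
    | kap s t => .inr (.inr (.inr (.inl (s, t))))
    | lam => .inr (.inr (.inr (.inr (.inl ()))))
    | mu s t => .inr (.inr (.inr (.inr (.inr (s, t)))))
  invFun
    | .inl (((s, i), u), v) => pos s i u v
    | .inr (.inl i) => row i
    | .inr (.inr (.inl ((s, u), v))) => col s u v
    | .inr (.inr (.inr (.inl (s, t)))) => kap s t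
    | .inr (.inr (.inr (.inr (.inl ())))) => lam
    | .inr (.inr (.inr (.inr (.inr (s, t))))) => mu s t
  left_inv x := by cases x <;> rfl
  right_inv x := by rcases x with x | x | x | x | x | x <;> rfl

/-- The product of two numberings. -/
def prodNumbering {α β : Type} {m k : ℕ} (e : α ≃ Fin m) (f : β ≃ Fin k) : α × β ≃ Fin (m * k) :=
  (e.prodCongr f).trans finProdFinEquiv

theorem prodNumbering_val {α β : Type} {m k : ℕ} (e : α ≃ Fin m) (f : β ≃ Fin k) (a : α) (b : β) :
    (prodNumbering e f (a, b) : ℕ) = e a * k + f b := by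
  simp [prodNumbering, Nat.mul_comm, Nat.add_comm]

/-- The sum of two numberings. -/
def sumNumbering {α β : Type} {m k : ℕ} (e : α ≃ Fin m) (f : β ≃ Fin k) : α ⊕ β ≃ Fin (m + k) :=
  (e.sumCongr f).trans finSumFinEquiv

theorem sumNumbering_inl {α β : Type} {m k : ℕ} (e : α ≃ Fin m) (f : β ≃ Fin k) (a : α) :
    (sumNumbering e f (.inl a) : ℕ) = e a := by
  simp [sumNumbering]

theorem sumNumbering_inr {α β : Type} {m k : ℕ} (e : α ≃ Fin m) (f : β ≃ Fin k) (b : β) :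
    (sumNumbering e f (.inr b) : ℕ) = m + f b := by
  simp [sumNumbering]

/-- The numbering of the truth values. -/
def boolNumbering : Bool ≃ Fin 2 where
  toFun b := ⟨b.toNat, by cases b <;> decide⟩
  invFun i := i == 1
  left_inv b := by cases b <;> rfl
  right_inv i := by fin_cases i <;> rfl

theorem boolNumbering_val (b : Bool) : (boolNumbering b : ℕ) = b.toNat := rfl

/-- The numbering of the nodes of the gadget graph. -/
def GadgetNode.numbering (σ n : ℕ) : GadgetNode σ n ≃ Fin (gadgetSize σ n) :=
  (GadgetNode.sumEquiv σ n).trans <|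
    sumNumbering (prodNumbering (prodNumbering (prodNumbering (Equiv.refl _) (rowEquiv n))
      (vertexEquiv n)) (vertexEquiv n)) <|
    sumNumbering (rowEquiv n) <|
    sumNumbering (prodNumbering (prodNumbering (Equiv.refl _) (vertexEquiv n)) (vertexEquiv n)) <|
    sumNumbering (prodNumbering (Equiv.refl _) boolNumbering) <|
    sumNumbering finOneEquiv.symm (prodNumbering (Equiv.refl _) boolNumbering)

theorem GadgetNode.numbering_val {σ n : ℕ} (x : GadgetNode σ n) :
    (GadgetNode.numbering σ n x : ℕ) = x.num := by
  cases x <;> simp only [GadgetNode.numbering, GadgetNode.sumEquiv, Equiv.trans_apply,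
    Equiv.coe_fn_mk, sumNumbering_inl, sumNumbering_inr, prodNumbering_val, Equiv.refl_apply,
    rowEquiv_val, vertexEquiv_val, boolNumbering_val, GadgetNode.num]
  simp

instance (σ n : ℕ) : Finite (GadgetNode σ n) := Finite.of_equiv _ (GadgetNode.numbering σ n).symm

/-! ### Degrees in the gadget graph -/

section Degrees

variable {σ n : ℕ} {G : SimpleGraph (Fin n)}

open Classical in
-- The neighbors of a position are its row, its column, its coefficient and, as `σ ≤ 2`, at most one
-- twin.
theorem deg_pos_le (hσ : σ ≤ 2) (s : Fin σ) (i : Option (PaddedVertex n)) (u v : PaddedVertex n) :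
    deg (gadget σ G) (.pos s i u v) ≤ 4 := by
  have hsub : (gadget σ G).neighborSet (.pos s i u v) ⊆
      {.row i, .col s u v, .kap s (decide (IsTwo G i u v))} ∪
        (fun s' => GadgetNode.pos s' i u v) '' {s' : Fin σ | s' ≠ s} := by
    intro x hx
    rw [SimpleGraph.mem_neighborSet, gadget_adj] at hx
    rcases hx with h | h
    · cases h with
      | pos_row => simp
      | pos_col => simp
      | pos_kap _ _ _ _ t h =>
        have : t = decide (IsTwo G i u v) := by rw [Bool.eq_iff_iff, h]; simp
        simp [this]
      | pos_pos _ s' _ _ _ h => exact .inr ⟨s', h.ne', rfl⟩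
    · cases h with
      | pos_pos s' _ _ _ _ h => exact .inr ⟨s', h.ne, rfl⟩
  have h1 : ({s' : Fin σ | s' ≠ s} : Set (Fin σ)).ncard ≤ 1 := by
    rw [Set.ncard_le_one_iff]
    intro a b ha hb
    have h1 : (a : ℕ) ≠ s := fun h => ha (Fin.ext h)
    have h2 : (b : ℕ) ≠ s := fun h => hb (Fin.ext h)
    ext
    omega
  calc _ ≤ _ := Set.ncard_le_ncard hsub (Set.toFinite _)
    _ ≤ _ := Set.ncard_union_le _ _
    _ ≤ 3 + 1 := by
      refine Nat.add_le_add ?_ ((Set.ncard_image_le (Set.toFinite _)).trans h1)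
      refine (Set.ncard_insert_le _ _).trans (Nat.add_le_add_right ?_ 1)
      refine (Set.ncard_insert_le _ _).trans (Nat.add_le_add_right ?_ 1)
      simp

theorem adj_pos_row (s : Fin σ) (i u v) : (gadget σ G).Adj (.pos s i u v) (.row i) :=
  gadget_adj.2 (.inl (.pos_row ..))

theorem adj_pos_col (s : Fin σ) (i u v) : (gadget σ G).Adj (.pos s i u v) (.col s u v) :=
  gadget_adj.2 (.inl (.pos_col ..))

theorem adj_pos_kap (s : Fin σ) {i u v} {t : Bool} (h : t = true ↔ IsTwo G i u v) :
    (gadget σ G).Adj (.pos s i u v) (.kap s t) :=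
  gadget_adj.2 (.inl (.pos_kap _ _ _ _ _ h))

theorem adj_row_lam (i) : (gadget σ G).Adj (.row i) .lam :=
  gadget_adj.2 (.inl (.row_lam i))

theorem adj_col_mu (s : Fin σ) {u v} {t : Bool} (h : t = true ↔ IsMarked u v) :
    (gadget σ G).Adj (.col s u v) (.mu s t) :=
  gadget_adj.2 (.inl (.col_mu _ _ _ _ h))

theorem isMarked_inr (k : Fin 6) : IsMarked (n := n) (.inr k) (.inr k) := ⟨rfl, k, rfl⟩

theorem not_isMarked_inr {k l : Fin 6} (h : k ≠ l) : ¬ IsMarked (n := n) (.inr k) (.inr l) :=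
  fun h' => h (Sum.inr_injective h'.1)

/-- The six padding vertices exist for every `n`, even for `n = 0`. They provide six neighbors here
and for every other node that is not a position. -/
theorem six_le_deg_row (s : Fin σ) (i) : 6 ≤ deg (gadget σ G) (.row i) := by
  refine (Fintype.card_fin 6).symm.le.trans
    (card_le_deg (fun k : Fin 6 => .pos s i (.inr k) (.inr k)) ?_ ?_)
  · intro k l h; simpa using h
  · intro k; exact (adj_pos_row ..).symm

theorem six_le_deg_col (s : Fin σ) (u v) : 6 ≤ deg (gadget σ G) (.col s u v) := by
  refine (Fintype.card_fin 6).symm.le.trans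
    (card_le_deg (fun k : Fin 6 => .pos s (some (.inr k)) u v) ?_ ?_)
  · intro k l h; simpa using h
  · intro k; exact (adj_pos_col ..).symm

theorem six_le_deg_kap (s : Fin σ) (t : Bool) : 6 ≤ deg (gadget σ G) (.kap s t) := by
  cases t with
  | true =>
    refine (Fintype.card_fin 6).symm.le.trans
      (card_le_deg (fun k : Fin 6 => .pos s none (.inr k) (.inr k)) ?_ ?_)
    · intro k l h; simpa using h
    · intro k
      exact (adj_pos_kap s (by simpa [IsTwo] using isMarked_inr k)).symm
  | false =>
    refine (Fintype.card_fin 6).symm.le.trans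
      (card_le_deg (fun k : Fin 6 => .pos s none (.inr k) (.inr (k + 1))) ?_ ?_)
    · intro k l h; simpa using h
    · intro k
      have : k ≠ k + 1 := by revert k; decide
      exact (adj_pos_kap s (by simpa [IsTwo] using not_isMarked_inr this)).symm

theorem six_le_deg_lam : 6 ≤ deg (gadget σ G) .lam := by
  refine (Fintype.card_fin 6).symm.le.trans
    (card_le_deg (fun k : Fin 6 => .row (some (.inr k))) ?_ ?_)
  · intro k l h; simpa using h
  · intro k; exact (adj_row_lam _).symm

/-- Every padding vertex `k` already contributes the two unmarked columns `(k, k + 1)` and `(k, k +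
2)`. The strict inequality is needed to separate this node from the coefficient of the marked
columns, which has degree 6. -/
theorem six_lt_deg_mu (s : Fin σ) : 6 < deg (gadget σ G) (.mu s false) := by
  refine lt_of_lt_of_le (by decide : 6 < Fintype.card (Fin 6 × Fin 2))
    (card_le_deg (fun k : Fin 6 × Fin 2 =>
      .col s (.inr k.1) (.inr (if k.2 = 0 then k.1 + 1 else k.1 + 2))) ?_ ?_)
  · intro k l h
    simp only [GadgetNode.col.injEq, Sum.inr.injEq, true_and] at h
    revert k l
    decide
  · intro k
    have : k.1 ≠ if k.2 = 0 then k.1 + 1 else k.1 + 2 := by revert k; decide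
    exact (adj_col_mu s (by simpa using not_isMarked_inr this)).symm

theorem six_le_deg_mu (s : Fin σ) (t : Bool) : 6 ≤ deg (gadget σ G) (.mu s t) := by
  cases t with
  | true =>
    refine (Fintype.card_fin 6).symm.le.trans
      (card_le_deg (fun k : Fin 6 => .col s (.inr k) (.inr k)) ?_ ?_)
    · intro k l h; simpa using h
    · intro k
      exact (adj_col_mu s (by simpa using isMarked_inr k)).symm
  | false => exact (six_lt_deg_mu s).le

theorem deg_mu_le (s : Fin σ) : deg (gadget σ G) (.mu s true) ≤ 6 := by
  refine (Set.ncard_le_ncard ?_ (Set.toFinite _)).trans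
    ((ncard_range_le fun k : Fin 6 => GadgetNode.col s (.inr k) (.inr k)).trans (by simp))
  intro x hx
  rw [SimpleGraph.mem_neighborSet, gadget_adj] at hx
  rcases hx with h | h
  · cases h
  · cases h with
    | col_mu _ u v _ h =>
      obtain ⟨rfl, k, rfl⟩ := h.1 rfl
      exact ⟨k, rfl⟩

/-- A row has a neighbor in each of the `(n + 6)²` columns, whereas a column has at most `n + 7`
positions and four further neighbors. -/
theorem deg_col_lt_deg_row (hσ : σ ≤ 2) (s : Fin σ) (u v i) :
    deg (gadget σ G) (.col s u v) < deg (gadget σ G) (.row i) := by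
  have h1 : (n + 6) * (n + 6) ≤ deg (gadget σ G) (.row i) := by
    refine le_trans (by simp) (card_le_deg
      (fun k : PaddedVertex n × PaddedVertex n => .pos s i k.1 k.2) ?_ ?_)
    · intro k l h
      simpa [Prod.ext_iff] using h
    · intro k; exact (adj_pos_row ..).symm
  have h2 : deg (gadget σ G) (.col s u v) ≤ (n + 7) + (2 + 2) := by
    have hsub : (gadget σ G).neighborSet (.col s u v) ⊆
        Set.range (fun i => GadgetNode.pos s i u v) ∪ (Set.range (fun t => GadgetNode.mu s t) ∪
          Set.range (fun s' => GadgetNode.col s' u v)) := by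
      intro x hx
      rw [SimpleGraph.mem_neighborSet, gadget_adj] at hx
      rcases hx with h | h
      · cases h with
        | col_mu _ _ _ t => exact .inr (.inl ⟨t, rfl⟩)
        | col_col _ s' => exact .inr (.inr ⟨s', rfl⟩)
      · cases h with
        | pos_col _ i => exact .inl ⟨i, rfl⟩
        | col_col s' => exact .inr (.inr ⟨s', rfl⟩)
    refine (Set.ncard_le_ncard hsub (Set.toFinite _)).trans ((Set.ncard_union_le _ _).trans
      (Nat.add_le_add ((ncard_range_le _).trans (by simp)) ((Set.ncard_union_le _ _).trans
      (Nat.add_le_add ((ncard_range_le _).trans (by simp))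
        ((ncard_range_le _).trans (by simpa using hσ))))))
  nlinarith

/-- The additional row has at most `(n + 6)²` entries 2, and a column `(u, v)` has at most two
others, in the rows `u` and `v`. So at most `3 (n + 6)²` of the `(n + 7) (n + 6)²` positions of a
copy carry a 2, which is less than half. -/
theorem deg_kap_lt (s : Fin σ) :
    deg (gadget σ G) (.kap s true) < deg (gadget σ G) (.kap s false) := by
  set Q := PaddedVertex n × PaddedVertex n
  have hQ : Fintype.card Q = (n + 6) * (n + 6) := by simp [Q]
  have h1 : deg (gadget σ G) (.kap s true) ≤ (n + 6) * (n + 6) + ((n + 6) * (n + 6) +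
      (n + 6) * (n + 6)) := by
    have hsub : (gadget σ G).neighborSet (.kap s true) ⊆
        Set.range (fun q : Q => GadgetNode.pos s none q.1 q.2) ∪
        (Set.range (fun q : Q => GadgetNode.pos s (some q.1) q.1 q.2) ∪
          Set.range (fun q : Q => GadgetNode.pos s (some q.2) q.1 q.2)) := by
      intro x hx
      rw [SimpleGraph.mem_neighborSet, gadget_adj] at hx
      rcases hx with h | h
      · cases h
      · cases h with
        | pos_kap _ i u v _ h =>
          cases i with
          | none => exact .inl ⟨(u, v), rfl⟩
          | some i =>
            rcases (h.1 rfl).1 with rfl | rfl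
            · exact .inr (.inl ⟨(i, v), rfl⟩)
            · exact .inr (.inr ⟨(u, i), rfl⟩)
    refine (Set.ncard_le_ncard hsub (Set.toFinite _)).trans ((Set.ncard_union_le _ _).trans
      (Nat.add_le_add ((ncard_range_le _).trans hQ.le) ((Set.ncard_union_le _ _).trans
      (Nat.add_le_add ((ncard_range_le _).trans hQ.le) ((ncard_range_le _).trans hQ.le)))))
  have h2 : (n + 7) * ((n + 6) * (n + 6)) ≤
      deg (gadget σ G) (.kap s true) + deg (gadget σ G) (.kap s false) := by
    have hinj : Function.Injective (fun q : Option (PaddedVertex n) × Q =>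
        (GadgetNode.pos s q.1 q.2.1 q.2.2 : GadgetNode σ n)) := by
      rintro ⟨i, u, v⟩ ⟨i', u', v'⟩ h
      obtain ⟨rfl, rfl, rfl⟩ : i = i' ∧ u = u' ∧ v = v' := by simpa using h
      rfl
    have hcard : (Set.range (fun q : Option (PaddedVertex n) × Q =>
        (GadgetNode.pos s q.1 q.2.1 q.2.2 : GadgetNode σ n))).ncard =
        (n + 7) * ((n + 6) * (n + 6)) := by
      rw [← Set.image_univ, Set.ncard_image_of_injective _ hinj, Set.ncard_univ,
        Nat.card_eq_fintype_card]
      simp [Q]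
    rw [← hcard]
    refine (Set.ncard_le_ncard ?_ (Set.toFinite _)).trans (Set.ncard_union_le _ _)
    rintro _ ⟨⟨i, u, v⟩, rfl⟩
    by_cases h : IsTwo G i u v
    · exact .inl (adj_pos_kap s (by simpa using h)).symm
    · exact .inr (adj_pos_kap s (by simpa using h)).symm
  nlinarith

/-- All copies have the same pattern of entries. Hence comparing the degrees of coefficient nodes is
meaningful even across copies, where an isomorphism could mix them. -/
theorem deg_kap_eq (s s' : Fin σ) (t : Bool) :
    deg (gadget σ G) (.kap s t) = deg (gadget σ G) (.kap s' t) := by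
  have key : ∀ s : Fin σ, deg (gadget σ G) (.kap s t) =
      {q : Option (PaddedVertex n) × PaddedVertex n × PaddedVertex n |
        t = true ↔ IsTwo G q.1 q.2.1 q.2.2}.ncard := by
    intro s
    have hinj : Function.Injective
        (fun q : Option (PaddedVertex n) × PaddedVertex n × PaddedVertex n =>
          (GadgetNode.pos s q.1 q.2.1 q.2.2 : GadgetNode σ n)) := by
      rintro ⟨i, u, v⟩ ⟨i', u', v'⟩ h
      obtain ⟨rfl, rfl, rfl⟩ : i = i' ∧ u = u' ∧ v = v' := by simpa using h
      rfl
    rw [← Set.ncard_image_of_injective _ hinj, deg]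
    congr 1
    ext x
    rw [SimpleGraph.mem_neighborSet, gadget_adj]
    constructor
    · rintro (h | h)
      · cases h
      · cases h with
        | pos_kap _ i u v _ h => exact ⟨(i, u, v), h, rfl⟩
    · rintro ⟨⟨i, u, v⟩, h, rfl⟩
      exact .inr (.pos_kap _ _ _ _ _ h)
  rw [key s, key s']

end Degrees

end ILPGraphs

namespace ILPGraphs

/-! ### The gadget graph determines the graph -/

section Recovery

variable {σ n : ℕ} {G : SimpleGraph (Fin n)}

theorem isSmall_pos (hσ : σ ≤ 2) (s : Fin σ) (i u v) : IsSmall (gadget σ G) (.pos s i u v) :=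
  deg_pos_le hσ s i u v

theorem not_isSmall_row (s : Fin σ) (i) : ¬ IsSmall (gadget σ G) (.row i) := by
  have := six_le_deg_row (G := G) s i
  rw [IsSmall]; omega

theorem not_isSmall_col (s : Fin σ) (u v) : ¬ IsSmall (gadget σ G) (.col s u v) := by
  have := six_le_deg_col (G := G) s u v
  rw [IsSmall]; omega

theorem not_isSmall_kap (s : Fin σ) (t) : ¬ IsSmall (gadget σ G) (.kap s t) := by
  have := six_le_deg_kap (G := G) s t
  rw [IsSmall]; omega

theorem not_isSmall_lam : ¬ IsSmall (gadget σ G) .lam := by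
  have := six_le_deg_lam (G := G) (σ := σ)
  rw [IsSmall]; omega

theorem not_isSmall_mu (s : Fin σ) (t) : ¬ IsSmall (gadget σ G) (.mu s t) := by
  have := six_le_deg_mu (G := G) s t
  rw [IsSmall]; omega

theorem exists_eq_pos_of_isSmall (s₀ : Fin σ) {x : GadgetNode σ n}
    (h : IsSmall (gadget σ G) x) : ∃ s i u v, x = .pos s i u v := by
  cases x with
  | pos s i u v => exact ⟨s, i, u, v, rfl⟩
  | row i => exact absurd h (not_isSmall_row s₀ i)
  | col s u v => exact absurd h (not_isSmall_col s u v)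
  | kap s t => exact absurd h (not_isSmall_kap s t)
  | lam => exact absurd h not_isSmall_lam
  | mu s t => exact absurd h (not_isSmall_mu s t)

open Classical in
theorem exists_adj_col_mu (s : Fin σ) (u v : PaddedVertex n) :
    ∃ t, (gadget σ G).Adj (.col s u v) (.mu s t) :=
  ⟨decide (IsMarked u v), adj_col_mu s (by simp)⟩

theorem exists_adj_mu_col (s : Fin σ) (t : Bool) :
    ∃ u v, (gadget σ G).Adj (.mu s t) (.col s u v) := by
  cases t with
  | true => exact ⟨_, _, (adj_col_mu s (by simpa using isMarked_inr 0)).symm⟩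
  | false =>
    exact ⟨_, _, (adj_col_mu s (by simpa using not_isMarked_inr (show (0 : Fin 6) ≠ 1 by decide))).symm⟩

theorem isEntry_kap (hσ : σ ≤ 2) (s : Fin σ) (t) : IsEntry (gadget σ G) (.kap s t) := by
  refine ⟨not_isSmall_kap s t, fun w hw => ?_⟩
  rcases gadget_adj.1 hw with h | h
  · cases h
  · cases h with
    | pos_kap => exact isSmall_pos hσ ..

/-- Every other large node has a large neighbor: rows are joined to the right hand side and columns
to the objective coefficients, and each of these coefficient nodes does occur. -/
theorem exists_eq_kap_of_isEntry (hσ : σ ≤ 2) (s₀ : Fin σ) {x : GadgetNode σ n}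
    (h : IsEntry (gadget σ G) x) : ∃ s t, x = .kap s t := by
  cases x with
  | pos s i u v => exact absurd (isSmall_pos hσ s i u v) h.1
  | row i => exact absurd (h.2 _ (adj_row_lam i)) not_isSmall_lam
  | col s u v =>
    obtain ⟨t, ht⟩ := exists_adj_col_mu (G := G) s u v
    exact absurd (h.2 _ ht) (not_isSmall_mu s t)
  | kap s t => exact ⟨s, t, rfl⟩
  | lam => exact absurd (h.2 _ (adj_row_lam none).symm) (not_isSmall_row s₀ none)
  | mu s t =>
    obtain ⟨u, v, hw⟩ := exists_adj_mu_col (G := G) s t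
    exact absurd (h.2 _ hw) (not_isSmall_col s u v)

theorem isRare_pos (hσ : σ ≤ 2) (s : Fin σ) {i u v} (h : IsTwo G i u v) :
    IsRare (gadget σ G) (.pos s i u v) :=
  ⟨isSmall_pos hσ .., .kap s true, adj_pos_kap s (by simpa using h), isEntry_kap hσ s _,
    .kap s false, isEntry_kap hσ s _, deg_kap_lt s⟩

/-- The node of the entry 1 has maximal degree among all entry nodes of all copies, so an entry node
of smaller degree belongs to the entry 2. -/
theorem exists_eq_pos_of_isRare (hσ : σ ≤ 2) (s₀ : Fin σ) {x : GadgetNode σ n}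
    (h : IsRare (gadget σ G) x) : ∃ s i u v, x = .pos s i u v ∧ IsTwo G i u v := by
  obtain ⟨h1, k, h2, h3, k', h4, h5⟩ := h
  obtain ⟨s, i, u, v, rfl⟩ := exists_eq_pos_of_isSmall s₀ h1
  obtain ⟨s₁, t₁, rfl⟩ := exists_eq_kap_of_isEntry hσ s₀ h3
  obtain ⟨s₂, t₂, rfl⟩ := exists_eq_kap_of_isEntry hσ s₀ h4
  refine ⟨s, i, u, v, rfl, ?_⟩
  rcases gadget_adj.1 h2 with h | h
  · cases h with
    | pos_kap _ _ _ _ _ h =>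
      refine h.1 ?_
      by_contra ht
      rw [Bool.not_eq_true] at ht
      subst ht
      rw [deg_kap_eq s₂ s t₂] at h5
      cases t₂ with
      | true => exact lt_asymm h5 (deg_kap_lt s)
      | false => exact lt_irrefl _ h5
  · cases h

theorem isLine_row (s₀ : Fin σ) (i) : IsLine (gadget σ G) (.row i) :=
  ⟨not_isSmall_row s₀ i, .lam, adj_row_lam i, not_isSmall_lam⟩

theorem isLine_col (s : Fin σ) (u v) : IsLine (gadget σ G) (.col s u v) := by
  obtain ⟨t, ht⟩ := exists_adj_col_mu (G := G) s u v
  exact ⟨not_isSmall_col s u v, _, ht, not_isSmall_mu s t⟩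

theorem isOuter_mu (s : Fin σ) (t) : IsOuter (gadget σ G) (.mu s t) := by
  refine ⟨not_isSmall_mu s t, fun w hw => ?_⟩
  rcases gadget_adj.1 hw with h | h
  · cases h
  · cases h with
    | col_mu => exact not_isSmall_col _ _ _

/-- The neighbors of a position that are lines are its row and its column. -/
theorem eq_of_adj_pos_of_isLine (hσ : σ ≤ 2) {s : Fin σ} {i u v} {x : GadgetNode σ n}
    (h : (gadget σ G).Adj x (.pos s i u v)) (hx : IsLine (gadget σ G) x) :
    x = .row i ∨ x = .col s u v := by
  rcases gadget_adj.1 h with h | h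
  · cases h with
    | pos_pos => exact absurd (isSmall_pos hσ ..) hx.1
  · cases h with
    | pos_row => exact .inl rfl
    | pos_col => exact .inr rfl
    | pos_kap =>
      obtain ⟨w, hw, hw'⟩ := hx.2
      exact absurd ((isEntry_kap hσ _ _).2 w hw) hw'
    | pos_pos => exact absurd (isSmall_pos hσ ..) hx.1

/-- Excluding the marked columns eliminates the padding vertices and the additional row: padding
vertices lie on no edge, and the additional row has its entries 2 in marked columns only. -/
theorem exists_vertex_of_isTwo {i : Option (PaddedVertex n)} {u v : PaddedVertex n}
    (h : IsTwo G i u v) (hm : ¬ IsMarked u v) :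
    ∃ a b : Fin n, u = .inl a ∧ v = .inl b ∧ (a = b ∨ G.Adj a b) ∧
      (i = some (.inl a) ∨ i = some (.inl b)) := by
  cases i with
  | none => exact absurd h hm
  | some i =>
    obtain ⟨h1, rfl | ⟨a, b, rfl, rfl, hab⟩⟩ := h
    · rcases u with a | k
      · refine ⟨a, a, rfl, rfl, .inl rfl, .inl ?_⟩
        rcases h1 with rfl | rfl <;> rfl
      · exact absurd (isMarked_inr k) hm
    · refine ⟨a, b, rfl, rfl, .inr hab, ?_⟩
      exact h1.imp (congrArg some) (congrArg some)

/-- Diagonal columns of vertices account for `i = j`, and columns of edges for adjacency. The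
reflexive part is useful: it singles out the rows of genuine vertices as the nodes linked to
themselves. -/
theorem linked_gadget_iff (hσ : σ ≤ 2) (s₀ : Fin σ) {x y : GadgetNode σ n} :
    Linked (gadget σ G) x y ↔ ∃ i j : Fin n, x = .row (some (.inl i)) ∧
      y = .row (some (.inl j)) ∧ (i = j ∨ G.Adj i j) := by
  constructor
  · rintro ⟨z, a, a', h1, h2, h3, h4, h5, h6, h7, h8, h9, ⟨w, h10, h11, h12⟩, h13, h14⟩
    obtain ⟨s, i, u, v, rfl, hi⟩ := exists_eq_pos_of_isRare hσ s₀ h1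
    obtain ⟨s', i', u', v', rfl, hi'⟩ := exists_eq_pos_of_isRare hσ s₀ h2
    -- Both `x` and `z` are the row or the column of the position `a`, and the strict inequality of
    -- degrees leaves only one possibility.
    have hz : z = .col s u v ∧ x = .row i := by
      rcases eq_of_adj_pos_of_isLine hσ h3 h9 with rfl | rfl <;>
        rcases eq_of_adj_pos_of_isLine hσ h5 h7 with rfl | rfl
      · exact absurd h13 (lt_irrefl _)
      · exact absurd h13 (deg_col_lt_deg_row hσ _ _ _ _).asymm
      · exact ⟨rfl, rfl⟩
      · exact absurd h13 (lt_irrefl _)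
    obtain ⟨rfl, rfl⟩ := hz
    -- As `z` is also adjacent to `a'`, this position lies in the same column of the same copy.
    rcases eq_of_adj_pos_of_isLine hσ h4 h9 with h | h
    · cases h
    cases h
    have hy : y = .row i' := by
      rcases eq_of_adj_pos_of_isLine hσ h6 h8 with rfl | rfl
      · rfl
      · exact absurd h14 (lt_irrefl _)
    subst hy
    -- A twin column is not outer because it is adjacent to positions. So `w` is an objective
    -- coefficient, and its degree excludes the one of the marked columns.
    have hm : ¬ IsMarked u v := by
      rcases gadget_adj.1 h10 with h | h
      · cases h with
        | col_mu _ _ _ t h =>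
          intro hm
          rw [h.2 hm] at h12
          exact absurd h12 (deg_mu_le s).not_gt
        | col_col =>
          exact absurd (isSmall_pos hσ _ none u v) (h11.2 _ (adj_pos_col ..).symm)
      · cases h with
        | pos_col => exact absurd (isSmall_pos hσ ..) h11.1
        | col_col =>
          exact absurd (isSmall_pos hσ _ none u v) (h11.2 _ (adj_pos_col ..).symm)
    obtain ⟨a, b, rfl, rfl, hab, hia⟩ := exists_vertex_of_isTwo hi hm
    obtain ⟨a', b', ha, hb, -, hia'⟩ := exists_vertex_of_isTwo hi' hm
    cases ha
    cases hb
    rcases hia with rfl | rfl <;> rcases hia' with rfl | rfl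
    · exact ⟨_, _, rfl, rfl, .inl rfl⟩
    · exact ⟨_, _, rfl, rfl, hab⟩
    · exact ⟨_, _, rfl, rfl, hab.imp Eq.symm (fun h => h.symm)⟩
    · exact ⟨_, _, rfl, rfl, .inl rfl⟩
  · rintro ⟨i, j, rfl, rfl, h⟩
    have h' : (Sum.inl i : PaddedVertex n) = .inl j ∨
        ∃ a b, (Sum.inl i : PaddedVertex n) = .inl a ∧ (Sum.inl j : PaddedVertex n) = .inl b ∧
          G.Adj a b :=
      h.imp (congrArg _) fun h => ⟨i, j, rfl, rfl, h⟩
    have hm : ¬ IsMarked (Sum.inl i : PaddedVertex n) (.inl j) := by simp [IsMarked]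
    -- The witnesses are the column `(i, j)` and its entries in the rows `i` and `j`; for `i = j`
    -- the two positions coincide.
    exact ⟨.col s₀ (.inl i) (.inl j), .pos s₀ (some (.inl i)) (.inl i) (.inl j),
      .pos s₀ (some (.inl j)) (.inl i) (.inl j), isRare_pos hσ s₀ ⟨.inl rfl, h'⟩,
      isRare_pos hσ s₀ ⟨.inr rfl, h'⟩, (adj_pos_col ..).symm, (adj_pos_col ..).symm,
      (adj_pos_row ..).symm, (adj_pos_row ..).symm, isLine_row s₀ _, isLine_row s₀ _,
      isLine_col .., ⟨.mu s₀ false, adj_col_mu s₀ (by simpa using hm), isOuter_mu .., six_lt_deg_mu s₀⟩,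
      deg_col_lt_deg_row hσ .., deg_col_lt_deg_row hσ ..⟩

/-- Rows of vertices are recognized as the nodes linked to themselves, and isomorphisms preserve
this. -/
theorem exists_vertex_map {n' : ℕ} {G' : SimpleGraph (Fin n')} (hσ : σ ≤ 2) (s₀ : Fin σ)
    (φ : gadget σ G ≃g gadget σ G') (i : Fin n) :
    ∃ j : Fin n', φ (.row (some (.inl i))) = .row (some (.inl j)) := by
  have h : Linked (gadget σ G) (.row (some (.inl i))) (.row (some (.inl i))) :=
    (linked_gadget_iff hσ s₀).2 ⟨i, i, rfl, rfl, .inl rfl⟩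
  obtain ⟨j, -, hj, -⟩ := (linked_gadget_iff hσ s₀).1 (linked_map φ h)
  exact ⟨j, hj⟩

/-- The isomorphism restricts to a bijection between the rows of vertices that preserves "equal or
adjacent". Since a bijection also preserves equality and adjacent vertices are distinct, it
preserves adjacency. -/
theorem nonempty_iso_of_gadget {n' : ℕ} {G' : SimpleGraph (Fin n')} (hσ : σ ≤ 2) (s₀ : Fin σ)
    (φ : gadget σ G ≃g gadget σ G') : Nonempty (G ≃g G') := by
  choose f hf using exists_vertex_map hσ s₀ φ
  choose g hg using exists_vertex_map hσ s₀ φ.symm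
  have hgf : ∀ i, g (f i) = i := by
    intro i
    have := hg (f i)
    rw [← hf, φ.symm_apply_apply] at this
    simpa using this.symm
  have hfg : ∀ i, f (g i) = i := by
    intro i
    have := hf (g i)
    rw [← hg, φ.apply_symm_apply] at this
    simpa using this.symm
  refine ⟨⟨⟨f, g, hgf, hfg⟩, ?_⟩⟩
  intro i j
  have h := linked_map_iff φ (x := .row (some (.inl i))) (y := .row (some (.inl j)))
  rw [hf, hf, linked_gadget_iff hσ s₀, linked_gadget_iff hσ s₀] at h
  simp only [GadgetNode.row.injEq, Option.some.injEq, Sum.inl.injEq] at h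
  have h1 : f i = f j ↔ i = j := ⟨fun h => by rw [← hgf i, h, hgf], fun h => h ▸ rfl⟩
  have h2 : (f i = f j ∨ G'.Adj (f i) (f j)) ↔ (i = j ∨ G.Adj i j) := by
    constructor
    · intro h'
      obtain ⟨_, _, rfl, rfl, h''⟩ := h.1 ⟨_, _, rfl, rfl, h'⟩
      exact h''
    · intro h'
      obtain ⟨_, _, e1, e2, h''⟩ := h.2 ⟨_, _, rfl, rfl, h'⟩
      rwa [e1, e2]
  change G'.Adj (f i) (f j) ↔ G.Adj i j
  constructor
  · intro h'
    exact (h2.1 (.inr h')).resolve_left fun e => h'.ne (h1.2 e)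
  · intro h'
    exact (h2.2 (.inr h')).resolve_left fun e => h'.ne (h1.1 e)

end Recovery

end ILPGraphs

namespace ILPGraphs

/-! ### The linear program of a graph -/

section Program

variable {n : ℕ} (G : SimpleGraph (Fin n))

/-- The numbering of the columns. -/
def colEquiv (n : ℕ) : PaddedVertex n × PaddedVertex n ≃ Fin ((n + 6) * (n + 6)) :=
  prodNumbering (vertexEquiv n) (vertexEquiv n)

open Classical in
/-- The entries of the matrix. -/
noncomputable def entry (i : Option (PaddedVertex n)) (q : PaddedVertex n × PaddedVertex n) : ℤ :=
  if IsTwo G i q.1 q.2 then 2 else 1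

/-- The matrix of the linear program of a graph. -/
noncomputable def matrix : Matrix (Fin (n + 7)) (Fin ((n + 6) * (n + 6))) ℝ :=
  fun i j => entry G ((rowEquiv n).symm i) ((colEquiv n).symm j)

/-- The objective function, which equals the row of the matrix with the additional index. -/
noncomputable def objective : Fin ((n + 6) * (n + 6)) → ℝ :=
  fun j => entry G none ((colEquiv n).symm j)

theorem matrix_apply (i q) : matrix G (rowEquiv n i) (colEquiv n q) = entry G i q := by
  simp [matrix]

theorem objective_apply (q) : objective G (colEquiv n q) = entry G none q := by
  simp [objective]

variable {G}

theorem entry_of_isTwo {i q} (h : IsTwo G i q.1 q.2) : entry G i q = 2 := if_pos h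

theorem entry_of_not_isTwo {i q} (h : ¬ IsTwo G i q.1 q.2) : entry G i q = 1 := if_neg h

variable (G)

theorem entry_pos (i q) : 0 < entry G i q := by
  unfold entry; split <;> decide

theorem exists_ne_inr (u : PaddedVertex n) : ∃ k : Fin 6, u ≠ .inr k := by
  rcases u with a | k
  · exact ⟨0, by simp⟩
  · refine ⟨k + 1, fun h => ?_⟩
    have : ∀ k : Fin 6, k ≠ k + 1 := by decide
    exact this k (Sum.inr_injective h)

theorem isTwo_diag_iff {i u : PaddedVertex n} : IsTwo G (some i) u u ↔ i = u := by
  simp [IsTwo]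

theorem exists_entry_eq_one (i) : ∃ q, entry G i q = 1 := by
  cases i with
  | none => exact ⟨(.inr 0, .inr 1), entry_of_not_isTwo (not_isMarked_inr (by decide))⟩
  | some u =>
    obtain ⟨k, hk⟩ := exists_ne_inr u
    exact ⟨(.inr k, .inr k), entry_of_not_isTwo (by rwa [isTwo_diag_iff])⟩

/-- With a padding vertex `k` different from `u`, the two rows are `(2, 1)` and `(x, 2)` in the
columns `(u, u)` and `(k, k)`, where `x` is 1 or 2; so the minor does not vanish. -/
theorem entry_independent_none (u : PaddedVertex n) :
    ∃ q q', entry G (some u) q' * entry G none q ≠ entry G (some u) q * entry G none q' := by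
  obtain ⟨k, hk⟩ := exists_ne_inr u
  refine ⟨(u, u), (.inr k, .inr k), ?_⟩
  rw [entry_of_not_isTwo (G := G) (i := some u) (q := (.inr k, .inr k)) (by rwa [isTwo_diag_iff]),
    entry_of_isTwo (G := G) (i := some u) (q := (u, u)) (by rw [isTwo_diag_iff]),
    entry_of_isTwo (G := G) (i := none) (q := (.inr k, .inr k)) (isMarked_inr k)]
  unfold entry
  split <;> decide

/-- The rows are pairwise not proportional, as witnessed by a minor. For the rows of `u` and `v` the
diagonal columns `(u, u)` and `(v, v)` give 2 on the diagonal and 1 off it. -/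
theorem entry_independent {i i' : Option (PaddedVertex n)} (h : i ≠ i') :
    ∃ q q', entry G i q' * entry G i' q ≠ entry G i q * entry G i' q' := by
  cases i with
  | none =>
    cases i' with
    | none => exact absurd rfl h
    | some u =>
      obtain ⟨q, q', hq⟩ := entry_independent_none G u
      exact ⟨q', q, fun h => hq (by linarith)⟩
  | some u =>
    cases i' with
    | none => exact entry_independent_none G u
    | some v =>
      have huv : u ≠ v := fun h' => h (congrArg some h')
      refine ⟨(u, u), (v, v), ?_⟩
      have h1 : entry G (some u) (v, v) = 1 := entry_of_not_isTwo (by rwa [isTwo_diag_iff])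
      have h2 : entry G (some v) (u, u) = 1 :=
        entry_of_not_isTwo (by rw [isTwo_diag_iff]; exact huv.symm)
      have h3 : ∀ w, entry G (some w) (w, w) = 2 := fun w =>
        entry_of_isTwo (by rw [isTwo_diag_iff])
      rw [h1, h2, h3, h3]
      decide

theorem matrix_mulVec_sub (i : Fin (n + 7)) (j j' : Fin ((n + 6) * (n + 6))) (a a' : ℝ) :
    (matrix G).mulVec (Pi.single j a - Pi.single j' a') i =
      matrix G i j * a - matrix G i j' * a' := by
  rw [Matrix.mulVec_sub]
  simp [mul_comm]

theorem matrix_pos (i j) : 0 < matrix G i j := by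
  exact Int.cast_pos.2 (entry_pos G _ _)

/-- The linear program of a graph satisfies the standing assumptions. -/
theorem admissible : Admissible (matrix G) 0 (objective G) where
  objective_ne_zero := by
    intro h
    have h1 := objective_apply G (.inr 0, .inr 0)
    rw [h] at h1
    have h2 := entry_pos G none (.inr 0, .inr 0)
    have h3 : ((entry G none (.inr 0, .inr 0) : ℤ) : ℝ) = 0 := h1.symm
    norm_cast at h3
    omega
  fullDimensional := by
    -- All entries are positive, so the open negative orthant is feasible.
    have hopen : IsOpen (Set.univ.pi fun _ : Fin ((n + 6) * (n + 6)) => Set.Iio (0 : ℝ)) :=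
      isOpen_set_pi Set.finite_univ fun _ _ => isOpen_Iio
    refine ⟨fun _ => -1, interior_maximal ?_ hopen (by intro j _; simp)⟩
    intro x hx i
    change ∑ j, matrix G i j * x j ≤ 0
    exact Finset.sum_nonpos fun j _ =>
      mul_nonpos_of_nonneg_of_nonpos (matrix_pos G i j).le (hx j trivial).le
  exists_optimal := by
    refine ⟨0, by simp [feasible], fun y hy => ?_⟩
    -- The objective is the additional row and its right hand side is 0, so this constraint bounds
    -- the objective by its value at the origin.
    have h := hy (rowEquiv n none)
    rw [dotProduct_zero]
    refine le_trans (le_of_eq ?_) h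
    simp [Matrix.mulVec, objective, matrix, dotProduct]
  row_ne_zero := by
    intro i h
    have := matrix_pos G i (colEquiv n (.inr 0, .inr 0))
    rw [h] at this
    exact lt_irrefl _ this
  hyperplane_injective := by
    intro i i' h
    obtain ⟨i, rfl⟩ := (rowEquiv n).surjective i
    obtain ⟨i', rfl⟩ := (rowEquiv n).surjective i'
    by_contra hne
    obtain ⟨q, q', hq⟩ := entry_independent G (fun h' : i = i' => hne (congrArg _ h'))
    -- A vector supported on the two columns of the minor that is orthogonal to row `i`. If it were
    -- also orthogonal to row `i'`, the minor would vanish.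
    have h1 : (Pi.single (colEquiv n q) (entry G i q' : ℝ) -
        Pi.single (colEquiv n q') (entry G i q : ℝ)) ∈ hyperplane (matrix G) 0 (rowEquiv n i) := by
      rw [hyperplane, Set.mem_ofPred_eq, matrix_mulVec_sub, matrix_apply, matrix_apply]
      simp [mul_comm]
    rw [h, hyperplane, Set.mem_ofPred_eq, matrix_mulVec_sub, matrix_apply, matrix_apply] at h1
    apply hq
    have h2 : (entry G i q' * entry G i' q : ℝ) = entry G i q * entry G i' q' := by
      have h3 : (entry G i' q * entry G i q' - entry G i' q' * entry G i q : ℝ) = 0 := h1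
      linarith
    exact_mod_cast h2
  normalized := by
    refine .inr ⟨fun i j => entry G ((rowEquiv n).symm i) ((colEquiv n).symm j), 0,
      fun i j => rfl, fun i => by simp, fun i d hd _ => ?_⟩
    -- A common divisor of a row divides its entry 1.
    obtain ⟨q, hq⟩ := exists_entry_eq_one G ((rowEquiv n).symm i)
    have : d ∣ entry G ((rowEquiv n).symm i) ((colEquiv n).symm (colEquiv n q)) :=
      hd (colEquiv n q)
    rw [Equiv.symm_apply_apply, hq] at this
    exact isUnit_of_dvd_one this

/-- The coefficient with the sign `(-1)^s` and absolute value `1` or `2`. -/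
noncomputable def coeff {σ : ℕ} (s : Fin σ) (t : Bool) : ℝ :=
  (if (s : ℕ) = 0 then 1 else -1) * (if t then 2 else 1)

theorem entry_mem (t : Bool) : ∃ q, entry G none q = if t then 2 else 1 := by
  cases t with
  | true => exact ⟨(.inr 0, .inr 0), entry_of_isTwo (isMarked_inr 0)⟩
  | false => exact exists_entry_eq_one G none

theorem mem_entries (t : Bool) : (if t then 2 else 1 : ℝ) ∈ entries (matrix G) := by
  obtain ⟨q, hq⟩ := entry_mem G t
  refine ⟨(rowEquiv n none, colEquiv n q), ?_⟩
  change matrix G _ _ = _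
  rw [matrix_apply, hq]
  push_cast
  rfl

theorem mem_range_objective (t : Bool) :
    (if t then 2 else 1 : ℝ) ∈ Set.range (objective G) := by
  obtain ⟨q, hq⟩ := entry_mem G t
  refine ⟨colEquiv n q, ?_⟩
  rw [objective_apply, hq]
  push_cast
  rfl

theorem mem_signed {S : Set ℝ} (hS : ∀ t : Bool, (if t then 2 else 1 : ℝ) ∈ S) {σ : ℕ}
    (s : Fin σ) (t : Bool) : coeff s t ∈ signed S := by
  unfold coeff
  split
  · exact .inl (by rw [one_mul]; exact hS t)
  · exact .inr (by rw [neg_one_mul, neg_neg]; exact hS t)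

end Program

end ILPGraphs

namespace ILPGraphs

/-! ### The gadget graph as an ILP graph -/

/-- The label of the ILP graph with a given number. -/
def labelOf : ℕ → Label
  | 0 => .pos
  | 1 => .row
  | 2 => .col
  | 3 => .kappa 1
  | 4 => .kappa 2
  | 5 => .kappa (-1)
  | 6 => .kappa (-2)
  | 7 => .lam 0
  | 8 => .mu 1
  | 9 => .mu 2
  | 10 => .mu (-1)
  -- This is the label of 11; larger numbers do not occur, and injectivity is claimed only below 12.
  | _ => .mu (-2)

theorem labelOf_injOn : Set.InjOn labelOf (Set.Iio 12) := by
  intro a ha b hb h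
  rw [Set.mem_Iio] at ha hb
  interval_cases a <;> interval_cases b <;> first | rfl | (exfalso; simp [labelOf] at h; try norm_num at h)

theorem GadgetNode.label_lt {σ n : ℕ} (hσ : σ ≤ 2) (x : GadgetNode σ n) : x.label < 12 := by
  have : ∀ t : Bool, t.toNat ≤ 1 := Bool.toNat_le
  cases x with
  | kap s t => have := this t; simp only [GadgetNode.label]; omega
  | mu s t => have := this t; simp only [GadgetNode.label]; omega
  | _ => simp [GadgetNode.label]

section Realization

variable {n : ℕ} (G : SimpleGraph (Fin n))

theorem coeff_kap (s : Fin 2) (t : Bool) : labelOf (3 + (2 * s + t.toNat)) = .kappa (coeff s t) := by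
  fin_cases s <;> cases t <;> simp [labelOf, coeff]

theorem coeff_mu (s : Fin 2) (t : Bool) : labelOf (8 + (2 * s + t.toNat)) = .mu (coeff s t) := by
  fin_cases s <;> cases t <;> simp [labelOf, coeff]

theorem coeff_injective : Function.Injective fun p : Fin 2 × Bool => coeff p.1 p.2 := by
  rintro ⟨s, t⟩ ⟨s', t'⟩ h
  fin_cases s <;> fin_cases s' <;> cases t <;> cases t' <;> simp [coeff] at h ⊢ <;> norm_num at h

theorem entry_eq_coeff {i q} {t : Bool} (h : t = true ↔ IsTwo G i q.1 q.2) :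
    (entry G i q : ℝ) = if t then 2 else 1 := by
  cases t with
  | true => rw [entry_of_isTwo (h.1 rfl)]; simp
  | false => rw [entry_of_not_isTwo (fun h' => by simpa using h.2 h')]; simp

/-- A bijection that maps edges to edges, such that every edge comes from an edge. -/
noncomputable def isoOfEdges {V W : Type} {R : V → V → Prop} {S : W → W → Prop} (f : V → W)
    (hf : Function.Bijective f) (h₁ : ∀ x y, R x y → S (f x) (f y))
    (h₂ : ∀ x' y', S x' y' → ∃ x y, f x = x' ∧ f y = y' ∧ R x y) :
    SimpleGraph.fromRel R ≃g SimpleGraph.fromRel S where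
  toEquiv := Equiv.ofBijective f hf
  map_rel_iff' := by
    have key : ∀ x y, S (f x) (f y) ↔ R x y := by
      refine fun x y => ⟨fun h => ?_, h₁ x y⟩
      obtain ⟨x', y', hx, hy, h⟩ := h₂ _ _ h
      rwa [← hf.1 hx, ← hf.1 hy]
    intro x y
    simp [SimpleGraph.fromRel_adj, key, hf.1.eq_iff]

/-- The nodes of the gadget graph as nodes of the reduced ILP graph. -/
noncomputable def toReducedNode : GadgetNode 1 n → ReducedNode (matrix G) 0 (objective G)
  | .pos _ i u v => .pos (rowEquiv n i) (colEquiv n (u, v))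
  | .row i => .row (rowEquiv n i)
  | .col _ u v => .col (colEquiv n (u, v))
  | .kap _ t => .kappa ⟨if t then 2 else 1, mem_entries G t⟩
  | .lam => .lam ⟨0, 0, rfl⟩
  | .mu _ t => .mu ⟨if t then 2 else 1, mem_range_objective G t⟩

theorem ite_two_one_inj {t t' : Bool} :
    ((if t then 2 else 1 : ℝ) = if t' then 2 else 1) ↔ t = t' := by
  cases t <;> cases t' <;> simp

open Classical in
theorem exists_entry_eq (i q) :
    ∃ t : Bool, (t = true ↔ IsTwo G i q.1 q.2) ∧ (entry G i q : ℝ) = if t then 2 else 1 :=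
  ⟨decide (IsTwo G i q.1 q.2), by simp, entry_eq_coeff G (by simp)⟩

theorem toReducedNode_bijective : Function.Bijective (toReducedNode G) := by
  constructor
  · intro x y h
    cases x <;> cases y <;>
      simp [toReducedNode, ite_two_one_inj, Subsingleton.elim _ (0 : Fin 1)] at h ⊢ <;> exact h
  · intro x
    cases x with
    | pos i j =>
      obtain ⟨i, rfl⟩ := (rowEquiv n).surjective i
      obtain ⟨⟨u, v⟩, rfl⟩ := (colEquiv n).surjective j
      exact ⟨.pos 0 i u v, rfl⟩
    | row i =>
      obtain ⟨i, rfl⟩ := (rowEquiv n).surjective i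
      exact ⟨.row i, rfl⟩
    | col j =>
      obtain ⟨⟨u, v⟩, rfl⟩ := (colEquiv n).surjective j
      exact ⟨.col 0 u v, rfl⟩
    | kappa u =>
      obtain ⟨_, ⟨i, j⟩, rfl⟩ := u
      obtain ⟨t, -, ht⟩ := exists_entry_eq G ((rowEquiv n).symm i) ((colEquiv n).symm j)
      exact ⟨.kap 0 t, congrArg _ (Subtype.ext ht.symm)⟩
    | lam v =>
      obtain ⟨_, i, rfl⟩ := v
      exact ⟨.lam, rfl⟩
    | mu w =>
      obtain ⟨_, j, rfl⟩ := w
      obtain ⟨t, -, ht⟩ := exists_entry_eq G none ((colEquiv n).symm j)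
      exact ⟨.mu 0 t, congrArg _ (Subtype.ext ht.symm)⟩

theorem toReducedNode_edge {x y} (h : GadgetEdge 1 G x y) :
    ReducedEdge (matrix G) 0 (objective G) (toReducedNode G x) (toReducedNode G y) := by
  cases h with
  | pos_row => exact .pos_row _ _
  | pos_col => exact .pos_col _ _
  | pos_kap s i u v t h =>
    exact .pos_kappa _ _ _ (by rw [matrix_apply]; exact (entry_eq_coeff G h).symm)
  | row_lam => exact .row_lam _ _ rfl
  | col_mu s u v t h =>
    exact .col_mu _ _ (by rw [objective_apply]; exact (entry_eq_coeff G h).symm)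
  | pos_pos s s' _ _ _ h => omega
  | col_col s s' _ _ h => omega

theorem exists_toReducedNode_edge {x' y'} (h : ReducedEdge (matrix G) 0 (objective G) x' y') :
    ∃ x y, toReducedNode G x = x' ∧ toReducedNode G y = y' ∧ GadgetEdge 1 G x y := by
  cases h with
  | pos_row i j =>
    obtain ⟨i, rfl⟩ := (rowEquiv n).surjective i
    obtain ⟨⟨u, v⟩, rfl⟩ := (colEquiv n).surjective j
    exact ⟨.pos 0 i u v, .row i, rfl, rfl, .pos_row ..⟩
  | pos_col i j =>
    obtain ⟨i, rfl⟩ := (rowEquiv n).surjective i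
    obtain ⟨⟨u, v⟩, rfl⟩ := (colEquiv n).surjective j
    exact ⟨.pos 0 i u v, .col 0 u v, rfl, rfl, .pos_col ..⟩
  | pos_kappa i j a h =>
    obtain ⟨i, rfl⟩ := (rowEquiv n).surjective i
    obtain ⟨⟨u, v⟩, rfl⟩ := (colEquiv n).surjective j
    rw [matrix_apply] at h
    obtain ⟨t, ht, ht'⟩ := exists_entry_eq G i (u, v)
    exact ⟨.pos 0 i u v, .kap 0 t, rfl, congrArg _ (Subtype.ext (ht'.symm.trans h.symm)),
      .pos_kap _ _ _ _ _ ht⟩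
  | row_lam i a h =>
    obtain ⟨i, rfl⟩ := (rowEquiv n).surjective i
    exact ⟨.row i, .lam, rfl, congrArg _ (Subtype.ext h.symm), .row_lam _⟩
  | col_mu j a h =>
    obtain ⟨⟨u, v⟩, rfl⟩ := (colEquiv n).surjective j
    rw [objective_apply] at h
    obtain ⟨t, ht, ht'⟩ := exists_entry_eq G none (u, v)
    exact ⟨.col 0 u v, .mu 0 t, rfl, congrArg _ (Subtype.ext (ht'.symm.trans h.symm)),
      .col_mu _ _ _ _ ht⟩

theorem label_toReducedNode (x : GadgetNode 1 n) :
    (toReducedNode G x).label = labelOf x.label := by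
  cases x with
  | kap s t => cases t <;> simp [toReducedNode, ReducedNode.label, GadgetNode.label, labelOf]
  | mu s t => cases t <;> simp [toReducedNode, ReducedNode.label, GadgetNode.label, labelOf]
  | _ => rfl

/-- The gadget graph with one copy of the columns is a reduced ILP graph. -/
theorem exists_reducedILPGraph : ∃ Γ ∈ reducedILPGraphs, ∃ e : gadget 1 G ≃g Γ.graph,
    ∀ x, Γ.label (e x) = labelOf x.label :=
  ⟨_, ⟨_, _, _, _, _, admissible G, rfl⟩,
    isoOfEdges (toReducedNode G) (toReducedNode_bijective G) (fun _ _ => toReducedNode_edge G)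
      (fun _ _ => exists_toReducedNode_edge G), label_toReducedNode G⟩

/-- The nodes of the gadget graph as nodes of the ILP graph. -/
noncomputable def toNode : GadgetNode 2 n → Node (matrix G) 0 (objective G)
  | .pos 0 i u v => .pos (rowEquiv n i) (colEquiv n (u, v))
  -- No entry is zero, so every position has a proper twin and the second copy is complete.
  | .pos 1 i u v => .posTwin (rowEquiv n i) (colEquiv n (u, v)) (matrix_pos G _ _).ne'
  | .row i => .row (rowEquiv n i)
  | .col 0 u v => .col (colEquiv n (u, v))
  | .col 1 u v => .colTwin (colEquiv n (u, v))
  | .kap s t => .kappa ⟨coeff s t, mem_signed (mem_entries G) s t⟩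
  | .lam => .lam ⟨0, 0, rfl⟩
  | .mu s t => .mu ⟨coeff s t, mem_signed (mem_range_objective G) s t⟩

theorem coeff_inj {s s' : Fin 2} {t t' : Bool} : coeff s t = coeff s' t' ↔ s = s' ∧ t = t' := by
  rw [← Prod.mk_inj]
  exact (coeff_injective.eq_iff (a := (s, t)) (b := (s', t')))

theorem coeff_zero (t : Bool) : coeff (0 : Fin 2) t = if t then 2 else 1 := by simp [coeff]

theorem coeff_one (t : Bool) : coeff (1 : Fin 2) t = -if t then 2 else 1 := by
  cases t <;> simp [coeff]

theorem exists_coeff_eq {S : Set ℝ} (hS : ∀ a ∈ S, ∃ t : Bool, a = if t then 2 else 1) {a : ℝ}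
    (ha : a ∈ signed S) : ∃ (s : Fin 2) (t : Bool), coeff s t = a := by
  rcases ha with ha | ha <;> obtain ⟨t, ht⟩ := hS _ ha
  · exact ⟨0, t, (coeff_zero t).trans ht.symm⟩
  · exact ⟨1, t, by rw [coeff_one, ← ht, neg_neg]⟩

theorem toNode_bijective : Function.Bijective (toNode G) := by
  constructor
  · intro x y h
    have h01 : ∀ s : Fin 2, s = 0 ∨ s = 1 := by decide
    rcases x with ⟨s, i, u, v⟩ | i | ⟨s, u, v⟩ | ⟨s, t⟩ | _ | ⟨s, t⟩ <;>
      try obtain rfl | rfl := h01 s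
    all_goals
      rcases y with ⟨s', i', u', v'⟩ | i' | ⟨s', u', v'⟩ | ⟨s', t'⟩ | _ | ⟨s', t'⟩ <;>
      try obtain rfl | rfl := h01 s'
    all_goals simp [toNode, coeff_inj] at h ⊢ <;> exact h
  · intro x
    cases x with
    | pos i j =>
      obtain ⟨i, rfl⟩ := (rowEquiv n).surjective i
      obtain ⟨⟨u, v⟩, rfl⟩ := (colEquiv n).surjective j
      exact ⟨.pos 0 i u v, rfl⟩
    | posTwin i j =>
      obtain ⟨i, rfl⟩ := (rowEquiv n).surjective i
      obtain ⟨⟨u, v⟩, rfl⟩ := (colEquiv n).surjective j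
      exact ⟨.pos 1 i u v, rfl⟩
    | row i =>
      obtain ⟨i, rfl⟩ := (rowEquiv n).surjective i
      exact ⟨.row i, rfl⟩
    | col j =>
      obtain ⟨⟨u, v⟩, rfl⟩ := (colEquiv n).surjective j
      exact ⟨.col 0 u v, rfl⟩
    | colTwin j =>
      obtain ⟨⟨u, v⟩, rfl⟩ := (colEquiv n).surjective j
      exact ⟨.col 1 u v, rfl⟩
    | kappa a =>
      obtain ⟨s, t, h⟩ := exists_coeff_eq (by
        rintro _ ⟨⟨i, j⟩, rfl⟩
        obtain ⟨t, -, ht⟩ := exists_entry_eq G ((rowEquiv n).symm i) ((colEquiv n).symm j)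
        exact ⟨t, ht⟩) a.2
      exact ⟨.kap s t, congrArg _ (Subtype.ext h)⟩
    | lam v =>
      obtain ⟨_, i, rfl⟩ := v
      exact ⟨.lam, rfl⟩
    | mu a =>
      obtain ⟨s, t, h⟩ := exists_coeff_eq (by
        rintro _ ⟨j, rfl⟩
        obtain ⟨t, -, ht⟩ := exists_entry_eq G none ((colEquiv n).symm j)
        exact ⟨t, ht⟩) a.2
      exact ⟨.mu s t, congrArg _ (Subtype.ext h)⟩

theorem toNode_edge {x y} (h : GadgetEdge 2 G x y) :
    Edge (matrix G) 0 (objective G) (toNode G x) (toNode G y) := by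
  have h01 : ∀ s : Fin 2, s = 0 ∨ s = 1 := by decide
  have hlt : ∀ s s' : Fin 2, s < s' → s = 0 ∧ s' = 1 := by decide
  cases h with
  | pos_row s =>
    obtain rfl | rfl := h01 s
    · exact .pos_row _ _
    · exact .posTwin_row _ _ _
  | pos_col s =>
    obtain rfl | rfl := h01 s
    · exact .pos_col _ _
    · exact .posTwin_colTwin _ _ _
  | pos_kap s i u v t h =>
    have h' := entry_eq_coeff G (i := i) (q := (u, v)) h
    obtain rfl | rfl := h01 s
    · exact .pos_kappa _ _ _ (by rw [matrix_apply, h']; exact coeff_zero t)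
    · exact .posTwin_kappa _ _ _ _ (by rw [matrix_apply, h']; exact coeff_one t)
  | row_lam => exact .row_lam _ _ rfl
  | col_mu s u v t h =>
    have h' := entry_eq_coeff G (i := none) (q := (u, v)) h
    obtain rfl | rfl := h01 s
    · exact .col_mu _ _ (by rw [objective_apply, h']; exact coeff_zero t)
    · exact .colTwin_mu _ _ (by rw [objective_apply, h']; exact coeff_one t)
  | pos_pos s s' _ _ _ h =>
    obtain ⟨rfl, rfl⟩ := hlt s s' h
    exact .pos_posTwin _ _ _
  | col_col s s' _ _ h =>
    obtain ⟨rfl, rfl⟩ := hlt s s' h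
    exact .col_colTwin _

theorem exists_toNode_edge {x' y'} (h : Edge (matrix G) 0 (objective G) x' y') :
    ∃ x y, toNode G x = x' ∧ toNode G y = y' ∧ GadgetEdge 2 G x y := by
  cases h with
  | pos_row i j =>
    obtain ⟨i, rfl⟩ := (rowEquiv n).surjective i
    obtain ⟨⟨u, v⟩, rfl⟩ := (colEquiv n).surjective j
    exact ⟨.pos 0 i u v, .row i, rfl, rfl, .pos_row ..⟩
  | pos_col i j =>
    obtain ⟨i, rfl⟩ := (rowEquiv n).surjective i
    obtain ⟨⟨u, v⟩, rfl⟩ := (colEquiv n).surjective j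
    exact ⟨.pos 0 i u v, .col 0 u v, rfl, rfl, .pos_col ..⟩
  | pos_kappa i j a h =>
    obtain ⟨i, rfl⟩ := (rowEquiv n).surjective i
    obtain ⟨⟨u, v⟩, rfl⟩ := (colEquiv n).surjective j
    rw [matrix_apply] at h
    obtain ⟨t, ht, ht'⟩ := exists_entry_eq G i (u, v)
    exact ⟨.pos 0 i u v, .kap 0 t, rfl,
      congrArg _ (Subtype.ext (by rw [h, ht', ← coeff_zero])), .pos_kap _ _ _ _ _ ht⟩
  | row_lam i a h =>
    obtain ⟨i, rfl⟩ := (rowEquiv n).surjective i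
    exact ⟨.row i, .lam, rfl, congrArg _ (Subtype.ext h.symm), .row_lam _⟩
  | col_mu j a h =>
    obtain ⟨⟨u, v⟩, rfl⟩ := (colEquiv n).surjective j
    rw [objective_apply] at h
    obtain ⟨t, ht, ht'⟩ := exists_entry_eq G none (u, v)
    exact ⟨.col 0 u v, .mu 0 t, rfl,
      congrArg _ (Subtype.ext (by rw [h, ht', ← coeff_zero])), .col_mu _ _ _ _ ht⟩
  | posTwin_row i j =>
    obtain ⟨i, rfl⟩ := (rowEquiv n).surjective i
    obtain ⟨⟨u, v⟩, rfl⟩ := (colEquiv n).surjective j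
    exact ⟨.pos 1 i u v, .row i, rfl, rfl, .pos_row ..⟩
  | posTwin_colTwin i j =>
    obtain ⟨i, rfl⟩ := (rowEquiv n).surjective i
    obtain ⟨⟨u, v⟩, rfl⟩ := (colEquiv n).surjective j
    exact ⟨.pos 1 i u v, .col 1 u v, rfl, rfl, .pos_col ..⟩
  | zero_colTwin i j h => exact absurd h (matrix_pos G i j).ne'
  | posTwin_kappa i j _ a h =>
    obtain ⟨i, rfl⟩ := (rowEquiv n).surjective i
    obtain ⟨⟨u, v⟩, rfl⟩ := (colEquiv n).surjective j
    rw [matrix_apply] at h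
    obtain ⟨t, ht, ht'⟩ := exists_entry_eq G i (u, v)
    exact ⟨.pos 1 i u v, .kap 1 t, rfl,
      congrArg _ (Subtype.ext (by rw [h, ht', ← coeff_one])), .pos_kap _ _ _ _ _ ht⟩
  | colTwin_mu j a h =>
    obtain ⟨⟨u, v⟩, rfl⟩ := (colEquiv n).surjective j
    rw [objective_apply] at h
    obtain ⟨t, ht, ht'⟩ := exists_entry_eq G none (u, v)
    exact ⟨.col 1 u v, .mu 1 t, rfl,
      congrArg _ (Subtype.ext (by rw [h, ht', ← coeff_one])), .col_mu _ _ _ _ ht⟩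
  | pos_posTwin i j =>
    obtain ⟨i, rfl⟩ := (rowEquiv n).surjective i
    obtain ⟨⟨u, v⟩, rfl⟩ := (colEquiv n).surjective j
    exact ⟨.pos 0 i u v, .pos 1 i u v, rfl, rfl, .pos_pos _ _ _ _ _ (by decide)⟩
  | col_colTwin j =>
    obtain ⟨⟨u, v⟩, rfl⟩ := (colEquiv n).surjective j
    exact ⟨.col 0 u v, .col 1 u v, rfl, rfl, .col_col _ _ _ _ (by decide)⟩

theorem label_toNode (x : GadgetNode 2 n) : (toNode G x).label = labelOf x.label := by
  have h01 : ∀ s : Fin 2, s = 0 ∨ s = 1 := by decide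
  cases x with
  | pos s => obtain rfl | rfl := h01 s <;> rfl
  | col s => obtain rfl | rfl := h01 s <;> rfl
  | kap s t => exact (coeff_kap s t).symm
  | mu s t => exact (coeff_mu s t).symm
  | _ => rfl

/-- The gadget graph with two copies of the columns is an ILP graph. -/
theorem exists_ilpGraph : ∃ Γ ∈ ilpGraphs, ∃ e : gadget 2 G ≃g Γ.graph,
    ∀ x, Γ.label (e x) = labelOf x.label :=
  ⟨_, ⟨_, _, _, _, _, admissible G, rfl⟩,
    isoOfEdges (toNode G) (toNode_bijective G) (fun _ _ => toNode_edge G)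
      (fun _ _ => exists_toNode_edge G), label_toNode G⟩

end Realization

end ILPGraphs

namespace ILPGraphs

/-! ### Output of edge lists -/

/-- The edge list `F e` can be output in polynomial time. -/
def EdgeList (F : Env → List (ℕ × ℕ)) : Prop := Emittable fun e => tableCode (F e)

theorem EdgeList.append {F F' : Env → List (ℕ × ℕ)} (hF : EdgeList F) (hF' : EdgeList F') :
    EdgeList fun e => F e ++ F' e :=
  (Emittable.append hF hF').congr fun _ => (tableCode_append _ _).symm

theorem EdgeList.single {h h' : Env → ℕ} (hh : Num h) (hh' : Num h') :
    EdgeList fun e => [(h e, h' e)] :=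
  ((Emittable.bit true).append (hh.unary.append hh'.unary)).congr fun e => by simp [tableCode]

theorem tableCode_flatMap {α : Type} (L : List α) (f : α → List (ℕ × ℕ)) :
    tableCode (L.flatMap f) = L.flatMap fun a => tableCode (f a) := by
  simp [tableCode, List.flatMap_assoc]

theorem EdgeList.forRange (x : ℕ) {h : Env → ℕ} {F : Env → List (ℕ × ℕ)} (hh : Num h)
    (hx : ∀ e, h (e.set x 0) = h e) (hF : EdgeList F) :
    EdgeList fun e => (List.range (h e)).flatMap fun k => F (e.set x k) :=
  (Emittable.forRange x hh hx hF).congr fun _ => (tableCode_flatMap _ _).symm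

theorem Num.ite {b : Env → Prop} [∀ e, Decidable (b e)] {h h' : Env → ℕ} (hb : Testable b)
    (hh : Num h) (hh' : Num h') : Num fun e => if b e then h e else h' e :=
  (Emittable.ite hb hh hh').congr fun e => by simp only [apply_ite (List.replicate · true)]

open Classical in
-- One bit is output for each row of the table with the property, so the output is nonempty exactly
-- if such a row exists.
theorem Testable.existsTable (t x a b : ℕ) {c : Env → Prop} (hc : Testable c)
    (hxa : x ≠ a := by decide) (hxb : x ≠ b := by decide) (hab : a ≠ b := by decide) :
    Testable fun e => ∃ k < (e.tab t).length, c (((e.set x k).set a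
      ((e.tab t).getD k (0, 0)).1).set b ((e.tab t).getD k (0, 0)).2) := by
  refine ⟨_, Emittable.forTable t x a b (Emittable.ite hc (Emittable.bit true) Emittable.nil)
    hxa hxb hab, fun e => ?_⟩
  simp only [ne_eq, List.flatMap_eq_nil_iff, List.mem_range]
  push Not
  refine exists_congr fun k => and_congr_right fun _ => ?_
  split <;> simp_all

/-! ### The edges of the gadget graph in numbers -/

/-- The numerical form of `IsTwo`. -/
def IsTwoNum (n : ℕ) (T : List (ℕ × ℕ)) (i u v : ℕ) : Prop :=
  ((i = u ∨ i = v) ∧ (u = v ∨ ∃ p ∈ T, (p.1 = u ∧ p.2 = v) ∨ (p.1 = v ∧ p.2 = u))) ∨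
    -- The number `n + 6` is that of the additional row, and `n ≤ u` characterizes the padding
    -- vertices.
    (i = n + 6 ∧ u = v ∧ n ≤ u)

section Numbers

variable (σ n : ℕ) (T : List (ℕ × ℕ))

/-- The number of a position. -/
def posNum (s i u v : ℕ) : ℕ := ((s * (n + 7) + i) * (n + 6) + u) * (n + 6) + v

/-- The number of positions. -/
def posCount : ℕ := σ * (n + 7) * (n + 6) * (n + 6)

/-- The number of a column. -/
def colNum (s u v : ℕ) : ℕ := posCount σ n + ((n + 7) + ((s * (n + 6) + u) * (n + 6) + v))

/-- The number of columns. -/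
def colCount : ℕ := σ * (n + 6) * (n + 6)

open Classical in
/-- The edges of the gadget graph that end in a given position, except for those of rows. -/
noncomputable def posEdges (s i u v : ℕ) : List (ℕ × ℕ) :=
  [(posNum n s i u v, posCount σ n + i)] ++ [(posNum n s i u v, colNum σ n s u v)] ++
    [(posNum n s i u v, posCount σ n + ((n + 7) + (colCount σ n +
      (s * 2 + if IsTwoNum n T i u v then 1 else 0))))] ++
    -- Edges between twins are listed at the later copy, so that each of them occurs from the
    -- smaller to the larger index, as in `GadgetEdge`.
    (List.range s).flatMap fun s' => [(posNum n s' i u v, posNum n s i u v)]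

open Classical in
/-- The edges of the gadget graph between columns and from columns to coefficients. -/
noncomputable def colEdges (s u v : ℕ) : List (ℕ × ℕ) :=
  [(colNum σ n s u v, posCount σ n + ((n + 7) + (colCount σ n +
      (σ * 2 + (1 + (s * 2 + if u = v ∧ n ≤ u then 1 else 0))))))] ++
    (List.range s).flatMap fun s' => [(colNum σ n s' u v, colNum σ n s u v)]

/-- The edges of the gadget graph. -/
noncomputable def gadgetEdges : List (ℕ × ℕ) :=
  ((List.range σ).flatMap fun s => (List.range (n + 7)).flatMap fun i =>
    (List.range (n + 6)).flatMap fun u => (List.range (n + 6)).flatMap fun v =>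
      posEdges σ n T s i u v) ++
  ((List.range (n + 7)).flatMap fun i =>
    [(posCount σ n + i, posCount σ n + ((n + 7) + (colCount σ n + σ * 2)))]) ++
  ((List.range σ).flatMap fun s =>
    (List.range (n + 6)).flatMap fun u => (List.range (n + 6)).flatMap fun v =>
      colEdges σ n s u v)

end Numbers

/-! ### Output of the gadget graph in polynomial time -/

section Emission

variable (σ : ℕ) {d : ℕ}

/-- Convention for variables: `d` is 0 or 1 and holds the number of vertices of the respective
graph, 2 to 5 hold `s`, `i`, `u`, `v`, 6 holds an earlier copy, 7 to 9 are used for rows of the edge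
table, and 100 is the dummy of multiplications. The case distinction on `d` makes independence of
the dummy hold by `rfl`. -/
theorem num_posCount (hd : d = 0 ∨ d = 1) : Num fun e => posCount σ (e.var d) := by
  rcases hd with rfl | rfl <;>
  exact (((Num.const σ).mul 100 ((Num.var _).add (Num.const 7))).mul 100
    ((Num.var _).add (Num.const 6))).mul 100 ((Num.var _).add (Num.const 6))

theorem num_colCount (hd : d = 0 ∨ d = 1) : Num fun e => colCount σ (e.var d) := by
  rcases hd with rfl | rfl <;>
  exact ((Num.const σ).mul 100 ((Num.var _).add (Num.const 6))).mul 100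
    ((Num.var _).add (Num.const 6))

theorem num_posNum (hd : d = 0 ∨ d = 1) {y : ℕ} (hy : y = 2 ∨ y = 6) :
    Num fun e => posNum (e.var d) (e.var y) (e.var 3) (e.var 4) (e.var 5) := by
  rcases hd with rfl | rfl <;> rcases hy with rfl | rfl <;>
  exact ((((((Num.var _).mul 100 ((Num.var _).add (Num.const 7))).add (Num.var 3)).mul 100
    ((Num.var _).add (Num.const 6))).add (Num.var 4)).mul 100
    ((Num.var _).add (Num.const 6))).add (Num.var 5)

theorem num_colNum (hd : d = 0 ∨ d = 1) {y : ℕ} (hy : y = 2 ∨ y = 6) :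
    Num fun e => colNum σ (e.var d) (e.var y) (e.var 4) (e.var 5) := by
  refine (num_posCount σ hd).add (((Num.var d).add (Num.const 7)).add ?_)
  rcases hd with rfl | rfl <;> rcases hy with rfl | rfl <;>
  exact ((((Num.var _).mul 100 ((Num.var _).add (Num.const 6))).add (Num.var 4)).mul 100
    ((Num.var _).add (Num.const 6))).add (Num.var 5)

theorem exists_mem_iff_getD {T : List (ℕ × ℕ)} {c : ℕ × ℕ → Prop} :
    (∃ p ∈ T, c p) ↔ ∃ k < T.length, c (T.getD k (0, 0)) := by
  constructor
  · rintro ⟨p, hp, hc⟩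
    obtain ⟨k, hk, rfl⟩ := List.getElem_of_mem hp
    exact ⟨k, hk, by rwa [List.getD_eq_getElem _ _ hk]⟩
  · rintro ⟨k, hk, hc⟩
    rw [List.getD_eq_getElem _ _ hk] at hc
    exact ⟨_, List.getElem_mem hk, hc⟩

theorem testable_isTwoNum (d : ℕ) :
    Testable fun e => IsTwoNum (e.var d) (e.tab d) (e.var 3) (e.var 4) (e.var 5) := by
  refine (((Testable.eq (Num.var 3) (Num.var 4)).or (Testable.eq (Num.var 3) (Num.var 5))).and
    ((Testable.eq (Num.var 4) (Num.var 5)).or ?_)).or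
    ((Testable.eq (Num.var 3) ((Num.var d).add (Num.const 6))).and
      ((Testable.eq (Num.var 4) (Num.var 5)).and (Testable.le (Num.var d) (Num.var 4))))
  refine (Testable.existsTable d 7 8 9
    (((Testable.eq (Num.var 8) (Num.var 4)).and (Testable.eq (Num.var 9) (Num.var 5))).or
    ((Testable.eq (Num.var 8) (Num.var 5)).and (Testable.eq (Num.var 9) (Num.var 4))))).congr ?_
  intro e
  exact (exists_mem_iff_getD (c := fun p => (p.1 = e.var 4 ∧ p.2 = e.var 5) ∨
    (p.1 = e.var 5 ∧ p.2 = e.var 4))).symm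

open Classical in
theorem edgeList_posEdges (hd : d = 0 ∨ d = 1) : EdgeList fun e =>
    posEdges σ (e.var d) (e.tab d) (e.var 2) (e.var 3) (e.var 4) (e.var 5) := by
  have hP := num_posNum hd (.inl rfl)
  refine ((EdgeList.single hP ((num_posCount σ hd).add (Num.var 3))).append
    (EdgeList.single hP (num_colNum σ hd (.inl rfl)))).append (EdgeList.single hP
    ((num_posCount σ hd).add (((Num.var d).add (Num.const 7)).add ((num_colCount σ hd).add
      (((Num.var 2).mul 100 (Num.const 2)).add
      (Num.ite (testable_isTwoNum d) (Num.const 1) (Num.const 0))))))) |>.append ?_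
  have := EdgeList.forRange 6 (Num.var 2) (fun _ => rfl)
    (EdgeList.single (num_posNum hd (.inr rfl)) hP)
  rcases hd with rfl | rfl <;> exact this

theorem edgeList_colEdges (hd : d = 0 ∨ d = 1) : EdgeList fun e =>
    colEdges σ (e.var d) (e.var 2) (e.var 4) (e.var 5) := by
  have hC := num_colNum σ hd (.inl rfl)
  refine (EdgeList.single hC ((num_posCount σ hd).add (((Num.var d).add (Num.const 7)).add
    ((num_colCount σ hd).add ((Num.const (σ * 2)).add ((Num.const 1).add
      (((Num.var 2).mul 100 (Num.const 2)).add
      (Num.ite ((Testable.eq (Num.var 4) (Num.var 5)).and (Testable.le (Num.var d) (Num.var 4)))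
        (Num.const 1) (Num.const 0))))))))).append ?_
  have := EdgeList.forRange 6 (Num.var 2) (fun _ => rfl)
    (EdgeList.single (num_colNum σ hd (.inr rfl)) hC)
  rcases hd with rfl | rfl <;> exact this

/-- A loop variable must not overwrite the variables 0 and 1, on which the bounds of the loops
depend. -/
theorem EdgeList.forRange_var {x : ℕ} {d c : ℕ} {F : Env → List (ℕ × ℕ)} (hd : d = 0 ∨ d = 1)
    (hx : 2 ≤ x) (hF : EdgeList F) :
    EdgeList fun e => (List.range (e.var d + c)).flatMap fun k => F (e.set x k) :=
  EdgeList.forRange x ((Num.var d).add (Num.const c))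
    (fun e => by simp only [Env.set, if_neg (show d ≠ x by omega)]) hF

theorem edgeList_gadgetEdges (hd : d = 0 ∨ d = 1) :
    EdgeList fun e => gadgetEdges σ (e.var d) (e.tab d) := by
  have h1 := EdgeList.forRange 2 (Num.const σ) (fun _ => rfl) <|
    EdgeList.forRange_var (x := 3) (c := 7) hd (by decide) <|
    EdgeList.forRange_var (x := 4) (c := 6) hd (by decide) <|
    EdgeList.forRange_var (x := 5) (c := 6) hd (by decide) <| edgeList_posEdges σ hd
  have h2 := EdgeList.forRange_var (x := 3) (c := 7) hd (by decide) <|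
    EdgeList.single ((num_posCount σ hd).add (Num.var 3)) ((num_posCount σ hd).add
      (((Num.var d).add (Num.const 7)).add ((num_colCount σ hd).add (Num.const (σ * 2)))))
  have h3 := EdgeList.forRange 2 (Num.const σ) (fun _ => rfl) <|
    EdgeList.forRange_var (x := 4) (c := 6) hd (by decide) <|
    EdgeList.forRange_var (x := 5) (c := 6) hd (by decide) <| edgeList_colEdges σ hd
  refine ((h1.append h2).append h3).congr fun e => ?_
  have hd' : ∀ x, 2 ≤ x → d ≠ x := by omega
  simp [Env.set, gadgetEdges, hd' 2, hd' 3, hd' 4, hd' 5]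

end Emission

end ILPGraphs

namespace ILPGraphs

/-! ### The code of the gadget graph -/

/-- The edges of a list that join nodes of number less than `N`. -/
def finEdges (N : ℕ) (L : List (ℕ × ℕ)) : List (Fin N × Fin N) :=
  L.filterMap fun p => if h : p.1 < N ∧ p.2 < N then some (⟨p.1, h.1⟩, ⟨p.2, h.2⟩) else none

theorem mem_finEdges {N : ℕ} {L : List (ℕ × ℕ)} {i j : Fin N} :
    (i, j) ∈ finEdges N L ↔ ((i : ℕ), (j : ℕ)) ∈ L := by
  simp only [finEdges, List.mem_filterMap, Option.dite_none_right_eq_some, Option.some.injEq,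
    Prod.mk.injEq]
  constructor
  · rintro ⟨⟨a, b⟩, h, _, rfl, rfl⟩
    exact h
  · intro h
    exact ⟨_, h, ⟨i.2, j.2⟩, rfl, rfl⟩

/-- In general `finEdges` drops pairs that are out of range. If there are none, the list of numbers
that is output is exactly the edge list of the code. -/
theorem natEdges_finEdges {N : ℕ} {L : List (ℕ × ℕ)} (h : ∀ p ∈ L, p.1 < N ∧ p.2 < N) :
    GraphCode.natEdges ⟨N, finEdges N L⟩ = L := by
  induction L with
  | nil => rfl
  | cons p L ih =>
    have hp := h p (by simp)
    have := ih fun q hq => h q (by simp [hq])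
    simp only [GraphCode.natEdges, finEdges] at this ⊢
    rw [List.filterMap_cons, dif_pos hp, List.map_cons, this]

/-! ### Agreement of the numerical edge list with the gadget graph -/

section Membership

variable {σ n : ℕ}

theorem vertexNum_lt (u : PaddedVertex n) : vertexNum u < n + 6 := by
  rw [← vertexEquiv_val]; exact Fin.isLt _

theorem vertexNum_inj {u v : PaddedVertex n} : vertexNum u = vertexNum v ↔ u = v := by
  rw [← vertexEquiv_val, ← vertexEquiv_val, ← Fin.ext_iff, (vertexEquiv n).injective.eq_iff]

theorem exists_vertexNum {k : ℕ} (h : k < n + 6) : ∃ u : PaddedVertex n, vertexNum u = k := by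
  obtain ⟨u, hu⟩ := (vertexEquiv n).surjective ⟨k, h⟩
  exact ⟨u, by rw [← vertexEquiv_val, hu]⟩

theorem rowNum_lt (i : Option (PaddedVertex n)) : rowNum i < n + 7 := by
  rw [← rowEquiv_val]; exact Fin.isLt _

theorem exists_rowNum {k : ℕ} (h : k < n + 7) :
    ∃ i : Option (PaddedVertex n), rowNum i = k := by
  obtain ⟨u, hu⟩ := (rowEquiv n).surjective ⟨k, h⟩
  exact ⟨u, by rw [← rowEquiv_val, hu]⟩

theorem isMarked_iff_num {u v : PaddedVertex n} :
    IsMarked u v ↔ vertexNum u = vertexNum v ∧ n ≤ vertexNum u := by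
  rw [vertexNum_inj, IsMarked]
  refine and_congr_right fun _ => ?_
  rcases u with a | k
  · simp [vertexNum]
  · simp [vertexNum]

/-- Listed loops are ignored by the graph, so `u ≠ v` is necessary. In `IsTwo` the case `u = v` is a
separate alternative, which is why the numerical test is still correct. -/
theorem graph_adj_iff_num {x : GraphCode} {u v : PaddedVertex x.n} (huv : u ≠ v) :
    (∃ a b, u = .inl a ∧ v = .inl b ∧ x.graph.Adj a b) ↔
      ∃ p ∈ x.natEdges, (p.1 = vertexNum u ∧ p.2 = vertexNum v) ∨
        (p.1 = vertexNum v ∧ p.2 = vertexNum u) := by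
  constructor
  · rintro ⟨a, b, rfl, rfl, h⟩
    rw [GraphCode.graph, SimpleGraph.fromRel_adj] at h
    rcases h.2 with h | h
    · exact ⟨_, List.mem_map.2 ⟨_, h, rfl⟩, .inl ⟨rfl, rfl⟩⟩
    · exact ⟨_, List.mem_map.2 ⟨_, h, rfl⟩, .inr ⟨rfl, rfl⟩⟩
  · rintro ⟨p, hp, h⟩
    obtain ⟨⟨a, b⟩, hab, rfl⟩ := List.mem_map.1 hp
    have ha : (a : ℕ) = vertexNum (.inl a : PaddedVertex x.n) := rfl
    have hb : (b : ℕ) = vertexNum (.inl b : PaddedVertex x.n) := rfl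
    simp only [ha, hb, vertexNum_inj] at h
    rcases h with ⟨rfl, rfl⟩ | ⟨rfl, rfl⟩
    · exact ⟨a, b, rfl, rfl, (SimpleGraph.fromRel_adj _ _ _).2
        ⟨fun h => huv (congrArg _ h), .inl hab⟩⟩
    · exact ⟨b, a, rfl, rfl, (SimpleGraph.fromRel_adj _ _ _).2
        ⟨fun h => huv (congrArg _ h), .inr hab⟩⟩

theorem isTwo_iff_num {x : GraphCode} {i : Option (PaddedVertex x.n)} {u v : PaddedVertex x.n} :
    IsTwo x.graph i u v ↔
      IsTwoNum x.n x.natEdges (rowNum i) (vertexNum u) (vertexNum v) := by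
  have hu := vertexNum_lt u
  have hv := vertexNum_lt v
  cases i with
  | none =>
    rw [IsTwo, isMarked_iff_num, IsTwoNum]
    simp only [rowNum, hu.ne', hv.ne', or_self, false_and, false_or, true_and]
  | some i =>
    have hi := vertexNum_lt i
    rw [IsTwo, IsTwoNum]
    simp only [rowNum, hi.ne, false_and, or_false, vertexNum_inj]
    refine and_congr_right fun _ => ?_
    by_cases huv : u = v
    · simp [huv]
    · rw [graph_adj_iff_num huv]

open Classical in
theorem mem_gadgetEdges {x : GraphCode} {p : ℕ × ℕ} : p ∈ gadgetEdges σ x.n x.natEdges ↔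
    ∃ a b, GadgetEdge σ x.graph a b ∧ p = (a.num, b.num) := by
  constructor
  · intro h
    simp only [gadgetEdges, posEdges, colEdges, List.mem_append, List.mem_flatMap, List.mem_range,
      List.mem_singleton] at h
    rcases h with (⟨s, hs, i, hi, u, hu, v, hv, h⟩ | ⟨i, hi, h⟩) | ⟨s, hs, u, hu, v, hv, h⟩
    · obtain ⟨i, rfl⟩ := exists_rowNum hi
      obtain ⟨u, rfl⟩ := exists_vertexNum hu
      obtain ⟨v, rfl⟩ := exists_vertexNum hv
      rcases h with ((rfl | rfl) | rfl) | ⟨s', hs', rfl⟩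
      · exact ⟨.pos ⟨s, hs⟩ i u v, .row i, .pos_row .., rfl⟩
      · exact ⟨.pos ⟨s, hs⟩ i u v, .col ⟨s, hs⟩ u v, .pos_col .., rfl⟩
      · rw [← isTwo_iff_num]
        by_cases h : IsTwo x.graph i u v
        · exact ⟨.pos ⟨s, hs⟩ i u v, .kap ⟨s, hs⟩ true, .pos_kap _ _ _ _ _ (by simpa using h),
            by rw [if_pos h]; rfl⟩
        · exact ⟨.pos ⟨s, hs⟩ i u v, .kap ⟨s, hs⟩ false, .pos_kap _ _ _ _ _ (by simpa using h),
            by rw [if_neg h]; rfl⟩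
      · exact ⟨.pos ⟨s', hs'.trans hs⟩ i u v, .pos ⟨s, hs⟩ i u v, .pos_pos _ _ _ _ _ hs', rfl⟩
    · obtain ⟨i, rfl⟩ := exists_rowNum hi
      exact ⟨.row i, .lam, .row_lam _, h⟩
    · obtain ⟨u, rfl⟩ := exists_vertexNum hu
      obtain ⟨v, rfl⟩ := exists_vertexNum hv
      rcases h with rfl | ⟨s', hs', rfl⟩
      · by_cases h : vertexNum u = vertexNum v ∧ x.n ≤ vertexNum u
        · exact ⟨.col ⟨s, hs⟩ u v, .mu ⟨s, hs⟩ true,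
            .col_mu _ _ _ _ (by simpa using isMarked_iff_num.2 h), by rw [if_pos h]; rfl⟩
        · exact ⟨.col ⟨s, hs⟩ u v, .mu ⟨s, hs⟩ false,
            .col_mu _ _ _ _ (by simpa using mt isMarked_iff_num.1 h), by rw [if_neg h]; rfl⟩
      · exact ⟨.col ⟨s', hs'.trans hs⟩ u v, .col ⟨s, hs⟩ u v, .col_col _ _ _ _ hs', rfl⟩
  · rintro ⟨a, b, h, rfl⟩
    have htoNat : ∀ {t : Bool} {c : Prop}, (t = true ↔ c) → t.toNat = if c then 1 else 0 := by
      intro t c h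
      cases t <;> simp [← h]
    have hpos : ∀ (s : Fin σ) (i : Option (PaddedVertex x.n)) (u v : PaddedVertex x.n) q,
        q ∈ posEdges σ x.n x.natEdges s (rowNum i) (vertexNum u) (vertexNum v) → q ∈ gadgetEdges σ x.n x.natEdges := by
      intro s i u v q hq
      simp only [gadgetEdges, List.mem_append, List.mem_flatMap, List.mem_range]
      exact .inl (.inl ⟨s, s.2, _, rowNum_lt i, _, vertexNum_lt u, _, vertexNum_lt v, hq⟩)
    have hcol : ∀ (s : Fin σ) (u v : PaddedVertex x.n) q, q ∈ colEdges σ x.n s (vertexNum u)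
        (vertexNum v) → q ∈ gadgetEdges σ x.n x.natEdges := by
      intro s u v q hq
      simp only [gadgetEdges, List.mem_append, List.mem_flatMap, List.mem_range]
      exact .inr ⟨s, s.2, _, vertexNum_lt u, _, vertexNum_lt v, hq⟩
    cases h with
    | pos_row s i u v =>
      refine hpos s i u v _ ?_
      simp only [posEdges, List.mem_append, List.mem_singleton]
      exact .inl (.inl (.inl rfl))
    | pos_col s i u v =>
      refine hpos s i u v _ ?_
      simp only [posEdges, List.mem_append, List.mem_singleton]
      exact .inl (.inl (.inr rfl))
    | pos_kap s i u v t h =>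
      refine hpos s i u v _ ?_
      simp only [posEdges, List.mem_append, List.mem_singleton, ← isTwo_iff_num, ← htoNat h]
      exact .inl (.inr rfl)
    | row_lam i =>
      simp only [gadgetEdges, List.mem_append, List.mem_flatMap, List.mem_range,
        List.mem_singleton]
      exact .inl (.inr ⟨_, rowNum_lt i, rfl⟩)
    | col_mu s u v t h =>
      refine hcol s u v _ ?_
      simp only [colEdges, List.mem_append, List.mem_singleton, ← isMarked_iff_num, ← htoNat h]
      exact .inl rfl
    | pos_pos s s' i u v h =>
      refine hpos s' i u v _ ?_
      simp only [posEdges, List.mem_append, List.mem_singleton, List.mem_flatMap, List.mem_range]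
      exact .inr ⟨s, h, rfl⟩
    | col_col s s' u v h =>
      refine hcol s' u v _ ?_
      simp only [colEdges, List.mem_append, List.mem_singleton, List.mem_flatMap, List.mem_range]
      exact .inr ⟨s, h, rfl⟩

end Membership

/-! ### The code and the labels of the gadget graph -/

section Codes

variable (σ : ℕ) (x : GraphCode)

/-- The code of the gadget graph. -/
noncomputable def gadgetCode : GraphCode :=
  ⟨gadgetSize σ x.n, finEdges _ (gadgetEdges σ x.n x.natEdges)⟩

/-- The code of the labeled gadget graph. -/
noncomputable def labeledGadgetCode : LabeledGraphCode where
  toGraphCode := gadgetCode σ x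
  label k := ((GadgetNode.numbering σ x.n).symm k).label

theorem GadgetNode.num_lt {σ n : ℕ} (a : GadgetNode σ n) : a.num < gadgetSize σ n := by
  rw [← GadgetNode.numbering_val]; exact Fin.isLt _

theorem natEdges_gadgetCode : (gadgetCode σ x).natEdges = gadgetEdges σ x.n x.natEdges := by
  refine natEdges_finEdges fun p hp => ?_
  obtain ⟨a, b, -, rfl⟩ := mem_gadgetEdges.1 hp
  exact ⟨a.num_lt, b.num_lt⟩

/-- The code of the gadget graph presents the gadget graph. -/
noncomputable def gadgetCodeIso : gadget σ x.graph ≃g (gadgetCode σ x).graph :=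
  isoOfEdges (GadgetNode.numbering σ x.n) (GadgetNode.numbering σ x.n).bijective
    (fun a b h => by
      refine mem_finEdges.2 ?_
      rw [GadgetNode.numbering_val, GadgetNode.numbering_val]
      exact mem_gadgetEdges.2 ⟨a, b, h, rfl⟩)
    (fun i j h => by
      obtain ⟨a, b, hab, h⟩ := mem_gadgetEdges.1 (mem_finEdges.1 h)
      rw [Prod.mk.injEq] at h
      exact ⟨a, b, Fin.ext ((GadgetNode.numbering_val a).trans h.1.symm),
        Fin.ext ((GadgetNode.numbering_val b).trans h.2.symm), hab⟩)

/-- The numbering treats the kinds of nodes one after the other, so the list of labels splits into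
one block for each kind. -/
theorem ofFn_sumNumbering {α β γ : Type} {m k : ℕ} (e : α ≃ Fin m) (f : β ≃ Fin k)
    (g : α ⊕ β → γ) : (List.ofFn fun i => g ((sumNumbering e f).symm i)) =
      (List.ofFn fun i => g (.inl (e.symm i))) ++ List.ofFn fun i => g (.inr (f.symm i)) := by
  rw [List.ofFn_add]
  congr 1
  · congr 1; funext i
    congr 1
    rw [Equiv.symm_apply_eq]
    exact Fin.ext (by simp [sumNumbering_inl])
  · congr 1; funext i
    congr 1
    rw [Equiv.symm_apply_eq]
    exact Fin.ext (by simp [sumNumbering_inr])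

theorem ofFn_boolNumbering (c : ℕ) :
    (List.ofFn fun i => c + (2 * (((prodNumbering (Equiv.refl (Fin σ)) boolNumbering).symm i).1 : ℕ)
      + ((prodNumbering (Equiv.refl (Fin σ)) boolNumbering).symm i).2.toNat)) =
    (List.range (σ * 2)).map fun k => c + k := by
  refine List.ext_getElem (by simp) fun i h₁ h₂ => ?_
  rw [List.getElem_ofFn, List.getElem_map, List.getElem_range]
  set e := prodNumbering (Equiv.refl (Fin σ)) boolNumbering
  have hi : i < σ * 2 := by simpa using h₁
  have h := prodNumbering_val (Equiv.refl (Fin σ)) boolNumbering (e.symm ⟨i, hi⟩).1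
    (e.symm ⟨i, hi⟩).2
  rw [Prod.mk.eta, Equiv.apply_symm_apply, Equiv.refl_apply, boolNumbering_val] at h
  rw [Nat.mul_comm 2]
  exact congrArg _ h.symm

/-- The labels of the gadget graph. -/
def gadgetLabels (n : ℕ) : List ℕ :=
  List.replicate (posCount σ n) 0 ++ (List.replicate (n + 7) 1 ++
    (List.replicate (colCount σ n) 2 ++ ((List.range (σ * 2)).map (fun k => 3 + k) ++
      ([7] ++ (List.range (σ * 2)).map (fun k => 8 + k)))))

theorem ofFn_label : List.ofFn (labeledGadgetCode σ x).label = gadgetLabels σ x.n := by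
  rw [gadgetLabels, ← ofFn_boolNumbering, ← ofFn_boolNumbering]
  let f := fun y => GadgetNode.label ((GadgetNode.sumEquiv σ x.n).symm y)
  refine (ofFn_sumNumbering _ _ f).trans (congrArg₂ _ (List.ofFn_const _ _) ?_)
  refine (ofFn_sumNumbering _ _ fun y => f (.inr y)).trans (congrArg₂ _ (List.ofFn_const _ _) ?_)
  refine (ofFn_sumNumbering _ _ fun y => f (.inr (.inr y))).trans
    (congrArg₂ _ (List.ofFn_const _ _) ?_)
  refine (ofFn_sumNumbering _ _ fun y => f (.inr (.inr (.inr y)))).trans (congrArg₂ _ rfl ?_)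
  exact (ofFn_sumNumbering _ _ fun y => f (.inr (.inr (.inr (.inr y)))))

end Codes

end ILPGraphs

namespace ILPGraphs

/-! ### Graph isomorphism reduces to isomorphism of ILP graphs -/

section Hardness

variable (σ : ℕ)

/-- The code of the gadget graph as a bit string. -/
noncomputable def gadgetBits (n : ℕ) (T : List (ℕ × ℕ)) : List Bool :=
  unary (gadgetSize σ n) ++ tableCode (gadgetEdges σ n T) ++ [false]

theorem encode_gadgetCode (x : GraphCode) :
    (gadgetCode σ x).encode = gadgetBits σ x.n x.natEdges := by
  rw [GraphCode.encode_eq, natEdges_gadgetCode]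
  rfl

theorem emittable_gadgetBits {d : ℕ} (hd : d = 0 ∨ d = 1) :
    Emittable fun e => gadgetBits σ (e.var d) (e.tab d) := by
  have h : Num fun e => gadgetSize σ (e.var d) :=
    (num_posCount σ hd).add (((Num.var d).add (Num.const 7)).add ((num_colCount σ hd).add
      ((Num.const (σ * 2)).add ((Num.const 1).add (Num.const (σ * 2))))))
  exact (h.unary.append (edgeList_gadgetEdges σ hd)).append (Emittable.bit false)

theorem flatMap_replicate {α β : Type} (k : ℕ) (a : α) (f : α → List β) :
    (List.replicate k a).flatMap f = (List.range k).flatMap fun _ => f a := by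
  induction k with
  | zero => rfl
  | succ k ih =>
    rw [List.replicate_succ', List.range_succ, List.flatMap_append, List.flatMap_append, ih]
    simp

theorem emittable_gadgetLabels {d : ℕ} (hd : d = 0 ∨ d = 1) :
    Emittable fun e => (gadgetLabels σ (e.var d)).flatMap unary := by
  have hd2 : ∀ (e : Env) k, (e.set 2 k).var d = e.var d := fun e k => by
    simp only [Env.set, if_neg (show d ≠ 2 by omega)]
  have hconst : ∀ (h : Env → ℕ) (c : ℕ), Num h → (∀ e, h (e.set 2 0) = h e) →
      Emittable fun e => (List.replicate (h e) c).flatMap unary := fun h c hh hx =>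
    (Emittable.forRange 2 hh hx (Num.const c).unary).congr fun e => (flatMap_replicate _ _ _).symm
  have hrange : ∀ c : ℕ, Emittable fun _ =>
      ((List.range (σ * 2)).map fun k => c + k).flatMap unary := fun c =>
    (Emittable.forRange 2 (Num.const (σ * 2)) (fun _ => rfl)
      ((Num.const c).add (Num.var 2)).unary).congr fun e => by
        rw [List.flatMap_map]; rfl
  have h := (hconst _ 0 (num_posCount σ hd) fun e => by rw [hd2]).append
    ((hconst _ 1 ((Num.var d).add (Num.const 7)) fun e => by rw [hd2]).append
    ((hconst _ 2 (num_colCount σ hd) fun e => by rw [hd2]).append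
    ((hrange 3).append ((Num.const 7).unary.append (hrange 8)))))
  refine h.congr fun e => ?_
  simp only [gadgetLabels, List.flatMap_append, List.flatMap_singleton]

theorem polyTime_gadgetCode : Nonempty (Turing.TM2ComputableInPolyTime encodePair encodePair
    fun p => (gadgetCode σ p.1, gadgetCode σ p.2)) := by
  refine polyTime_of_emittable_pair ((emittable_gadgetBits σ (d := 0) (.inl rfl)).append
    (emittable_gadgetBits σ (d := 1) (.inr rfl))) fun p => ?_
  rw [encodePair, encode_gadgetCode, encode_gadgetCode]
  rfl

theorem encode_labeledGadgetCode (x : GraphCode) : (labeledGadgetCode σ x).encode =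
    gadgetBits σ x.n x.natEdges ++ (gadgetLabels σ x.n).flatMap unary := by
  rw [LabeledGraphCode.encode, ofFn_label]
  exact congrArg (· ++ _) (encode_gadgetCode σ x)

theorem polyTime_labeledGadgetCode :
    Nonempty (Turing.TM2ComputableInPolyTime encodePair encodeLabeledPair
      fun p => (labeledGadgetCode σ p.1, labeledGadgetCode σ p.2)) := by
  refine polyTime_of_emittable_pair (((emittable_gadgetBits σ (d := 0) (.inl rfl)).append
    (emittable_gadgetLabels σ (d := 0) (.inl rfl))).append
    ((emittable_gadgetBits σ (d := 1) (.inr rfl)).append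
    (emittable_gadgetLabels σ (d := 1) (.inr rfl)))) fun p => ?_
  rw [encodeLabeledPair, encode_labeledGadgetCode, encode_labeledGadgetCode]
  rfl

variable {σ}

/-- The code of the gadget graph is isomorphic to a member of the class, which settles the promise.
Isomorphisms of graphs pass to gadgets by functoriality and come back by recognition. -/
theorem reduces_to_isomorphismProblem (hσ : σ ≤ 2) (s₀ : Fin σ) {C : Set (LabeledGraph Label)}
    (hC : ∀ (n : ℕ) (G : SimpleGraph (Fin n)), ∃ Γ ∈ C, ∃ e : gadget σ G ≃g Γ.graph,
      ∀ x, Γ.label (e x) = labelOf x.label) :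
    PolyReduces encodePair encodePair graphIsomorphism (isomorphismProblem C) := by
  refine ⟨_, polyTime_gadgetCode σ, fun p _ => ⟨⟨?_, ?_⟩, ⟨?_, ?_⟩⟩⟩
  · obtain ⟨Γ, hΓ, e, -⟩ := hC _ p.1.graph
    exact ⟨Γ, hΓ, ⟨(gadgetCodeIso σ p.1).symm.trans e⟩⟩
  · obtain ⟨Γ, hΓ, e, -⟩ := hC _ p.2.graph
    exact ⟨Γ, hΓ, ⟨(gadgetCodeIso σ p.2).symm.trans e⟩⟩
  · rintro ⟨e⟩
    exact ⟨((gadgetCodeIso σ p.1).symm.trans (gadgetIso σ e)).trans (gadgetCodeIso σ p.2)⟩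
  · rintro ⟨e⟩
    exact nonempty_iso_of_gadget hσ s₀
      (((gadgetCodeIso σ p.1).trans e).trans (gadgetCodeIso σ p.2).symm)

theorem label_gadgetCodeIso (x : GraphCode) (a : GadgetNode σ x.n) :
    (labeledGadgetCode σ x).label (gadgetCodeIso σ x a) = a.label :=
  congrArg GadgetNode.label ((GadgetNode.numbering σ x.n).symm_apply_apply a)

theorem label_gadgetCodeIso_symm (x : GraphCode) (k : Fin (gadgetCode σ x).n) :
    ((gadgetCodeIso σ x).symm k).label = (labeledGadgetCode σ x).label k := by
  rw [← label_gadgetCodeIso, RelIso.apply_symm_apply]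

theorem reduces_to_labeledIsomorphismProblem (hσ : σ ≤ 2) (s₀ : Fin σ)
    {C : Set (LabeledGraph Label)}
    (hC : ∀ (n : ℕ) (G : SimpleGraph (Fin n)), ∃ Γ ∈ C, ∃ e : gadget σ G ≃g Γ.graph,
      ∀ x, Γ.label (e x) = labelOf x.label) :
    PolyReduces encodePair encodeLabeledPair graphIsomorphism (labeledIsomorphismProblem C) := by
  refine ⟨_, polyTime_labeledGadgetCode σ, fun p _ => ⟨?_, ⟨?_, ?_⟩⟩⟩
  · obtain ⟨Γ₁, h₁, e₁, l₁⟩ := hC _ p.1.graph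
    obtain ⟨Γ₂, h₂, e₂, l₂⟩ := hC _ p.2.graph
    -- The labels are named by the inverse of `labelOf` on the numbers below 12. It is injective on
    -- the image of these numbers, which contains all labels of both graphs.
    have hinv : ∀ {n : ℕ} (a : GadgetNode σ n),
        Function.invFunOn labelOf (Set.Iio 12) (labelOf a.label) = a.label := fun a =>
      labelOf_injOn.leftInvOn_invFunOn (a.label_lt hσ)
    refine ⟨Γ₁, h₁, Γ₂, h₂, Function.invFunOn labelOf (Set.Iio 12), ?_,
      ⟨(gadgetCodeIso σ p.1).symm.trans e₁, fun k => ?_⟩,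
      ⟨(gadgetCodeIso σ p.2).symm.trans e₂, fun k => ?_⟩⟩
    · refine (labelOf_injOn.leftInvOn_invFunOn.rightInvOn_image).injOn.mono ?_
      rintro _ (⟨y, rfl⟩ | ⟨y, rfl⟩)
      · obtain ⟨a, rfl⟩ := e₁.surjective y
        exact ⟨_, a.label_lt hσ, (l₁ a).symm⟩
      · obtain ⟨a, rfl⟩ := e₂.surjective y
        exact ⟨_, a.label_lt hσ, (l₂ a).symm⟩
    · exact ((congrArg _ (l₁ _)).trans ((hinv _).trans (label_gadgetCodeIso_symm p.1 k))).symm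
    · exact ((congrArg _ (l₂ _)).trans ((hinv _).trans (label_gadgetCodeIso_symm p.2 k))).symm
  · rintro ⟨e⟩
    refine ⟨((gadgetCodeIso σ p.1).symm.trans (gadgetIso σ e)).trans (gadgetCodeIso σ p.2),
      fun k => ?_⟩
    exact (label_gadgetCodeIso p.2 _).trans
      ((GadgetNode.label_map _ _).trans (label_gadgetCodeIso_symm p.1 k))
  · rintro ⟨e, -⟩
    exact nonempty_iso_of_gadget hσ s₀
      (((gadgetCodeIso σ p.1).trans e).trans (gadgetCodeIso σ p.2).symm)

end Hardness

end ILPGraphs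

namespace ILPGraphs

/-! ### Elimination of labels -/

section LeafGraph

/-- The nodes of a graph, each with a number of leaves that encodes its label. -/
abbrev LeafNode {V : Type} (l : V → ℕ) : Type := V ⊕ Σ v : V, Fin (l v + 2)

variable {V V' : Type} {R : V → V → Prop} {R' : V' → V' → Prop} {l : V → ℕ} {l' : V' → ℕ}

/-- The edges of the graph with leaves. -/
inductive LeafEdge (R : V → V → Prop) (l : V → ℕ) : LeafNode l → LeafNode l → Prop
  | edge {a b : V} (h : R a b) : LeafEdge R l (.inl a) (.inl b)
  | leaf (v : V) (k : Fin (l v + 2)) : LeafEdge R l (.inl v) (.inr ⟨v, k⟩)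

/-- The graph with leaves. -/
def leafGraph (R : V → V → Prop) (l : V → ℕ) : SimpleGraph (LeafNode l) :=
  SimpleGraph.fromRel (LeafEdge R l)

theorem leafGraph_adj_inl {a b : V} :
    (leafGraph R l).Adj (.inl a) (.inl b) ↔ (SimpleGraph.fromRel R).Adj a b := by
  have key : ∀ a b, LeafEdge R l (.inl a) (.inl b) ↔ R a b := fun a b =>
    ⟨fun h => by cases h with | edge h => exact h, .edge⟩
  simp [leafGraph, SimpleGraph.fromRel_adj, key]

theorem leafGraph_adj_inr {y : LeafNode l} {p : Σ v, Fin (l v + 2)} :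
    (leafGraph R l).Adj (.inr p) y ↔ y = .inl p.1 := by
  rw [leafGraph, SimpleGraph.fromRel_adj]
  constructor
  · rintro ⟨-, h | h⟩
    · cases h
    · cases h with
      | leaf v k => rfl
  · rintro rfl
    exact ⟨by simp, .inr (.leaf p.1 p.2)⟩

/-- Label preserving isomorphisms extend to the graphs with leaves. -/
def leafGraphIso (e : SimpleGraph.fromRel R ≃g SimpleGraph.fromRel R')
    (he : ∀ v, l' (e v) = l v) : leafGraph R l ≃g leafGraph R' l' where
  toEquiv := e.toEquiv.sumCongr (e.toEquiv.sigmaCongr fun v => finCongr (by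
    rw [← he v]; rfl))
  map_rel_iff' := by
    rintro (a | a) (b | b)
    · exact leafGraph_adj_inl.trans (e.map_adj_iff.trans leafGraph_adj_inl.symm)
    · rw [SimpleGraph.adj_comm, SimpleGraph.adj_comm _ (Sum.inl a)]
      refine leafGraph_adj_inr.trans (Iff.trans ?_ leafGraph_adj_inr.symm)
      change Sum.inl (e a) = Sum.inl (e b.1) ↔ _
      rw [Sum.inl.injEq, Sum.inl.injEq, e.injective.eq_iff]
    · refine leafGraph_adj_inr.trans (Iff.trans ?_ leafGraph_adj_inr.symm)
      change Sum.inl (e b) = Sum.inl (e a.1) ↔ _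
      rw [Sum.inl.injEq, Sum.inl.injEq, e.injective.eq_iff]
    · refine leafGraph_adj_inr.trans (Iff.trans ?_ leafGraph_adj_inr.symm)
      exact iff_of_false (by rintro ⟨⟩) (by rintro ⟨⟩)

/-- If an old node were mapped to a leaf, two of its own leaves would both be mapped to the only
neighbor of that leaf. This is why even a node with label 0 gets two leaves. -/
theorem exists_leafGraph_map_inl (φ : leafGraph R l ≃g leafGraph R' l') (v : V) :
    ∃ w, φ (.inl v) = .inl w := by
  rcases h : φ (.inl v) with w | p
  · exact ⟨w, rfl⟩
  · have key : ∀ k : Fin (l v + 2), φ (.inr ⟨v, k⟩) = .inl p.1 := by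
      intro k
      rw [← leafGraph_adj_inr (R := R') (l := l'), ← h, φ.map_adj_iff, SimpleGraph.adj_comm,
        leafGraph_adj_inr]
    have := φ.injective ((key 0).trans (key 1).symm)
    simp at this

theorem exists_leafGraph_map_inr (φ : leafGraph R l ≃g leafGraph R' l') {v : V} {w : V'}
    (h : φ (.inl v) = .inl w) (k : Fin (l v + 2)) :
    ∃ k' : Fin (l' w + 2), φ (.inr ⟨v, k⟩) = .inr ⟨w, k'⟩ := by
  rcases h' : φ (.inr ⟨v, k⟩) with u | ⟨u, k'⟩
  · obtain ⟨a, ha⟩ := exists_leafGraph_map_inl φ.symm u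
    rw [← h', φ.symm_apply_apply] at ha
    cases ha
  · have : (leafGraph R' l').Adj (φ (.inr ⟨v, k⟩)) (φ (.inl v)) := by
      rw [φ.map_adj_iff, leafGraph_adj_inr]
    rw [h', h, leafGraph_adj_inr] at this
    cases this
    exact ⟨k', rfl⟩

/-- The leaves at `v` are mapped injectively to the leaves at `w`. Applied to the inverse as well,
this gives equality of labels. -/
theorem label_le_of_leafGraph (φ : leafGraph R l ≃g leafGraph R' l') {v : V} {w : V'}
    (h : φ (.inl v) = .inl w) : l v ≤ l' w := by
  choose f hf using exists_leafGraph_map_inr φ h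
  have hinj : Function.Injective f := by
    intro k k' hk
    have := φ.injective ((hf k).trans ((hk ▸ rfl : _ = _).trans (hf k').symm))
    simpa using this
  have := Fintype.card_le_of_injective f hinj
  simpa using this

/-- The labels can be recovered from the leaves. -/
theorem exists_iso_of_leafGraph (φ : leafGraph R l ≃g leafGraph R' l') :
    ∃ e : SimpleGraph.fromRel R ≃g SimpleGraph.fromRel R', ∀ v, l' (e v) = l v := by
  choose f hf using exists_leafGraph_map_inl φ
  choose g hg using exists_leafGraph_map_inl φ.symm
  have hgf : ∀ i, g (f i) = i := by
    intro i
    have := hg (f i)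
    rw [← hf, φ.symm_apply_apply] at this
    simpa using this.symm
  have hfg : ∀ i, f (g i) = i := by
    intro i
    have := hf (g i)
    rw [← hg, φ.apply_symm_apply] at this
    simpa using this.symm
  refine ⟨⟨⟨f, g, hgf, hfg⟩, ?_⟩, fun v => ?_⟩
  · intro a b
    change (SimpleGraph.fromRel R').Adj (f a) (f b) ↔ _
    rw [← leafGraph_adj_inl (l := l'), ← hf, ← hf, φ.map_adj_iff, leafGraph_adj_inl]
  · refine le_antisymm ?_ (label_le_of_leafGraph φ (hf v))
    have := label_le_of_leafGraph φ.symm (hg (f v))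
    rwa [hgf] at this

end LeafGraph

/-! #### The code of the graph with leaves -/

section LeafCode

/-- The number of leaves of the nodes before the node `v`, where the labels are given by a table. -/
def leafOffset (L : List (ℕ × ℕ)) (v : ℕ) : ℕ :=
  ((List.range L.length).map fun k => if k < v then (L.getD k (0, 0)).1 + 2 else 0).sum

/-- The number of leaves. -/
def leafCount (L : List (ℕ × ℕ)) : ℕ :=
  ((List.range L.length).map fun k => (L.getD k (0, 0)).1 + 2).sum

/-- The edges of the graph with leaves. -/
def leafEdges (n : ℕ) (T L : List (ℕ × ℕ)) : List (ℕ × ℕ) :=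
  T ++ (List.range L.length).flatMap fun v => (List.range ((L.getD v (0, 0)).1 + 2)).flatMap
    fun k => [(v, n + (leafOffset L v + k))]

/-- The code of the graph with leaves as a bit string. -/
def leafBits (n : ℕ) (T L : List (ℕ × ℕ)) : List Bool :=
  unary (n + leafCount L) ++ tableCode (leafEdges n T L) ++ [false]

theorem flatMap_replicate_sum {α : Type} (M : List α) (f : α → ℕ) :
    (M.flatMap fun a => List.replicate (f a) true) = List.replicate (M.map f).sum true := by
  induction M with
  | nil => rfl
  | cons a M ih => rw [List.flatMap_cons, ih, List.map_cons, List.sum_cons, List.replicate_add]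

theorem num_leafCount (t : ℕ) : Num fun e => leafCount (e.tab t) :=
  (Emittable.forTable t 10 11 12 ((Num.var 11).add (Num.const 2))).congr fun e =>
    flatMap_replicate_sum _ fun k => ((e.tab t).getD k (0, 0)).1 + 2

/-- This is evaluated inside loops over the variables 2 to 5, so its own loop uses 10 to 12. The sum
over all nodes with a condition avoids a loop whose bound depends on the node. -/
theorem num_leafOffset (t : ℕ) : Num fun e => leafOffset (e.tab t) (e.var 2) :=
  (Emittable.forTable t 10 11 12 (Num.ite (Testable.lt (Num.var 10) (Num.var 2))
    ((Num.var 11).add (Num.const 2)) (Num.const 0))).congr fun e =>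
    flatMap_replicate_sum _ fun k => if k < e.var 2 then ((e.tab t).getD k (0, 0)).1 + 2 else 0

theorem flatMap_getD (T : List (ℕ × ℕ)) :
    ((List.range T.length).flatMap fun k => [((T.getD k (0, 0)).1, (T.getD k (0, 0)).2)]) = T := by
  rw [← List.map_eq_flatMap]
  refine List.ext_getElem (by simp) fun i h₁ h₂ => ?_
  rw [List.getElem_map, List.getElem_range, List.getD_eq_getElem _ _ h₂]

theorem EdgeList.forTable (t x a b : ℕ) {F : Env → List (ℕ × ℕ)} (hF : EdgeList F)
    (hxa : x ≠ a := by decide) (hxb : x ≠ b := by decide) (hab : a ≠ b := by decide) :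
    EdgeList fun e => (List.range (e.tab t).length).flatMap fun k => F (((e.set x k).set a
      ((e.tab t).getD k (0, 0)).1).set b ((e.tab t).getD k (0, 0)).2) :=
  (Emittable.forTable t x a b hF hxa hxb hab).congr fun _ => (tableCode_flatMap _ _).symm

theorem EdgeList.table (t : ℕ) : EdgeList fun e => e.tab t :=
  (EdgeList.forTable t 2 3 4 (EdgeList.single (Num.var 3) (Num.var 4))).congr fun e =>
    congrArg tableCode (flatMap_getD (e.tab t))

theorem emittable_leafBits {d : ℕ} (hd : d = 0 ∨ d = 1) (t : ℕ) :
    Emittable fun e => leafBits (e.var d) (e.tab d) (e.tab t) := by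
  have h := EdgeList.forTable t 2 3 4 (EdgeList.forRange 5 ((Num.var 3).add (Num.const 2))
    (fun _ => rfl) (EdgeList.single (Num.var 2)
      ((Num.var d).add ((num_leafOffset t).add (Num.var 5)))))
  refine ((((Num.var d).add (num_leafCount t)).unary.append
    ((EdgeList.table d).append (h.congr fun e => ?_))).append (Emittable.bit false))
  rcases hd with rfl | rfl <;> rfl

variable (x : LabeledGraphCode)

/-- The table of labels. -/
def LabeledGraphCode.labels : List (ℕ × ℕ) := labelTable (List.ofFn x.label)

theorem LabeledGraphCode.length_labels : x.labels.length = x.n := by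
  simp [LabeledGraphCode.labels, labelTable]

theorem LabeledGraphCode.getD_labels {k : ℕ} (hk : k < x.n) :
    (x.labels.getD k (0, 0)).1 = x.label ⟨k, hk⟩ := by
  rw [List.getD_eq_getElem _ _ (by rwa [x.length_labels])]
  simp [LabeledGraphCode.labels, labelTable]

theorem sum_map_range (f : ℕ → ℕ) (n : ℕ) :
    ((List.range n).map f).sum = ∑ k ∈ Finset.range n, f k := by
  induction n with
  | zero => rfl
  | succ n ih => simp [List.range_succ, Finset.sum_range_succ, ih]

theorem leafCount_eq : leafCount x.labels = ∑ v, (x.label v + 2) := by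
  rw [leafCount, x.length_labels, sum_map_range, Finset.sum_range]
  exact Finset.sum_congr rfl fun v _ => by rw [x.getD_labels v.2]

/-- This is the form in which `finSigmaFinEquiv` describes the start of the block of `v`. -/
theorem leafOffset_eq (v : Fin x.n) :
    leafOffset x.labels v = ∑ i : Fin v, (x.label (Fin.castLE v.2.le i) + 2) := by
  rw [leafOffset, x.length_labels, sum_map_range, ← Finset.sum_filter]
  have h : (Finset.range x.n).filter (· < (v : ℕ)) = Finset.range v := by
    ext k
    simp only [Finset.mem_filter, Finset.mem_range]
    omega
  rw [h, Finset.sum_range]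
  exact Finset.sum_congr rfl fun i _ => by rw [x.getD_labels (i.2.trans v.2)]; rfl

/-- The numbering of the nodes of the graph with leaves. -/
def leafNumbering : LeafNode x.label ≃ Fin (x.n + ∑ v, (x.label v + 2)) :=
  sumNumbering (Equiv.refl _) finSigmaFinEquiv

theorem leafNumbering_inl (v : Fin x.n) : (leafNumbering x (.inl v) : ℕ) = v :=
  sumNumbering_inl _ _ _

theorem leafNumbering_inr (v : Fin x.n) (k : Fin (x.label v + 2)) :
    (leafNumbering x (.inr ⟨v, k⟩) : ℕ) = x.n + (leafOffset x.labels v + k) := by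
  rw [leafNumbering, sumNumbering_inr, finSigmaFinEquiv_apply, leafOffset_eq]

theorem mem_leafEdges {p : ℕ × ℕ} : p ∈ leafEdges x.n x.natEdges x.labels ↔
    ∃ a b, LeafEdge (fun i j => (i, j) ∈ x.edges) x.label a b ∧
      p = ((leafNumbering x a : ℕ), (leafNumbering x b : ℕ)) := by
  simp only [leafEdges, List.mem_append, List.mem_flatMap, List.mem_range, List.mem_singleton,
    x.length_labels]
  constructor
  · rintro (h | ⟨v, hv, k, hk, rfl⟩)
    · obtain ⟨⟨a, b⟩, hab, rfl⟩ := List.mem_map.1 h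
      exact ⟨.inl a, .inl b, .edge hab, by rw [leafNumbering_inl, leafNumbering_inl]⟩
    · rw [x.getD_labels hv] at hk
      exact ⟨.inl ⟨v, hv⟩, .inr ⟨⟨v, hv⟩, ⟨k, hk⟩⟩, .leaf _ _, by
        rw [leafNumbering_inl, leafNumbering_inr]⟩
  · rintro ⟨a, b, h, rfl⟩
    cases h with
    | edge h => exact .inl (List.mem_map.2 ⟨_, h, by rw [leafNumbering_inl, leafNumbering_inl]⟩)
    | leaf v k =>
      refine .inr ⟨v, v.2, k, ?_, by rw [leafNumbering_inl, leafNumbering_inr]⟩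
      rw [x.getD_labels v.2]
      exact k.2

/-- The code of the graph with leaves. -/
def leafCode : GraphCode :=
  ⟨x.n + ∑ v, (x.label v + 2), finEdges _ (leafEdges x.n x.natEdges x.labels)⟩

theorem encode_leafCode : (leafCode x).encode = leafBits x.n x.natEdges x.labels := by
  have h : (leafCode x).natEdges = leafEdges x.n x.natEdges x.labels := by
    refine natEdges_finEdges fun p hp => ?_
    obtain ⟨a, b, -, rfl⟩ := (mem_leafEdges x).1 hp
    exact ⟨Fin.isLt _, Fin.isLt _⟩
  rw [GraphCode.encode_eq, h, leafBits, leafCount_eq]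
  rfl

/-- The code of the graph with leaves presents the graph with leaves. -/
noncomputable def leafCodeIso :
    leafGraph (fun i j => (i, j) ∈ x.edges) x.label ≃g (leafCode x).graph :=
  isoOfEdges (leafNumbering x) (leafNumbering x).bijective
    (fun a b h => mem_finEdges.2 ((mem_leafEdges x).2 ⟨a, b, h, rfl⟩))
    (fun i j h => by
      obtain ⟨a, b, hab, h⟩ := (mem_leafEdges x).1 (mem_finEdges.1 h)
      rw [Prod.mk.injEq] at h
      exact ⟨a, b, Fin.ext h.1.symm, Fin.ext h.2.symm, hab⟩)

theorem polyTime_leafCode : Nonempty (Turing.TM2ComputableInPolyTime encodeLabeledPair encodePair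
    fun p => (leafCode p.1, leafCode p.2)) := by
  refine polyTime_of_emittable_labeledPair ((emittable_leafBits (d := 0) (.inl rfl) 2).append
    (emittable_leafBits (d := 1) (.inr rfl) 3)) fun p => ?_
  rw [encodePair, encode_leafCode, encode_leafCode]
  rfl

/-- Isomorphism of labeled graphs reduces to isomorphism of graphs. -/
theorem labeledIsomorphismProblem_reduces {L : Type} (C : Set (LabeledGraph L)) :
    PolyReduces encodeLabeledPair encodePair (labeledIsomorphismProblem C) graphIsomorphism := by
  refine ⟨_, polyTime_leafCode, fun p _ => ⟨trivial, ⟨?_, ?_⟩⟩⟩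
  · rintro ⟨e, he⟩
    exact ⟨((leafCodeIso p.1).symm.trans (leafGraphIso e he)).trans (leafCodeIso p.2)⟩
  · rintro ⟨φ⟩
    exact exists_iso_of_leafGraph (((leafCodeIso p.1).trans φ).trans (leafCodeIso p.2).symm)

end LeafCode

/-! ### Completeness -/

/-- Both problems ask the same question about the same instances; only the promise is dropped. -/
theorem isomorphismProblem_reduces {L : Type} (C : Set (LabeledGraph L)) :
    PolyReduces encodePair encodePair (isomorphismProblem C) graphIsomorphism :=
  ⟨id, ⟨Turing.idComputableInPolyTime _⟩, fun _ _ => ⟨trivial, Iff.rfl⟩⟩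

/-- A class that contains the gadget graphs is graph isomorphism complete, both with and without
labels. -/
theorem complete_of_gadget {σ : ℕ} (hσ : σ ≤ 2) (s₀ : Fin σ) {C : Set (LabeledGraph Label)}
    (hC : ∀ (n : ℕ) (G : SimpleGraph (Fin n)), ∃ Γ ∈ C, ∃ e : gadget σ G ≃g Γ.graph,
      ∀ x, Γ.label (e x) = labelOf x.label) :
    GraphIsomorphismComplete C ∧ LabeledGraphIsomorphismComplete C :=
  ⟨⟨reduces_to_isomorphismProblem hσ s₀ hC, isomorphismProblem_reduces C⟩,
    reduces_to_labeledIsomorphismProblem hσ s₀ hC, labeledIsomorphismProblem_reduces C⟩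

end ILPGraphs

theorem mainTheorem6 :
    (ILPGraphs.GraphIsomorphismComplete ILPGraphs.ilpGraphs ∧
      ILPGraphs.LabeledGraphIsomorphismComplete ILPGraphs.ilpGraphs) ∧
    (ILPGraphs.GraphIsomorphismComplete ILPGraphs.reducedILPGraphs ∧
      ILPGraphs.LabeledGraphIsomorphismComplete ILPGraphs.reducedILPGraphs) :=
  -- Two copies for ILP graphs, because of the twins, and one copy for reduced ILP graphs.
  ⟨ILPGraphs.complete_of_gadget le_rfl 0 fun _ => ILPGraphs.exists_ilpGraph,
    ILPGraphs.complete_of_gadget one_le_two 0 fun _ => ILPGraphs.exists_reducedILPGraph⟩
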